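/- **Theorem.** Let $n\ge 0$ be an integer, let $A_n$ be the $n$-th Weyl algebra over $\mathbb C$, with generators $x_i,\partial_i$ $(1\le i\le n)$ and relations $x_ix_j=x_jx_i$, $\partial_i\partial_j=\partial_j\partial_i$, $\partial_ix_j-x_j\partial_i=\delta_{ij}$, and let $\tilde A_n$ be the localization of $A_n$ at the multiplicative set generated by $x_1,\dots,x_n$ (the algebra of differential operators on the $n$-dimensional torus). Put $t_i=\partial_ix_i$. Let $W\in\{S_n,B_n,D_n\}$ act on $\tilde A_n$ by algebra automorphisms as follows: * $S_n$ permutes the indices of the $x_i$ and of the $\partial_i$ simultaneously; * $B_n$ is generated by $S_n$ and by $\varepsilon_1,\dots,\varepsilon_n$, where $\varepsilon_i(x_i)=-x_i^{-1}$, $\varepsilon_i(\partial_i)=x_i^2\partial_i$, and $\varepsilon_i$ fixes $x_j,\partial_j$ for $j\ne i$; * $D_n$ is generated by $S_n$ and by the products of an even number of distinct $\varepsilon_i$, where now $\varepsilon_i(x_i)=x_i^{-1}$, $\varepsilon_i(\partial_i)=-x_i^2\partial_i$, and $\varepsilon_i$ fixes $x_j,\partial_j$ for $j\ne i$. Let $U=\tilde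 A_n^W$ be the algebra of invariants and $\Gamma=\mathbb C[t_1,\dots,t_n]^W=\mathbb C[t_1,\dots,t_n]\cap U$. Then: 1. $\Gamma$ is a Harish-Chandra subalgebra of $U$: it is commutative and, for every $u\in U$, $\Gamma u\Gamma$ is finitely generated as a left and as a right $\Gamma$-module. 2. $U$ is a Galois order over $\Gamma$ in $\mathfrak K=(L*M)^G$. Here $L=\mathbb C(t_1,\dots,t_n)$ is the field of rational functions, containing $\Gamma$ through the embedding of $\mathbb C[t_1,\dots,t_n]\subset\tilde A_n$ in $L$ with $t_i\mapsto t_i$; $K=\operatorname{Frac}\Gamma\subseteq L$; $G=\operatorname{Gal}(L/K)$; $M\cong\mathbb Z^n$ is the group of the automorphisms $t_i\mapsto t_i-a_i$ of $L$ $(a\in\mathbb Z^n)$; $L*M$ is the skew monoid ring; and $G$ acts by $g\left(\sum_m r_m m\right)=\sum_m g(r_m)\,gmg^{-1}$. That is: $L/K$ is a finite Galois extension, $M$ is stable under conjugation by $G$, elements of $M$ with the same restriction to $K$ are equal, $U$ is generated as a ring by $\Gamma$ and finitely many elements, and there is an injective homomorphism of $\mathbb C$-algebras $U\to L*M$, equal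 on $\Gamma$ to the inclusion $\Gamma\subset L$, such that, identifying $U$ with its image, $KU=UK=\mathfrak K$ and, for every finite-dimensional left (respectively right) $K$-subspace $V\subseteq\mathfrak K$, $V\cap U$ is a finitely generated left (respectively right) $\Gamma$-module. 3. $U$ is free as a left $\Gamma$-module and as a right $\Gamma$-module. -/

import Mathlib

noncomputable section

/-! ## The Weyl algebra and its localization at the coordinates -/

/-- Generators of the Weyl algebra. -/
inductive WeylGen (n : ℕ) : Type
  | x (i : Fin n)
  | d (i : Fin n)

/-- Defining relations of the Weyl algebra: the `x i` commute, the `∂ i` commute, and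
`∂ i * x j - x j * ∂ i = δ i j`. -/
inductive WeylRel (n : ℕ) : FreeAlgebra ℂ (WeylGen n) → FreeAlgebra ℂ (WeylGen n) → Prop
  | x_comm (i j : Fin n) : WeylRel n
      (FreeAlgebra.ι ℂ (.x i) * FreeAlgebra.ι ℂ (.x j))
      (FreeAlgebra.ι ℂ (.x j) * FreeAlgebra.ι ℂ (.x i))
  | d_comm (i j : Fin n) : WeylRel n
      (FreeAlgebra.ι ℂ (.d i) * FreeAlgebra.ι ℂ (.d j))
      (FreeAlgebra.ι ℂ (.d j) * FreeAlgebra.ι ℂ (.d i))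
  | d_x (i j : Fin n) : WeylRel n
      (FreeAlgebra.ι ℂ (.d i) * FreeAlgebra.ι ℂ (.x j)
        - FreeAlgebra.ι ℂ (.x j) * FreeAlgebra.ι ℂ (.d i))
      (if i = j then 1 else 0)

/-- The `n`-th Weyl algebra `A_n` over `ℂ`. -/
def WeylAlgebra (n : ℕ) : Type := RingQuot (WeylRel n)

instance (n : ℕ) : Ring (WeylAlgebra n) := inferInstanceAs (Ring (RingQuot (WeylRel n)))

instance (n : ℕ) : Algebra ℂ (WeylAlgebra n) := inferInstanceAs (Algebra ℂ (RingQuot (WeylRel n)))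

namespace WeylAlgebra

/-- The projection from the free algebra. -/
def mk (n : ℕ) : FreeAlgebra ℂ (WeylGen n) →ₐ[ℂ] WeylAlgebra n := RingQuot.mkAlgHom ℂ (WeylRel n)

theorem mk_rel {n : ℕ} {a b : FreeAlgebra ℂ (WeylGen n)} (h : WeylRel n a b) : mk n a = mk n b :=
  RingQuot.mkAlgHom_rel ℂ h

theorem hom_ext {n : ℕ} {B : Type*} [Semiring B] [Algebra ℂ B] {f g : WeylAlgebra n →ₐ[ℂ] B}
    (h : f.comp (mk n) = g.comp (mk n)) : f = g :=
  RingQuot.ringQuot_ext' ℂ f g h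

/-- The homomorphism induced by a homomorphism out of the free algebra. -/
def desc {n : ℕ} {B : Type*} [Semiring B] [Algebra ℂ B] (f : FreeAlgebra ℂ (WeylGen n) →ₐ[ℂ] B)
    (h : ∀ ⦃a b⦄, WeylRel n a b → f a = f b) : WeylAlgebra n →ₐ[ℂ] B :=
  RingQuot.liftAlgHom ℂ ⟨f, h⟩

@[simp] theorem desc_mk {n : ℕ} {B : Type*} [Semiring B] [Algebra ℂ B]
    (f : FreeAlgebra ℂ (WeylGen n) →ₐ[ℂ] B) (h : ∀ ⦃a b⦄, WeylRel n a b → f a = f b)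
    (a : FreeAlgebra ℂ (WeylGen n)) : desc f h (mk n a) = f a :=
  RingQuot.liftAlgHom_mkAlgHom_apply ℂ f h a

/-- The generator `x i`. -/
def x {n : ℕ} (i : Fin n) : WeylAlgebra n :=
  mk n (FreeAlgebra.ι ℂ (.x i))

/-- The generator `∂ i`. -/
def d {n : ℕ} (i : Fin n) : WeylAlgebra n :=
  mk n (FreeAlgebra.ι ℂ (.d i))

theorem x_comm {n : ℕ} (i j : Fin n) : (x i : WeylAlgebra n) * x j = x j * x i := by
  simpa [x] using mk_rel (WeylRel.x_comm (n := n) i j)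

theorem d_comm {n : ℕ} (i j : Fin n) : (d i : WeylAlgebra n) * d j = d j * d i := by
  simpa [d] using mk_rel (WeylRel.d_comm (n := n) i j)

theorem d_x {n : ℕ} (i j : Fin n) :
    (d i : WeylAlgebra n) * x j - x j * d i = if i = j then 1 else 0 := by
  have h := mk_rel (WeylRel.d_x (n := n) i j)
  rw [map_sub, map_mul, map_mul, apply_ite (mk n), map_one,
    map_zero] at h
  exact h

end WeylAlgebra

/-- Generators of the localized Weyl algebra: those of the Weyl algebra, and formal inverses
`y i` of the `x i`. -/
inductive TorusGen (n : ℕ) : Type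
  | x (i : Fin n)
  | y (i : Fin n)
  | d (i : Fin n)

/-- Defining relations of the localized Weyl algebra: the relations of the Weyl algebra, and
`x i * y i = 1 = y i * x i`. -/
inductive TorusRel (n : ℕ) : FreeAlgebra ℂ (TorusGen n) → FreeAlgebra ℂ (TorusGen n) → Prop
  | x_comm (i j : Fin n) : TorusRel n
      (FreeAlgebra.ι ℂ (.x i) * FreeAlgebra.ι ℂ (.x j))
      (FreeAlgebra.ι ℂ (.x j) * FreeAlgebra.ι ℂ (.x i))
  | d_comm (i j : Fin n) : TorusRel n
      (FreeAlgebra.ι ℂ (.d i) * FreeAlgebra.ι ℂ (.d j))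
      (FreeAlgebra.ι ℂ (.d j) * FreeAlgebra.ι ℂ (.d i))
  | d_x (i j : Fin n) : TorusRel n
      (FreeAlgebra.ι ℂ (.d i) * FreeAlgebra.ι ℂ (.x j)
        - FreeAlgebra.ι ℂ (.x j) * FreeAlgebra.ι ℂ (.d i))
      (if i = j then 1 else 0)
  | x_y (i : Fin n) : TorusRel n (FreeAlgebra.ι ℂ (.x i) * FreeAlgebra.ι ℂ (.y i)) 1
  | y_x (i : Fin n) : TorusRel n (FreeAlgebra.ι ℂ (.y i) * FreeAlgebra.ι ℂ (.x i)) 1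

/-- The localization of the Weyl algebra `A_n` at the multiplicative set generated by
`x 1, …, x n`, i.e. the algebra of differential operators on the `n`-dimensional torus. It is
presented by adjoining inverses of the `x i`; the universal property of the localization is
`TorusWeyl.isUnit_ofWeyl` together with `TorusWeyl.existsUnique_extension`. -/
def TorusWeyl (n : ℕ) : Type := RingQuot (TorusRel n)

instance (n : ℕ) : Ring (TorusWeyl n) := inferInstanceAs (Ring (RingQuot (TorusRel n)))

instance (n : ℕ) : Algebra ℂ (TorusWeyl n) := inferInstanceAs (Algebra ℂ (RingQuot (TorusRel n)))

namespace TorusWeyl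

/-- The projection from the free algebra. -/
def mk (n : ℕ) : FreeAlgebra ℂ (TorusGen n) →ₐ[ℂ] TorusWeyl n := RingQuot.mkAlgHom ℂ (TorusRel n)

theorem mk_rel {n : ℕ} {a b : FreeAlgebra ℂ (TorusGen n)} (h : TorusRel n a b) : mk n a = mk n b :=
  RingQuot.mkAlgHom_rel ℂ h

theorem hom_ext {n : ℕ} {B : Type*} [Semiring B] [Algebra ℂ B] {f g : TorusWeyl n →ₐ[ℂ] B}
    (h : f.comp (mk n) = g.comp (mk n)) : f = g :=
  RingQuot.ringQuot_ext' ℂ f g h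

/-- The homomorphism induced by a homomorphism out of the free algebra. -/
def desc {n : ℕ} {B : Type*} [Semiring B] [Algebra ℂ B] (f : FreeAlgebra ℂ (TorusGen n) →ₐ[ℂ] B)
    (h : ∀ ⦃a b⦄, TorusRel n a b → f a = f b) : TorusWeyl n →ₐ[ℂ] B :=
  RingQuot.liftAlgHom ℂ ⟨f, h⟩

@[simp] theorem desc_mk {n : ℕ} {B : Type*} [Semiring B] [Algebra ℂ B]
    (f : FreeAlgebra ℂ (TorusGen n) →ₐ[ℂ] B) (h : ∀ ⦃a b⦄, TorusRel n a b → f a = f b)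
    (a : FreeAlgebra ℂ (TorusGen n)) : desc f h (mk n a) = f a :=
  RingQuot.liftAlgHom_mkAlgHom_apply ℂ f h a

/-- The coordinate `x i`. -/
def x {n : ℕ} (i : Fin n) : TorusWeyl n :=
  mk n (FreeAlgebra.ι ℂ (.x i))

/-- The inverse coordinate `(x i)⁻¹`. -/
def y {n : ℕ} (i : Fin n) : TorusWeyl n :=
  mk n (FreeAlgebra.ι ℂ (.y i))

/-- The derivation `∂ i`. -/
def d {n : ℕ} (i : Fin n) : TorusWeyl n :=
  mk n (FreeAlgebra.ι ℂ (.d i))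

/-- The element `t i = ∂ i * x i`. -/
def t {n : ℕ} (i : Fin n) : TorusWeyl n := d i * x i

theorem x_comm {n : ℕ} (i j : Fin n) : (x i : TorusWeyl n) * x j = x j * x i := by
  simpa [x] using mk_rel (TorusRel.x_comm (n := n) i j)

theorem d_comm {n : ℕ} (i j : Fin n) : (d i : TorusWeyl n) * d j = d j * d i := by
  simpa [d] using mk_rel (TorusRel.d_comm (n := n) i j)

theorem d_x {n : ℕ} (i j : Fin n) :
    (d i : TorusWeyl n) * x j - x j * d i = if i = j then 1 else 0 := by
  have h := mk_rel (TorusRel.d_x (n := n) i j)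
  rw [map_sub, map_mul, map_mul, apply_ite (mk n), map_one,
    map_zero] at h
  exact h

theorem x_y {n : ℕ} (i : Fin n) : (x i : TorusWeyl n) * y i = 1 := by
  simpa [x, y] using mk_rel (TorusRel.x_y (n := n) i)

theorem y_x {n : ℕ} (i : Fin n) : (y i : TorusWeyl n) * x i = 1 := by
  simpa [x, y] using mk_rel (TorusRel.y_x (n := n) i)

theorem algHom_ext {n : ℕ} {B : Type*} [Semiring B] [Algebra ℂ B] {f g : TorusWeyl n →ₐ[ℂ] B}
    (hx : ∀ i, f (x i) = g (x i)) (hy : ∀ i, f (y i) = g (y i)) (hd : ∀ i, f (d i) = g (d i)) :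
    f = g := by
  apply hom_ext
  apply FreeAlgebra.hom_ext
  funext a
  cases a with
  | x i => exact hx i
  | y i => exact hy i
  | d i => exact hd i

/-- The algebra homomorphism out of `TorusWeyl n` with prescribed values on the generators. -/
def lift {n : ℕ} {B : Type*} [Ring B] [Algebra ℂ B] (X Y D : Fin n → B)
    (hXX : ∀ i j, X i * X j = X j * X i) (hDD : ∀ i j, D i * D j = D j * D i)
    (hDX : ∀ i j, D i * X j - X j * D i = if i = j then 1 else 0)
    (hXY : ∀ i, X i * Y i = 1) (hYX : ∀ i, Y i * X i = 1) : TorusWeyl n →ₐ[ℂ] B :=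
  desc
    (FreeAlgebra.lift ℂ (fun a => match a with
      | .x i => X i
      | .y i => Y i
      | .d i => D i)) (by
      intro a b h
      cases h with
      | x_comm i j => simpa using hXX i j
      | d_comm i j => simpa using hDD i j
      | d_x i j =>
        have := hDX i j
        split_ifs at this ⊢ <;> simpa using this
      | x_y i => simpa using hXY i
      | y_x i => simpa using hYX i)

section lift

variable {n : ℕ} {B : Type*} [Ring B] [Algebra ℂ B] (X Y D : Fin n → B)
    (hXX : ∀ i j, X i * X j = X j * X i) (hDD : ∀ i j, D i * D j = D j * D i)
    (hDX : ∀ i j, D i * X j - X j * D i = if i = j then 1 else 0)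
    (hXY : ∀ i, X i * Y i = 1) (hYX : ∀ i, Y i * X i = 1)

@[simp] theorem lift_x (i : Fin n) : lift X Y D hXX hDD hDX hXY hYX (x i) = X i := by
  simp [lift, x]

@[simp] theorem lift_y (i : Fin n) : lift X Y D hXX hDD hDX hXY hYX (y i) = Y i := by
  simp [lift, y]

@[simp] theorem lift_d (i : Fin n) : lift X Y D hXX hDD hDX hXY hYX (d i) = D i := by
  simp [lift, d]

end lift

/-- The canonical homomorphism from the Weyl algebra to its localization. -/
def ofWeyl (n : ℕ) : WeylAlgebra n →ₐ[ℂ] TorusWeyl n :=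
  WeylAlgebra.desc
    (FreeAlgebra.lift ℂ (fun a => match a with
      | .x i => x i
      | .d i => d i)) (by
      intro a b h
      cases h with
      | x_comm i j => simpa using x_comm i j
      | d_comm i j => simpa using d_comm i j
      | d_x i j =>
        have := d_x i j
        split_ifs at this ⊢ <;> simpa using this)

@[simp] theorem ofWeyl_x {n : ℕ} (i : Fin n) : ofWeyl n (WeylAlgebra.x i) = x i := by
  simp [ofWeyl, WeylAlgebra.x]

@[simp] theorem ofWeyl_d {n : ℕ} (i : Fin n) : ofWeyl n (WeylAlgebra.d i) = d i := by
  simp [ofWeyl, WeylAlgebra.d]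

/-- The multiplicative set generated by the coordinates becomes invertible. -/
theorem isUnit_ofWeyl {n : ℕ} {s : WeylAlgebra n}
    (hs : s ∈ Submonoid.closure (Set.range (WeylAlgebra.x (n := n)))) :
    IsUnit (ofWeyl n s) := by
  induction hs using Submonoid.closure_induction with
  | mem s h =>
    obtain ⟨i, rfl⟩ := h
    rw [ofWeyl_x]
    exact ⟨⟨x i, y i, x_y i, y_x i⟩, rfl⟩
  | one => simp
  | mul a b _ _ ha hb => rw [map_mul]; exact ha.mul hb

/-- The localization is universal among algebras in which the multiplicative set generated by
the coordinates becomes invertible. -/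
theorem existsUnique_extension {n : ℕ} {B : Type*} [Ring B] [Algebra ℂ B]
    (f : WeylAlgebra n →ₐ[ℂ] B)
    (hf : ∀ s ∈ Submonoid.closure (Set.range (WeylAlgebra.x (n := n))), IsUnit (f s)) :
    ∃! F : TorusWeyl n →ₐ[ℂ] B, F.comp (ofWeyl n) = f := by
  have hu : ∀ i, ∃ b, f (WeylAlgebra.x i) * b = 1 ∧ b * f (WeylAlgebra.x i) = 1 := by
    intro i
    obtain ⟨u, hu⟩ := hf _ (Submonoid.subset_closure ⟨i, rfl⟩)
    exact ⟨↑u⁻¹, by rw [← hu]; simp, by rw [← hu]; simp⟩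
  choose Y hXY hYX using hu
  refine ⟨lift (fun i => f (WeylAlgebra.x i)) Y (fun i => f (WeylAlgebra.d i)) ?_ ?_ ?_ hXY hYX,
    ?_, ?_⟩
  · intro i j
    rw [← map_mul, WeylAlgebra.x_comm, map_mul]
  · intro i j
    rw [← map_mul, WeylAlgebra.d_comm, map_mul]
  · intro i j
    rw [← map_mul, ← map_mul, ← map_sub, WeylAlgebra.d_x, apply_ite f, map_one, map_zero]
  · apply WeylAlgebra.hom_ext
    apply FreeAlgebra.hom_ext
    funext a
    cases a with
    | x i =>
      change lift _ _ _ _ _ _ _ _ (ofWeyl n (WeylAlgebra.x i)) = f (WeylAlgebra.x i)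
      simp
    | d i =>
      change lift _ _ _ _ _ _ _ _ (ofWeyl n (WeylAlgebra.d i)) = f (WeylAlgebra.d i)
      simp
  · rintro F rfl
    apply algHom_ext
    · intro i; simp
    · intro i
      rw [lift_y]
      have h1 : F (y i) * F (x i) = 1 := by rw [← map_mul, y_x, map_one]
      have h2 := hXY i
      simp only [AlgHom.comp_apply, ofWeyl_x] at h2
      exact left_inv_eq_right_inv h1 h2
    · intro i; simp

/-! ### The actions of the classical groups -/

/-- The permutation action: `x i ↦ x (π i)`, `∂ i ↦ ∂ (π i)`. -/
def permHom {n : ℕ} (π : Equiv.Perm (Fin n)) : TorusWeyl n →ₐ[ℂ] TorusWeyl n :=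
  lift (fun i => x (π i)) (fun i => y (π i)) (fun i => d (π i))
    (fun _ _ => x_comm _ _) (fun _ _ => d_comm _ _)
    (fun i j => by rw [d_x]; simp) (fun _ => x_y _) (fun _ => y_x _)

/-- The permutation action, by automorphisms. -/
def perm {n : ℕ} (π : Equiv.Perm (Fin n)) : TorusWeyl n ≃ₐ[ℂ] TorusWeyl n :=
  AlgEquiv.ofAlgHom (permHom π) (permHom π⁻¹)
    (algHom_ext (by simp [permHom]) (by simp [permHom]) (by simp [permHom]))
    (algHom_ext (by simp [permHom]) (by simp [permHom]) (by simp [permHom]))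

@[simp] theorem perm_x {n : ℕ} (π : Equiv.Perm (Fin n)) (i : Fin n) :
    perm π (x i) = x (π i) := by simp [perm, permHom]

@[simp] theorem perm_d {n : ℕ} (π : Equiv.Perm (Fin n)) (i : Fin n) :
    perm π (d i) = d (π i) := by simp [perm, permHom]

theorem d_mul_x_self {n : ℕ} (i : Fin n) : (d i : TorusWeyl n) * x i = x i * d i + 1 := by
  have h := d_x i i
  rw [if_pos rfl] at h
  exact sub_eq_iff_eq_add'.mp h

theorem d_mul_x_of_ne {n : ℕ} {i j : Fin n} (h : i ≠ j) :
    (d i : TorusWeyl n) * x j = x j * d i := by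
  have h' := d_x i j
  rw [if_neg h] at h'
  exact sub_eq_zero.mp h'

theorem commute_y {n : ℕ} {a : TorusWeyl n} {i : Fin n} (h : a * x i = x i * a) :
    a * y i = y i * a := by
  calc a * y i = y i * (x i * a) * y i := by rw [← mul_assoc (y i), y_x, one_mul]
    _ = y i * a := by rw [← h, mul_assoc, mul_assoc, x_y, mul_one]

theorem d_mul_y_self {n : ℕ} (i : Fin n) :
    (d i : TorusWeyl n) * y i = y i * d i - y i * y i := by
  have h : y i * (d i * x i) * y i = y i * (x i * d i + 1) * y i := by rw [d_mul_x_self]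
  have e1 : y i * (d i * x i) * y i = y i * d i := by
    rw [mul_assoc, mul_assoc, x_y, mul_one]
  have e2 : y i * (x i * d i + 1) * y i = d i * y i + y i * y i := by
    rw [mul_add, add_mul, ← mul_assoc (y i), y_x, one_mul, mul_one]
  rw [e1, e2] at h
  rw [h]; abel

/-- Values of the sign change on `x i`. -/
def flipX {n : ℕ} (δ : ℤˣ) (s : Finset (Fin n)) (i : Fin n) : TorusWeyl n :=
  if i ∈ s then (δ : ℤ) • y i else x i

/-- Values of the sign change on `(x i)⁻¹`. -/
def flipY {n : ℕ} (δ : ℤˣ) (s : Finset (Fin n)) (i : Fin n) : TorusWeyl n :=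
  if i ∈ s then (δ : ℤ) • x i else y i

/-- Values of the sign change on `∂ i`. -/
def flipD {n : ℕ} (δ : ℤˣ) (s : Finset (Fin n)) (i : Fin n) : TorusWeyl n :=
  if i ∈ s then -((δ : ℤ) • (x i ^ 2 * d i)) else d i

theorem flipX_comm {n : ℕ} (δ : ℤˣ) (s : Finset (Fin n)) (i j : Fin n) :
    Commute (flipX δ s i) (flipX δ s j) := by
  have hxx : ∀ i j, Commute (x i : TorusWeyl n) (x j) := fun i j => x_comm i j
  have hxy : ∀ i j, Commute (x i : TorusWeyl n) (y j) := fun i j => commute_y (x_comm i j)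
  have hyy : ∀ i j, Commute (y i : TorusWeyl n) (y j) := fun i j => commute_y (hxy j i).symm
  have hyx : ∀ i j, Commute (y i : TorusWeyl n) (x j) := fun i j => (hxy j i).symm
  unfold flipX
  split_ifs
  · exact ((hyy i j).smul_left _).smul_right _
  · exact (hyx i j).smul_left _
  · exact (hxy i j).smul_right _
  · exact hxx i j

theorem flipD_flipX_of_ne {n : ℕ} (δ : ℤˣ) (s : Finset (Fin n)) {i j : Fin n} (h : i ≠ j) :
    Commute (flipD δ s i) (flipX δ s j) := by
  have hxx : Commute (x i : TorusWeyl n) (x j) := x_comm i j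
  have hxy : Commute (x i : TorusWeyl n) (y j) := commute_y (x_comm i j)
  have hdx : Commute (d i : TorusWeyl n) (x j) := d_mul_x_of_ne h
  have hdy : Commute (d i : TorusWeyl n) (y j) := commute_y hdx
  unfold flipD flipX
  split_ifs
  · exact ((((hxy.pow_left 2).mul_left hdy).smul_left _).neg_left).smul_right _
  · exact (((hxx.pow_left 2).mul_left hdx).smul_left _).neg_left
  · exact hdy.smul_right _
  · exact hdx

theorem flipD_comm {n : ℕ} (δ : ℤˣ) (s : Finset (Fin n)) (i j : Fin n) :
    Commute (flipD δ s i) (flipD δ s j) := by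
  rcases eq_or_ne i j with rfl | h
  · exact Commute.refl _
  have hdd : Commute (d i : TorusWeyl n) (d j) := d_comm i j
  have hxx : Commute (x i : TorusWeyl n) (x j) := x_comm i j
  have hdx : Commute (d i : TorusWeyl n) (x j) := d_mul_x_of_ne h
  have hxd : Commute (x i : TorusWeyl n) (d j) :=
    (show Commute (d j : TorusWeyl n) (x i) from d_mul_x_of_ne h.symm).symm
  have h1 : Commute (x i ^ 2 * d i : TorusWeyl n) (d j) := (hxd.pow_left 2).mul_left hdd
  have h2 : Commute (d i : TorusWeyl n) (x j ^ 2 * d j) := (hdx.pow_right 2).mul_right hdd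
  have h3 : Commute (x i ^ 2 * d i : TorusWeyl n) (x j ^ 2 * d j) :=
    Commute.mul_left (((hxx.pow_right 2).mul_right hxd).pow_left 2) h2
  unfold flipD
  split_ifs
  · exact (((h3.smul_left _).neg_left).smul_right _).neg_right
  · exact (h1.smul_left _).neg_left
  · exact (h2.smul_right _).neg_right
  · exact hdd

theorem flipX_flipY {n : ℕ} (δ : ℤˣ) (s : Finset (Fin n)) (i : Fin n) :
    flipX δ s i * flipY δ s i = 1 := by
  unfold flipX flipY
  split_ifs
  · rcases Int.units_eq_one_or δ with rfl | rfl <;> simp [y_x]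
  · exact x_y i

theorem flipY_flipX {n : ℕ} (δ : ℤˣ) (s : Finset (Fin n)) (i : Fin n) :
    flipY δ s i * flipX δ s i = 1 := by
  unfold flipX flipY
  split_ifs
  · rcases Int.units_eq_one_or δ with rfl | rfl <;> simp [x_y]
  · exact y_x i

theorem flipD_flipX {n : ℕ} (δ : ℤˣ) (s : Finset (Fin n)) (i j : Fin n) :
    flipD δ s i * flipX δ s j - flipX δ s j * flipD δ s i = if i = j then 1 else 0 := by
  split_ifs with h
  · subst h
    have e1 : (x i ^ 2 * d i * y i : TorusWeyl n) = x i * d i - 1 := by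
      rw [mul_assoc, d_mul_y_self, mul_sub, ← mul_assoc, ← mul_assoc, pow_two, mul_assoc (x i),
        x_y, mul_one, x_y]
    have e2 : (y i * (x i ^ 2 * d i) : TorusWeyl n) = x i * d i := by
      rw [pow_two, ← mul_assoc, ← mul_assoc, y_x, one_mul]
    unfold flipD flipX
    split_ifs
    · rcases Int.units_eq_one_or δ with rfl | rfl <;> simp [e1, e2]
    · rw [d_mul_x_self]; abel
  · exact sub_eq_zero.mpr (flipD_flipX_of_ne δ s h)

/-- The simultaneous sign change of the coordinates `i ∈ s`, with `δ = ±1`: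
`x i ↦ δ * (x i)⁻¹` and `∂ i ↦ -δ * (x i) ^ 2 * ∂ i` for `i ∈ s`, the other `x i` and `∂ i`
being fixed. -/
def flipHom {n : ℕ} (δ : ℤˣ) (s : Finset (Fin n)) : TorusWeyl n →ₐ[ℂ] TorusWeyl n :=
  lift (flipX δ s) (flipY δ s) (flipD δ s) (flipX_comm δ s) (flipD_comm δ s) (flipD_flipX δ s)
    (flipX_flipY δ s) (flipY_flipX δ s)

@[simp] theorem flipHom_x {n : ℕ} (δ : ℤˣ) (s : Finset (Fin n)) (i : Fin n) :
    flipHom δ s (x i) = flipX δ s i :=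
  lift_x ..

@[simp] theorem flipHom_y {n : ℕ} (δ : ℤˣ) (s : Finset (Fin n)) (i : Fin n) :
    flipHom δ s (y i) = flipY δ s i :=
  lift_y ..

@[simp] theorem flipHom_d {n : ℕ} (δ : ℤˣ) (s : Finset (Fin n)) (i : Fin n) :
    flipHom δ s (d i) = flipD δ s i :=
  lift_d ..

theorem flipHom_flipHom {n : ℕ} (δ : ℤˣ) (s : Finset (Fin n)) :
    (flipHom δ s).comp (flipHom δ s) = AlgHom.id ℂ (TorusWeyl n) := by
  have hyyx : ∀ i, (y i ^ 2 * (x i ^ 2 * d i) : TorusWeyl n) = d i := by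
    intro i
    rw [← mul_assoc, pow_two, pow_two, mul_assoc (y i), ← mul_assoc (y i) (x i), y_x, one_mul,
      y_x, one_mul]
  apply algHom_ext
  · intro i
    by_cases hi : i ∈ s <;> rcases Int.units_eq_one_or δ with rfl | rfl <;>
      simp [flipX, flipY, hi]
  · intro i
    by_cases hi : i ∈ s <;> rcases Int.units_eq_one_or δ with rfl | rfl <;>
      simp [flipX, flipY, hi]
  · intro i
    by_cases hi : i ∈ s <;> rcases Int.units_eq_one_or δ with rfl | rfl <;>
      simp [flipX, flipD, hi, hyyx]

/-- The simultaneous sign change of the coordinates `i ∈ s`, as an automorphism. -/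
def flip {n : ℕ} (δ : ℤˣ) (s : Finset (Fin n)) : TorusWeyl n ≃ₐ[ℂ] TorusWeyl n :=
  AlgEquiv.ofAlgHom (flipHom δ s) (flipHom δ s) (flipHom_flipHom δ s) (flipHom_flipHom δ s)

theorem flip_x {n : ℕ} (δ : ℤˣ) (s : Finset (Fin n)) (i : Fin n) :
    flip δ s (x i) = if i ∈ s then (δ : ℤ) • y i else x i := by
  simp [flip, flipX]

theorem flip_d {n : ℕ} (δ : ℤˣ) (s : Finset (Fin n)) (i : Fin n) :
    flip δ s (d i) = if i ∈ s then -((δ : ℤ) • (x i ^ 2 * d i)) else d i := by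
  simp [flip, flipD]

/-- The group `S_n` acting on the localized Weyl algebra by permutations of the indices. -/
def groupS (n : ℕ) : Subgroup (TorusWeyl n ≃ₐ[ℂ] TorusWeyl n) :=
  Subgroup.closure (Set.range perm)

/-- The group `B_n` acting on the localized Weyl algebra: it is generated by `S_n` and by the
sign changes `ε i` with `ε i (x i) = -(x i)⁻¹`, `ε i (∂ i) = (x i) ^ 2 * ∂ i`. -/
def groupB (n : ℕ) : Subgroup (TorusWeyl n ≃ₐ[ℂ] TorusWeyl n) :=
  Subgroup.closure (Set.range perm ∪ Set.range fun i => flip (-1) {i})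

/-- The group `D_n` acting on the localized Weyl algebra: it is generated by `S_n` and by the
products of an even number of the sign changes `ε i` with `ε i (x i) = (x i)⁻¹`,
`ε i (∂ i) = -(x i) ^ 2 * ∂ i`. -/
def groupD (n : ℕ) : Subgroup (TorusWeyl n ≃ₐ[ℂ] TorusWeyl n) :=
  Subgroup.closure (Set.range perm ∪ {g | ∃ s : Finset (Fin n), Even s.card ∧ g = flip 1 s})

/-- The algebra of invariants of a group of automorphisms of the localized Weyl algebra. -/
abbrev invariants {n : ℕ} (W : Subgroup (TorusWeyl n ≃ₐ[ℂ] TorusWeyl n)) :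
    Subalgebra ℂ (TorusWeyl n) :=
  FixedPoints.subalgebra ℂ (TorusWeyl n) W

/-- The subalgebra `ℂ[t 1, …, t n]` of the localized Weyl algebra. -/
def polynomials (n : ℕ) : Subalgebra ℂ (TorusWeyl n) :=
  Algebra.adjoin ℂ (Set.range t)

theorem t_mem_polynomials {n : ℕ} (i : Fin n) : t i ∈ polynomials n :=
  Algebra.subset_adjoin ⟨i, rfl⟩

/-- The subalgebra `ℂ[t 1, …, t n] ^ W` of the algebra of `W`-invariants, i.e. the `W`-invariant
elements of `ℂ[t 1, …, t n]`. -/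
def invariantPolynomials {n : ℕ} (W : Subgroup (TorusWeyl n ≃ₐ[ℂ] TorusWeyl n)) :
    Subalgebra ℂ (invariants W) :=
  (polynomials n).comap (invariants W).val

/-- The inclusion of `ℂ[t 1, …, t n] ^ W` in `ℂ[t 1, …, t n]`. -/
def invariantPolynomialsIncl {n : ℕ} (W : Subgroup (TorusWeyl n ≃ₐ[ℂ] TorusWeyl n)) :
    invariantPolynomials W →ₐ[ℂ] polynomials n :=
  (((invariants W).val.comp (invariantPolynomials W).val).codRestrict (polynomials n)
    fun γ => γ.2)

end TorusWeyl

/-! ## Harish-Chandra subalgebras and Galois orders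

A subalgebra `Γ` of an algebra `U` acts on `U` on the left by multiplication, and `Γ.op` acts on
`U` by multiplication on the right, so that `Γ.op`-modules are right `Γ`-modules. The same
convention is used for subrings. -/

/-- `Γ` is a Harish-Chandra subalgebra of `U`: it is commutative and, for all `u`, the bimodule
`Γ u Γ` is finitely generated as a left and as a right `Γ`-module. -/
structure IsHarishChandra {k U : Type*} [CommRing k] [Ring U] [Algebra k U]
    (Γ : Subalgebra k U) : Prop where
  comm : ∀ a ∈ Γ, ∀ b ∈ Γ, a * b = b * a
  fg_left : ∀ u : U, (Submodule.span Γ {v : U | ∃ a ∈ Γ, ∃ b ∈ Γ, v = a * u * b}).FG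
  fg_right : ∀ u : U, (Submodule.span Γ.op {v : U | ∃ a ∈ Γ, ∃ b ∈ Γ, v = a * u * b}).FG

section Galois

variable {k U L : Type*} [Field k] [Ring U] [Algebra k U] [Field L] [Algebra k L]

/-- The field of fractions of `Γ`, realized in a field `L` through an embedding `j` of `Γ`. -/
abbrev fracField {Γ : Subalgebra k U} (j : Γ →ₐ[k] L) : IntermediateField k L :=
  IntermediateField.adjoin k (Set.range j)

/-- The coefficient field `K ⊆ L` as a subring of the skew monoid ring `L * M`. -/
abbrev coeffRing (K : IntermediateField k L) (M : Submonoid (L ≃ₐ[k] L)) :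
    Subring (SkewMonoidAlgebra L M) :=
  K.toSubfield.toSubring.map SkewMonoidAlgebra.singleOneRingHom

/-- The set `(L * M) ^ G`, where `G = Gal(L / K)` acts on `L * M` through its action on `L` and
its action on `M` by conjugation, `g (∑ r_m m) = ∑ g (r_m) (g m g⁻¹)`. An element is invariant
when its coefficient at `g m g⁻¹` is `g` of its coefficient at `m`. -/
def skewInvariants (K : IntermediateField k L) (M : Submonoid (L ≃ₐ[k] L)) :
    Set (SkewMonoidAlgebra L M) :=
  {f | ∀ g ∈ K.fixingSubgroup, ∀ m m' : M, (m' : L ≃ₐ[k] L) = g * m * g⁻¹ →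
    f.coeff m' = g (f.coeff m)}

/-- `U` is a Galois ring over `Γ` in `(L * M) ^ G`, by means of the embeddings `j` of `Γ` in `L`
and `ι` of `U` in `L * M`. Here `K` is the field of fractions of `Γ`, the extension `L / K` is
finite and Galois with group `G`, and `M` is a monoid of automorphisms of `L`, stable under
conjugation by `G`, whose elements are determined by their restrictions to `K`. -/
structure IsGaloisRing (Γ : Subalgebra k U) (M : Submonoid (L ≃ₐ[k] L))
    (j : Γ →ₐ[k] L) (ι : U →ₐ[k] SkewMonoidAlgebra L M) : Prop where
  injective_coeff : Function.Injective j
  finiteDimensional : FiniteDimensional (fracField j) L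
  isGalois : IsGalois (fracField j) L
  conj_mem : ∀ g ∈ (fracField j).fixingSubgroup, ∀ m ∈ M, g * m * g⁻¹ ∈ M
  eq_of_restrict : ∀ m ∈ M, ∀ m' ∈ M, (∀ a ∈ fracField j, m a = m' a) → m = m'
  /-- `ι` is a homomorphism of `Γ`-rings. -/
  map_coeff : ∀ γ : Γ, ι (γ : U) = SkewMonoidAlgebra.single 1 (j γ)
  injective : Function.Injective ι
  /-- `U` is a finitely generated `Γ`-ring. -/
  finitelyGenerated : ∃ s : Finset U, Algebra.adjoin k ((Γ : Set U) ∪ (s : Set U)) = ⊤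
  /-- `K U = (L * M) ^ G`. -/
  span_left : (Submodule.span (coeffRing (fracField j) M) (Set.range ι) :
    Set (SkewMonoidAlgebra L M)) = skewInvariants (fracField j) M
  /-- `U K = (L * M) ^ G`. -/
  span_right : (Submodule.span (coeffRing (fracField j) M).op (Set.range ι) :
    Set (SkewMonoidAlgebra L M)) = skewInvariants (fracField j) M

/-- `U` is a left Galois order over `Γ`: it is a Galois ring, and `V ∩ U` is a finitely generated
left `Γ`-module for every finite dimensional left `K`-subspace `V` of `(L * M) ^ G`. -/
structure IsLeftGaloisOrder (Γ : Subalgebra k U) (M : Submonoid (L ≃ₐ[k] L))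
    (j : Γ →ₐ[k] L) (ι : U →ₐ[k] SkewMonoidAlgebra L M) : Prop
    extends IsGaloisRing Γ M j ι where
  fg_left : ∀ V : Submodule (coeffRing (fracField j) M) (SkewMonoidAlgebra L M), V.FG →
    (V : Set (SkewMonoidAlgebra L M)) ⊆ skewInvariants (fracField j) M →
    ∃ N : Submodule Γ U, (N : Set U) = ι ⁻¹' V ∧ N.FG

/-- `U` is a right Galois order over `Γ`: it is a Galois ring, and `V ∩ U` is a finitely generated
right `Γ`-module for every finite dimensional right `K`-subspace `V` of `(L * M) ^ G`. -/
structure IsRightGaloisOrder (Γ : Subalgebra k U) (M : Submonoid (L ≃ₐ[k] L))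
    (j : Γ →ₐ[k] L) (ι : U →ₐ[k] SkewMonoidAlgebra L M) : Prop
    extends IsGaloisRing Γ M j ι where
  fg_right : ∀ V : Submodule (coeffRing (fracField j) M).op (SkewMonoidAlgebra L M), V.FG →
    (V : Set (SkewMonoidAlgebra L M)) ⊆ skewInvariants (fracField j) M →
    ∃ N : Submodule Γ.op U, (N : Set U) = ι ⁻¹' V ∧ N.FG

/-- `U` is a Galois order over `Γ`: it is both a left and a right Galois order. -/
def IsGaloisOrder (Γ : Subalgebra k U) (M : Submonoid (L ≃ₐ[k] L))
    (j : Γ →ₐ[k] L) (ι : U →ₐ[k] SkewMonoidAlgebra L M) : Prop :=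
  IsLeftGaloisOrder Γ M j ι ∧ IsRightGaloisOrder Γ M j ι

end Galois

/-! ## The field `ℂ(t 1, …, t n)` and its group of shifts -/

/-- The field of rational functions `ℂ(t 1, …, t n)`. -/
abbrev RatFuncField (n : ℕ) : Type := FractionRing (MvPolynomial (Fin n) ℂ)

/-- The variable `t i` of the field of rational functions. -/
def ratVar {n : ℕ} (i : Fin n) : RatFuncField n :=
  algebraMap (MvPolynomial (Fin n) ℂ) (RatFuncField n) (MvPolynomial.X i)

/-- The group `ℤ ^ n` of shift automorphisms `t i ↦ t i - a i` (`a ∈ ℤ ^ n`) of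
`ℂ(t 1, …, t n)`, generated by the `σ i` with `σ i (t j) = t j - δ i j`. -/
def shiftMonoid (n : ℕ) : Submonoid (RatFuncField n ≃ₐ[ℂ] RatFuncField n) where
  carrier := {τ | ∃ a : Fin n → ℤ, ∀ i, τ (ratVar i) = ratVar i - (a i : RatFuncField n)}
  one_mem' := ⟨0, fun i => by simp⟩
  mul_mem' := by
    rintro τ τ' ⟨a, ha⟩ ⟨b, hb⟩
    refine ⟨a + b, fun i => ?_⟩
    rw [AlgEquiv.mul_apply, hb, map_sub, ha, map_intCast]
    push_cast [Pi.add_apply]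
    ring

end

/-! Put X_i = t_i − 1 = x_i∂_i and P = ℂ[X_1,…,X_n]. Each ε_i sends t_i to 2 − t_i, hence X_i to
−X_i, so in these coordinates W acts on P through a group H of signed permutations, and H is
generated by reflections.

Since x_i t_i = (t_i − 1)x_i, every element of the localized Weyl algebra is a sum of terms p_a x^a
with p_a ∈ P and a ∈ ℤ^n. The assignment t_i ↦ t_i, x_i ↦ cσ_i embeds the algebra in L*M, and the
image consists of all elements with coefficients in P (`toShift_injective`,
`mem_range_toShift_iff`). The scalar c is chosen with c² equal to the sign in ε_i(x_i) = ±x_i⁻¹;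
then the action of W becomes the semilinear conjugation action of H (`toShift_perm`,
`toShift_flip`). Thus U is the set of H-fixed elements of L*M with polynomial coefficients, and Γ =
P^H.

Freeness. With coefficients written on the left, U is, as a left Γ-module, the module of invariants
P[ℤ^n]^H of the diagonal action on the group algebra; with coefficients on the right the same holds
for the right structure. Chevalley's theorem gives a P^H-basis of P whose ℂ-span S is H-stable
(`exists_stable_basis`). Then P[ℤ^n] = P^H ⊗ (S ⊗ ℂ[ℤ^n]) with H acting on the second factor only,
and a ℂ-basis of (S ⊗ ℂ[ℤ^n])^H is a Γ-basis of U (`free_of_stable_basis`).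

Finiteness. P is a finite module over the Noetherian ring P^H, so a Γ-submodule of U whose elements
are all supported in one finite subset of M is finitely generated (`fg_left_of_support_subset`,
`fg_right_of_support_subset`). Multiplication by Γ or by K, on either side, does not enlarge
supports. This gives the Harish-Chandra property and the order condition. The equalities KU = UK =
(L*M)^G follow by clearing denominators with invariant polynomials.

Finite generation of U. Shifts do not change leading forms, so for the filtration by polynomial
degree the product of U agrees with that of the commutative algebra P[ℤ^n]^H up to lower degree. The
latter is finitely generated by Noether's theorem, and lifts of homogeneous generators generate U
(`exists_finset_adjoin_eq_top`). -/

noncomputable section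

set_option linter.unusedSectionVars false

open MvPolynomial

/-! ### Averaging over a finite group and Maschke's theorem -/

section Reynolds

variable (k G : Type*) {V : Type*} [Field k] [CharZero k] [Group G] [Fintype G]
  [AddCommGroup V] [Module k V] [DistribMulAction G V] [SMulCommClass G k V]

/-- The Reynolds operator, averaging over a finite group. -/
def reynolds : V →ₗ[k] V :=
  (Fintype.card G : k)⁻¹ • ∑ g : G, DistribSMul.toLinearMap k V g

theorem reynolds_apply (v : V) :
    reynolds k G v = (Fintype.card G : k)⁻¹ • ∑ g : G, g • v := by
  simp [reynolds]

theorem card_inv_smul_card_nsmul (v : V) :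
    (Fintype.card G : k)⁻¹ • (Fintype.card G • v) = v := by
  rw [← Nat.cast_smul_eq_nsmul k, smul_smul, inv_mul_cancel₀, one_smul]
  exact_mod_cast Fintype.card_ne_zero

variable {G}

theorem smul_reynolds (h : G) (v : V) : h • reynolds k G v = reynolds k G v := by
  rw [reynolds_apply, smul_comm, Finset.smul_sum]
  congr 1
  simp_rw [smul_smul]
  exact Fintype.sum_equiv (Equiv.mulLeft h) _ _ fun _ => rfl

theorem reynolds_eq_self {v : V} (hv : ∀ g : G, g • v = v) : reynolds k G v = v := by
  rw [reynolds_apply]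
  simp only [hv, Finset.sum_const, Finset.card_univ]
  exact card_inv_smul_card_nsmul k G v

theorem reynolds_mem {N : Submodule k V} {v : V} (hv : ∀ g : G, g • v ∈ N) :
    reynolds k G v ∈ N := by
  rw [reynolds_apply]
  exact N.smul_mem _ (N.sum_mem fun g _ => hv g)

theorem sub_reynolds_mem {N : Submodule k V} {v : V} (hv : ∀ g : G, v - g • v ∈ N) :
    v - reynolds k G v ∈ N := by
  have : v - reynolds k G v = (Fintype.card G : k)⁻¹ • ∑ g : G, (v - g • v) := by
    rw [Finset.sum_sub_distrib, smul_sub, ← reynolds_apply, Finset.sum_const, Finset.card_univ,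
      card_inv_smul_card_nsmul]
  rw [this]
  exact N.smul_mem _ (N.sum_mem fun g _ => hv g)

theorem reynolds_smul {A : Type*} [Monoid A] [DistribMulAction A V] [SMulCommClass G A V]
    [SMulCommClass k A V] (a : A) (v : V) : reynolds k G (a • v) = a • reynolds k G v := by
  simp_rw [reynolds_apply, smul_comm _ a v, ← Finset.smul_sum]
  rw [smul_comm]

variable (G) in
/-- Maschke's theorem, relative form: a stable subspace of a stable subspace has a stable
complement in it. -/
theorem exists_stable_complement {J W : Submodule k V} (hJW : J ≤ W)
    (hJ : ∀ (g : G), ∀ v ∈ J, g • v ∈ J) (hW : ∀ (g : G), ∀ v ∈ W, g • v ∈ W) :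
    ∃ H : Submodule k V, H ≤ W ∧ (∀ (g : G), ∀ v ∈ H, g • v ∈ H) ∧ H ⊓ J = ⊥ ∧ W ≤ H ⊔ J := by
  obtain ⟨p, hp⟩ := Submodule.exists_isCompl J
  set π : V →ₗ[k] V := J.subtype ∘ₗ J.projectionOnto p hp with hπ
  have hπmem : ∀ v, π v ∈ J := fun v => (J.projectionOnto p hp v).2
  have hπid : ∀ v ∈ J, π v = v := fun v hv => by
    have := Submodule.projectionOnto_apply_left hp ⟨v, hv⟩
    simp only [hπ, LinearMap.comp_apply, Submodule.subtype_apply]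
    rw [this]
  -- The average of the conjugates of an arbitrary projection onto J is an equivariant projection
  -- onto J; its kernel, cut down to W, is the required complement.
  let ρ : V →ₗ[k] V := (Fintype.card G : k)⁻¹ •
    ∑ g : G, DistribSMul.toLinearMap k V g ∘ₗ π ∘ₗ DistribSMul.toLinearMap k V g⁻¹
  have hρ : ∀ v, ρ v = (Fintype.card G : k)⁻¹ • ∑ g : G, g • π (g⁻¹ • v) := fun v => by simp [ρ]
  have hρmem : ∀ v, ρ v ∈ J := fun v => by
    rw [hρ]
    exact J.smul_mem _ (J.sum_mem fun g _ => hJ g _ (hπmem _))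
  have hρid : ∀ v ∈ J, ρ v = v := fun v hv => by
    rw [hρ]
    simp only [hπid _ (hJ _ v hv), smul_inv_smul, Finset.sum_const, Finset.card_univ]
    exact card_inv_smul_card_nsmul k G v
  have hρsmul : ∀ (h : G) v, ρ (h • v) = h • ρ v := fun h v => by
    rw [hρ, hρ, smul_comm h ((Fintype.card G : k)⁻¹) (∑ g : G, g • π (g⁻¹ • v))]
    congr 1
    rw [Finset.smul_sum]
    simp_rw [smul_smul]
    refine Fintype.sum_equiv (Equiv.mulLeft h⁻¹) _ _ fun g => ?_
    simp
  refine ⟨W ⊓ LinearMap.ker ρ, inf_le_left, ?_, ?_, ?_⟩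
  · rintro g v ⟨h1, h2⟩
    refine ⟨hW g v h1, ?_⟩
    rw [SetLike.mem_coe, LinearMap.mem_ker] at h2 ⊢
    rw [hρsmul, h2, smul_zero]
  · rw [eq_bot_iff]
    rintro v ⟨⟨_, h2⟩, h3⟩
    rw [SetLike.mem_coe, LinearMap.mem_ker] at h2
    rw [Submodule.mem_bot, ← hρid v h3, h2]
  · intro v hv
    rw [← sub_add_cancel v (ρ v)]
    refine Submodule.add_mem_sup ⟨W.sub_mem hv (hJW (hρmem v)), ?_⟩ (hρmem v)
    rw [SetLike.mem_coe, LinearMap.mem_ker, map_sub, hρid _ (hρmem v), sub_self]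

end Reynolds

/-! ### Nakayama's lemma through linear functionals -/

/-- With m the kernel of ε, a linear form that vanishes on mN but not on N sees A acting on N
through ε alone, because c − ε(c) lies in m. -/
theorem exists_functional_of_not_le {k A : Type*} [Field k] [CommRing A] [Algebra k A]
    (ε : A →ₐ[k] k) {N : Ideal A} (hN : ¬ N ≤ RingHom.ker ε * N) :
    ∃ f : A →ₗ[k] k, (∀ n ∈ N, ∀ c, f (c * n) = ε c * f n) ∧ ∃ n ∈ N, f n ≠ 0 := by
  obtain ⟨γ, hγ, hγ'⟩ := SetLike.not_le_iff_exists.mp hN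
  obtain ⟨f, hf1, hf2⟩ := Submodule.exists_le_ker_of_notMem
    (p := (RingHom.ker ε * N).restrictScalars k) (v := γ) hγ'
  refine ⟨f, fun n hn c => ?_, γ, hγ, hf1⟩
  have hc : c - algebraMap k A (ε c) ∈ RingHom.ker ε := by
    rw [RingHom.mem_ker, map_sub, AlgHom.commutes, Algebra.algebraMap_self_apply, sub_self]
  have h3 : (c - algebraMap k A (ε c)) * n ∈ RingHom.ker ε * N := Ideal.mul_mem_mul hc hn
  have h2 : f ((c - algebraMap k A (ε c)) * n) = 0 := hf2 h3
  rw [sub_mul, map_sub, sub_eq_zero, ← Algebra.smul_def,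
    map_smul] at h2
  exact h2

/-- Nakayama's lemma in a domain, tested on linear functionals. -/
theorem eq_zero_of_forall_functional {k A ι : Type*} [Field k] [CommRing A] [IsDomain A]
    [Algebra k A] (ε : A →ₐ[k] k) (l : ι →₀ A)
    (hl : ∀ f : A →ₗ[k] k, (∀ i c, f (c * l i) = ε c * f (l i)) → ∀ i, f (l i) = 0) : l = 0 := by
  classical
  let N : Ideal A := Ideal.span (l '' l.support)
  have hlN : ∀ i, l i ∈ N := fun i => by
    by_cases hi : i ∈ l.support
    · exact Ideal.subset_span ⟨i, hi, rfl⟩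
    · rw [Finsupp.notMem_support_iff.mp hi]
      exact zero_mem _
  have hN : N ≤ RingHom.ker ε * N := by
    by_contra hcon
    obtain ⟨f, hf, γ, hγ, hγ0⟩ := exists_functional_of_not_le ε hcon
    refine hγ0 ?_
    have h0 := hl f fun i => hf _ (hlN i)
    induction hγ using Submodule.span_induction with
    | mem n hn =>
      obtain ⟨i, _, rfl⟩ := hn
      exact h0 i
    | zero => exact map_zero f
    | add a b _ _ ha hb =>
      by_cases h : f a = 0
      · rw [map_add, h, zero_add] at hγ0
        rw [map_add, h, hb hγ0, zero_add]
      · exact absurd (ha h) h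
    | smul a n hn ih =>
      rw [smul_eq_mul, hf n hn]
      by_cases h : f n = 0
      · rw [h, mul_zero]
      · exact absurd (ih h) h
  -- The determinant form of Nakayama needs neither a local nor a Noetherian ring: some r ≡ 1 modulo
  -- the kernel of ε kills N. Such an r is nonzero, so N = 0 in a domain.
  obtain ⟨r, hr1, hr2⟩ := Submodule.exists_sub_one_mem_and_smul_eq_zero_of_fg_of_le_smul _ N
    ⟨l.support.image l, by rw [Finset.coe_image]⟩ hN
  have hr0 : r ≠ 0 := by
    rintro rfl
    rw [zero_sub, neg_mem_iff, RingHom.mem_ker, map_one] at hr1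
    exact one_ne_zero hr1
  ext i
  have := hr2 (l i) (hlN i)
  rw [smul_eq_mul, mul_eq_zero] at this
  exact this.resolve_left hr0

theorem homogeneousComponent_linearCombination_basis {σ k : Type*} [Field k]
    {H : ℕ → Submodule k (MvPolynomial σ k)}
    (hHW : ∀ d, H d ≤ homogeneousSubmodule σ k d) {κ : ℕ → Type*}
    (β : ∀ d, Module.Basis (κ d) k (H d)) (d : ℕ) (c : (Σ d, κ d) →₀ k) :
    homogeneousComponent d
      (Finsupp.linearCombination k (fun i => (β i.1 i.2 : MvPolynomial σ k)) c) =
      Finsupp.linearCombination k (fun j => (β d j : MvPolynomial σ k)) (c.split d) := by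
  classical
  induction c using Finsupp.induction_linear with
  | zero =>
    have : (0 : (Σ d, κ d) →₀ k).split d = 0 := by
      ext j
      rw [Finsupp.split_apply]
      rfl
    rw [map_zero, map_zero, this, map_zero]
  | add c c' hc hc' =>
    have : (c + c').split d = c.split d + c'.split d := by ext j; simp [Finsupp.split_apply]
    rw [map_add, map_add, hc, hc', this, map_add]
  | single i a =>
    rw [Finsupp.linearCombination_single, map_smul,
      homogeneousComponent_of_mem (hHW i.1 (β i.1 i.2).2)]
    obtain ⟨e, j⟩ := i
    rcases eq_or_ne d e with rfl | hde
    · have : (Finsupp.single (⟨d, j⟩ : Σ d, κ d) a).split d =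
          Finsupp.single j a := by
        ext j'
        rw [Finsupp.split_apply, Finsupp.single_apply, Finsupp.single_apply]
        simp
      rw [this, if_pos rfl, Finsupp.linearCombination_single]
    · have : (Finsupp.single (⟨e, j⟩ : Σ d, κ d) a).split d =
          0 := by
        ext j'
        rw [Finsupp.split_apply, Finsupp.single_apply, if_neg]
        · rfl
        · intro h
          exact hde (congrArg Sigma.fst h).symm
      rw [this, if_neg hde, smul_zero, map_zero]

/-! ### Chevalley's theorem for finite reflection groups -/

section Chevalley

universe u v

variable {σ : Type u} {k : Type v} {G : Type*} [Field k] [CharZero k] [Group G] [Fintype G]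
  [MulSemiringAction G (MvPolynomial σ k)] [SMulCommClass G k (MvPolynomial σ k)]

variable (σ k G) in
/-- The ideal generated by the invariant polynomials without constant term. -/
def hilbertIdeal : Ideal (MvPolynomial σ k) :=
  Ideal.span {p | (∀ g : G, g • p = p) ∧ constantCoeff p = 0}

theorem smul_mem_hilbertIdeal (g : G) {p : MvPolynomial σ k} (hp : p ∈ hilbertIdeal σ k G) :
    g • p ∈ hilbertIdeal σ k G := by
  unfold hilbertIdeal at hp
  induction hp using Submodule.span_induction with
  | mem p hp => rw [hp.1 g]; exact Ideal.subset_span hp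
  | zero => simp
  | add p q _ _ hp hq => rw [smul_add]; exact add_mem hp hq
  | smul a p _ hp =>
    rw [smul_eq_mul, smul_mul']
    exact Ideal.mul_mem_left _ _ hp

/-- Invariance modulo the ideal passes from generators to the group by 1 − ab = (1 − a) + a(1 − b),
since the ideal is stable. -/
theorem sub_smul_mem_hilbertIdeal_of_closure {R : Set G} (hR : Subgroup.closure R = ⊤)
    {p : MvPolynomial σ k} (h : ∀ r ∈ R, p - r • p ∈ hilbertIdeal σ k G) (g : G) :
    p - g • p ∈ hilbertIdeal σ k G := by
  have hg : g ∈ Subgroup.closure R := hR ▸ Subgroup.mem_top g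
  induction hg using Subgroup.closure_induction with
  | mem r hr => exact h r hr
  | one => simp
  | mul a b _ _ ha hb =>
    have := add_mem ha (smul_mem_hilbertIdeal a hb)
    rwa [smul_sub, sub_add_sub_cancel, smul_smul] at this
  | inv a _ ha =>
    have := neg_mem (smul_mem_hilbertIdeal a⁻¹ ha)
    rwa [smul_sub, inv_smul_smul, neg_sub] at this

section Homogeneous

variable (hG : ∀ (g : G) (p : MvPolynomial σ k) (d : ℕ), p.IsHomogeneous d → (g • p).IsHomogeneous d)
include hG

theorem smul_homogeneousComponent (g : G) (p : MvPolynomial σ k) (d : ℕ) :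
    g • homogeneousComponent d p = homogeneousComponent d (g • p) := by
  conv_rhs => rw [← sum_homogeneousComponent p, Finset.smul_sum, map_sum]
  by_cases hd : d ∈ Finset.range (p.totalDegree + 1)
  · rw [Finset.sum_eq_single d]
    · rw [homogeneousComponent_of_mem (hG g _ d (homogeneousComponent_isHomogeneous d p)), if_pos rfl]
    · intro e _ hed
      rw [homogeneousComponent_of_mem (hG g _ e (homogeneousComponent_isHomogeneous e p)),
        if_neg hed.symm]
    · exact fun h => absurd hd h
  · rw [homogeneousComponent_eq_zero, smul_zero, Finset.sum_eq_zero]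
    · intro e he
      rw [homogeneousComponent_of_mem (hG g _ e (homogeneousComponent_isHomogeneous e p)), if_neg]
      rintro rfl
      exact hd he
    · rw [Finset.mem_range] at hd
      omega

theorem totalDegree_smul_le (g : G) (p : MvPolynomial σ k) :
    (g • p).totalDegree ≤ p.totalDegree := by
  conv_lhs => rw [← sum_homogeneousComponent p, Finset.smul_sum]
  refine totalDegree_finsetSum_le fun d hd => ?_
  refine (hG g _ d (homogeneousComponent_isHomogeneous d p)).totalDegree_le.trans ?_
  rw [Finset.mem_range] at hd
  omega

/-- The action preserves degrees, so homogeneous components of invariants are invariant, and the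
ideal is already generated by homogeneous invariants of positive degree. -/
theorem hilbertIdeal_isHomogeneous (p : MvPolynomial σ k) (hp : p ∈ hilbertIdeal σ k G) (d : ℕ) :
    homogeneousComponent d p ∈ hilbertIdeal σ k G := by
  have : hilbertIdeal σ k G = Ideal.span {p | (∀ g : G, g • p = p) ∧ ∃ e, 0 < e ∧ p.IsHomogeneous e} := by
    apply le_antisymm
    · rw [hilbertIdeal, Ideal.span_le]
      rintro p ⟨h1, h2⟩
      rw [SetLike.mem_coe, ← sum_homogeneousComponent p]
      refine Ideal.sum_mem _ fun e _ => ?_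
      rcases Nat.eq_zero_or_pos e with rfl | he
      · rw [homogeneousComponent_zero, show coeff 0 p = 0 from h2, C_0]
        exact zero_mem _
      · refine Ideal.subset_span ⟨fun g => ?_, e, he, homogeneousComponent_isHomogeneous e p⟩
        rw [smul_homogeneousComponent hG, h1]
    · rw [Ideal.span_le]
      rintro p ⟨h1, e, he, h2⟩
      refine Ideal.subset_span ⟨h1, ?_⟩
      exact h2.coeff_eq_zero (by simp; omega)
  rw [this] at hp ⊢
  let := MvPolynomial.gradedAlgebra (σ := σ) (R := k)
  refine homogeneousComponent_mem_of_mem (Ideal.homogeneous_span _ _ ?_) hp d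
  rintro p ⟨_, e, _, h⟩
  exact ⟨e, h⟩

variable (hR : Subgroup.closure {r : G | ∃ α : MvPolynomial σ k, α ≠ 0 ∧ α.IsHomogeneous 1 ∧
    ∀ p : MvPolynomial σ k, α ∣ p - r • p} = ⊤)
include hR in
-- The heart of Chevalley's theorem, by induction on the degrees of the p_i. For a reflection r with
-- linear form α, write p_i − r p_i = α q_i; cancelling α shows that the q_i satisfy the same
-- relation in smaller degree. Hence the sum is fixed by every reflection modulo the ideal, so by
-- the whole group, and may be replaced by its average. The average is an invariant whose constant
-- term is φ applied to the averaged relation, which is zero.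
theorem sum_functional_smul_mem_hilbertIdeal {ι : Type*} (s : Finset ι)
    (γ : ι → FixedPoints.subalgebra k (MvPolynomial σ k) G)
    (φ : FixedPoints.subalgebra k (MvPolynomial σ k) G →ₗ[k] k)
    (hφ : ∀ i ∈ s, ∀ c : FixedPoints.subalgebra k (MvPolynomial σ k) G,
      φ (c * γ i) = constantCoeff (c : MvPolynomial σ k) * φ (γ i))
    (p : ι → MvPolynomial σ k) (hp : ∑ i ∈ s, (γ i : MvPolynomial σ k) * p i = 0) :
    ∑ i ∈ s, φ (γ i) • p i ∈ hilbertIdeal σ k G := by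
  -- The zero polynomial has `totalDegree` 0, so it is listed separately; then D = 0 forces every
  -- p_i to vanish.
  have key : ∀ (D : ℕ) (p : ι → MvPolynomial σ k), (∀ i ∈ s, p i = 0 ∨ (p i).totalDegree < D) →
      ∑ i ∈ s, (γ i : MvPolynomial σ k) * p i = 0 →
      ∑ i ∈ s, φ (γ i) • p i ∈ hilbertIdeal σ k G := by
    intro D
    induction D with
    | zero =>
      intro p hD _
      have h0 : ∀ i ∈ s, p i = 0 := fun i hi => (hD i hi).resolve_right (Nat.not_lt_zero _)
      rw [Finset.sum_eq_zero fun i hi => by rw [h0 i hi, smul_zero]]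
      exact zero_mem _
    | succ D ih =>
      intro p hD hp
      have h1 : ∀ r ∈ {r : G | ∃ α : MvPolynomial σ k, α ≠ 0 ∧ α.IsHomogeneous 1 ∧
          ∀ p : MvPolynomial σ k, α ∣ p - r • p},
          ∑ i ∈ s, φ (γ i) • p i - r • ∑ i ∈ s, φ (γ i) • p i ∈ hilbertIdeal σ k G := by
        rintro r ⟨α, hα0, hα1, hα⟩
        choose q hq using hα
        have hsum : ∑ i ∈ s, φ (γ i) • p i - r • ∑ i ∈ s, φ (γ i) • p i =
            α * ∑ i ∈ s, φ (γ i) • q (p i) := by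
          rw [Finset.smul_sum, ← Finset.sum_sub_distrib, Finset.mul_sum]
          refine Finset.sum_congr rfl fun i _ => ?_
          rw [smul_comm r, ← smul_sub, hq, mul_smul_comm]
        rw [hsum]
        -- Division by the linear form α lowers every degree by at least one, because r does not
        -- raise degrees.
        refine Ideal.mul_mem_left _ _ (ih (fun i => q (p i)) (fun i hi => ?_) ?_)
        · by_cases hq0 : q (p i) = 0
          · exact Or.inl hq0
          · right
            have hpi : p i ≠ 0 := by
              intro h0
              have := hq (p i)
              rw [h0, smul_zero, sub_zero] at this
              rcases mul_eq_zero.mp this.symm with h | h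
              · exact hα0 h
              · exact hq0 (h0 ▸ h)
            have hdeg := congrArg totalDegree (hq (p i))
            rw [totalDegree_mul_of_isDomain hα0 hq0, hα1.totalDegree hα0] at hdeg
            have hle := totalDegree_sub (p i) (r • p i)
            have hr := totalDegree_smul_le hG r (p i)
            have hlt := (hD i hi).resolve_left hpi
            rw [max_eq_left hr] at hle
            change (q (p i)).totalDegree < D
            omega
        · have : α * ∑ i ∈ s, (γ i : MvPolynomial σ k) * q (p i) = 0 := by
            have h2 : ∑ i ∈ s, (γ i : MvPolynomial σ k) * (p i - r • p i) = 0 := by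
              simp_rw [mul_sub]
              rw [Finset.sum_sub_distrib, hp, zero_sub, neg_eq_zero]
              calc _ = r • ∑ i ∈ s, (γ i : MvPolynomial σ k) * p i := by
                    rw [Finset.smul_sum]
                    refine Finset.sum_congr rfl fun i _ => ?_
                    rw [smul_mul', (γ i).2 r]
                _ = 0 := by rw [hp, smul_zero]
            rw [← h2, Finset.mul_sum]
            refine Finset.sum_congr rfl fun i _ => ?_
            rw [hq (p i)]
            ring
          exact (mul_eq_zero.mp this).resolve_left hα0
      have h2 := sub_smul_mem_hilbertIdeal_of_closure hR h1
      have h3 : ∑ i ∈ s, φ (γ i) • p i - reynolds k G (∑ i ∈ s, φ (γ i) • p i) ∈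
          hilbertIdeal σ k G :=
        sub_reynolds_mem k (N := (hilbertIdeal σ k G).restrictScalars k) h2
      -- With R the averaging operator, the constant term is ∑ φ(γ_i)·(R p_i)(0) = φ(∑ (R p_i) γ_i)
      -- = φ(R(∑ γ_i p_i)) = 0; the first equality is the hypothesis on φ and the second is
      -- linearity of R over the invariants.
      have h4 : reynolds k G (∑ i ∈ s, φ (γ i) • p i) ∈ hilbertIdeal σ k G := by
        refine Ideal.subset_span ⟨fun g => smul_reynolds k g _, ?_⟩
        let a : ι → FixedPoints.subalgebra k (MvPolynomial σ k) G :=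
          fun i => ⟨reynolds k G (p i), fun g => smul_reynolds k g _⟩
        have ha : ∑ i ∈ s, a i * γ i = 0 := by
          apply Subtype.ext
          have : ((∑ i ∈ s, a i * γ i : FixedPoints.subalgebra k (MvPolynomial σ k) G) :
              MvPolynomial σ k) = ∑ i ∈ s, reynolds k G (γ i • p i) := by
            rw [AddSubmonoidClass.coe_finsetSum]
            refine Finset.sum_congr rfl fun i _ => ?_
            rw [reynolds_smul, mul_comm]
            rfl
          rw [this, ← map_sum]
          change reynolds k G (∑ i ∈ s, (γ i : MvPolynomial σ k) * p i) = 0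
          rw [hp, map_zero]
        have h5 := congrArg φ ha
        rw [map_sum, map_zero, Finset.sum_congr rfl fun i hi => hφ i hi (a i)] at h5
        rw [map_sum, map_sum, ← h5]
        refine Finset.sum_congr rfl fun i _ => ?_
        rw [map_smul, smul_eq_C_mul, map_mul, constantCoeff_C, mul_comm]
      have h5 := add_mem h3 h4
      rwa [sub_add_cancel] at h5
  refine key ((s.sup fun i => (p i).totalDegree) + 1) p (fun i hi => Or.inr ?_) hp
  exact Nat.lt_succ_of_le (Finset.le_sup (f := fun i => (p i).totalDegree) hi)

include hR in
-- A relation over the invariants is pushed by each admissible functional to a scalar relation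
-- modulo the ideal, hence to a trivial one. The functional form of Nakayama's lemma then kills the
-- coefficients themselves.
theorem linearIndependent_of_mod_hilbertIdeal {ι : Type*} (h : ι → MvPolynomial σ k)
    (hli : ∀ c : ι →₀ k, Finsupp.linearCombination k h c ∈ hilbertIdeal σ k G → c = 0) :
    LinearIndependent (FixedPoints.subalgebra k (MvPolynomial σ k) G) h := by
  rw [linearIndependent_iff]
  intro l hl
  let ε : FixedPoints.subalgebra k (MvPolynomial σ k) G →ₐ[k] k :=
    (aeval (fun _ => (0 : k))).comp (FixedPoints.subalgebra k (MvPolynomial σ k) G).val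
  have hε : ∀ c, ε c = constantCoeff (c : MvPolynomial σ k) := fun c => by
    simp [ε]
  refine eq_zero_of_forall_functional ε l fun f hf => ?_
  have hsum := sum_functional_smul_mem_hilbertIdeal hG hR l.support l f
    (fun i _ c => by rw [hf, hε]) h hl
  have hc := hli (l.mapRange f (map_zero f)) (by
    rw [Finsupp.linearCombination_apply, Finsupp.sum_mapRange_index (by simp)]
    exact hsum)
  intro i
  simpa using DFunLike.congr_fun hc i

/-- Both the family and the ideal are graded, so independence modulo the ideal can be tested in each
degree, where H d meets the ideal in zero. -/
theorem eq_zero_of_linearCombination_mem_hilbertIdeal {H : ℕ → Submodule k (MvPolynomial σ k)}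
    (hHW : ∀ d, H d ≤ homogeneousSubmodule σ k d)
    (hHI : ∀ d, H d ⊓ ((hilbertIdeal σ k G).restrictScalars k ⊓ homogeneousSubmodule σ k d) = ⊥)
    {κ : ℕ → Type*} (β : ∀ d, Module.Basis (κ d) k (H d)) (c : (Σ d, κ d) →₀ k)
    (hc : Finsupp.linearCombination k (fun i => (β i.1 i.2 : MvPolynomial σ k)) c ∈
      hilbertIdeal σ k G) : c = 0 := by
  have h1 : ∀ d, c.split d = 0 := by
    intro d
    have h2 := hilbertIdeal_isHomogeneous hG _ hc d
    have h3 := homogeneousComponent_mem d (Finsupp.linearCombination k (fun i => (β i.1 i.2 : MvPolynomial σ k)) c)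
    rw [homogeneousComponent_linearCombination_basis hHW] at h2 h3
    have h4 : Finsupp.linearCombination k (fun j => (β d j : MvPolynomial σ k)) (c.split d) ∈
        H d := by
      rw [Finsupp.linearCombination_apply]
      exact Submodule.sum_mem _ fun j _ => (H d).smul_mem _ (β d j).2
    have h5 : Finsupp.linearCombination k (fun j => (β d j : MvPolynomial σ k)) (c.split d) = 0 :=
      (Submodule.mem_bot k).mp (hHI d ▸ ⟨h4, h2, h3⟩)
    exact linearIndependent_iff.mp
      ((β d).linearIndependent.map' (H d).subtype (Submodule.ker_subtype _)) _ h5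
  ext ⟨d, j⟩
  rw [← Finsupp.split_apply, h1]
  rfl

theorem exists_stable_complement_homogeneousSubmodule (d : ℕ) :
    ∃ H : Submodule k (MvPolynomial σ k), H ≤ homogeneousSubmodule σ k d ∧
    (∀ (g : G), ∀ v ∈ H, g • v ∈ H) ∧
    H ⊓ ((hilbertIdeal σ k G).restrictScalars k ⊓ homogeneousSubmodule σ k d) = ⊥ ∧
    homogeneousSubmodule σ k d ≤
      H ⊔ ((hilbertIdeal σ k G).restrictScalars k ⊓ homogeneousSubmodule σ k d) :=
  exists_stable_complement k G inf_le_right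
    (fun g v hv => ⟨smul_mem_hilbertIdeal g hv.1, hG g v d hv.2⟩) (fun g v hv => hG g v d hv)

/-- The family consists of bases of stable complements of the ideal, one complement in each degree.
Stability of its span is what later allows invariants to be taken in other modules. -/
theorem exists_homogeneous_stable_complement : ∃ (ι : Type (max u v)) (h : ι → MvPolynomial σ k),
    (∀ (g : G) i, g • h i ∈ Submodule.span k (Set.range h)) ∧
    (∀ c : ι →₀ k, Finsupp.linearCombination k h c ∈ hilbertIdeal σ k G → c = 0) ∧
    (∀ d, ∀ p ∈ homogeneousSubmodule σ k d, ∃ a ∈ Submodule.span k (Set.range h),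
      ∃ b ∈ hilbertIdeal σ k G, b ∈ homogeneousSubmodule σ k d ∧ p = a + b) := by
  choose H hHW hHs hHI hHsup using
    exists_stable_complement_homogeneousSubmodule (σ := σ) (k := k) (G := G) hG
  obtain ⟨κ, ⟨β⟩⟩ : ∃ κ : ℕ → Type (max u v), Nonempty (∀ d, Module.Basis (κ d) k (H d)) :=
    ⟨_, ⟨fun d => Module.Basis.ofVectorSpace k (H d)⟩⟩
  have hspanH : ∀ d, ∀ v ∈ H d, v ∈ Submodule.span k
      (Set.range fun i : Σ d, κ d => (β i.1 i.2 : MvPolynomial σ k)) := by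
    intro d v hv
    have h2 := Submodule.mem_map_of_mem (f := (H d).subtype) ((β d).mem_span ⟨v, hv⟩)
    rw [Submodule.map_span] at h2
    refine Submodule.span_mono ?_ h2
    rintro _ ⟨_, ⟨j, rfl⟩, rfl⟩
    exact ⟨⟨d, j⟩, rfl⟩
  refine ⟨Σ d, κ d, fun i => (β i.1 i.2 : MvPolynomial σ k),
    fun g i => hspanH i.1 _ (hHs i.1 g _ (β i.1 i.2).2),
    fun c hc => eq_zero_of_linearCombination_mem_hilbertIdeal hG hHW hHI β c hc, fun d p hp => ?_⟩
  obtain ⟨a, ha, b, hb, rfl⟩ := Submodule.mem_sup.mp (hHsup d hp)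
  exact ⟨a, hspanH d a ha, b, hb.1, hb.2, rfl⟩

/-- Graded Nakayama: what spans modulo the ideal spans over the invariants, by strong induction on
the degree. -/
theorem span_eq_top_of_homogeneous {X : Submodule (FixedPoints.subalgebra k (MvPolynomial σ k) G)
    (MvPolynomial σ k)} (hdec : ∀ d, ∀ p ∈ homogeneousSubmodule σ k d, ∃ a ∈ X,
      ∃ b ∈ hilbertIdeal σ k G, b ∈ homogeneousSubmodule σ k d ∧ p = a + b) : ⊤ ≤ X := by
  have hX : ∀ d, ∀ p ∈ homogeneousSubmodule σ k d, p ∈ X := by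
    intro d
    induction d using Nat.strong_induction_on with
    | _ d ih =>
      -- In degree d an element of the ideal is a sum of products qγ with γ a homogeneous invariant
      -- of positive degree; then q has degree below d and lies in X by induction.
      have hIX : ∀ p ∈ hilbertIdeal σ k G, homogeneousComponent d p ∈ X := by
        have hγq : ∀ (γ q : MvPolynomial σ k) (e : ℕ), 0 < e → (∀ g : G, g • γ = γ) →
            γ.IsHomogeneous e → homogeneousComponent d (q * γ) ∈ X := by
          intro γ q e he hγ hγe
          rw [← sum_homogeneousComponent q, Finset.sum_mul, map_sum]
          refine Submodule.sum_mem _ fun m _ => ?_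
          have hm := (homogeneousComponent_isHomogeneous m q).mul hγe
          rw [homogeneousComponent_of_mem hm]
          split_ifs with hd
          · rw [mul_comm]
            exact X.smul_mem ⟨γ, hγ⟩ (ih m (by omega) _ (homogeneousComponent_mem m q))
          · exact zero_mem _
        intro p hp
        rw [hilbertIdeal] at hp
        obtain ⟨n, f, g, rfl⟩ := Submodule.mem_span_set'.mp hp
        rw [map_sum]
        refine Submodule.sum_mem _ fun i _ => ?_
        obtain ⟨h1, h2⟩ := (g i).2
        rw [smul_eq_mul, ← sum_homogeneousComponent (g i : MvPolynomial σ k), Finset.mul_sum,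
          map_sum]
        refine Submodule.sum_mem _ fun e _ => ?_
        rcases Nat.eq_zero_or_pos e with rfl | he
        · rw [homogeneousComponent_zero, show coeff 0 (g i : MvPolynomial σ k) = 0 from h2, C_0,
            mul_zero, map_zero]
          exact zero_mem _
        · refine hγq _ _ e he (fun g' => ?_) (homogeneousComponent_isHomogeneous e _)
          rw [smul_homogeneousComponent hG, h1]
      intro p hp
      obtain ⟨a, ha, b, hb, hbd, rfl⟩ := hdec d p hp
      refine X.add_mem ha ?_
      have := hIX b hb
      rwa [homogeneousComponent_of_mem hbd, if_pos rfl] at this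
  intro p _
  rw [← sum_homogeneousComponent p]
  exact Submodule.sum_mem _ fun d _ => hX d _ (homogeneousComponent_mem d p)

include hR in
/-- Chevalley's theorem: the polynomial ring is free over the ring of invariants of a finite
reflection group, with a basis spanning a stable subspace. -/
theorem exists_stable_basis :
    ∃ (ι : Type (max u v)) (b : Module.Basis ι (FixedPoints.subalgebra k (MvPolynomial σ k) G)
      (MvPolynomial σ k)), ∀ (g : G) i, g • b i ∈ Submodule.span k (Set.range b) := by
  obtain ⟨ι, h, hs, hli, hdec⟩ := exists_homogeneous_stable_complement (σ := σ) (k := k) hG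
  refine ⟨ι, Module.Basis.mk (linearIndependent_of_mod_hilbertIdeal hG hR h hli)
    (span_eq_top_of_homogeneous hG fun d p hp => ?_), fun g i => ?_⟩
  · obtain ⟨a, ha, b, hb⟩ := hdec d p hp
    exact ⟨a, Submodule.span_le_restrictScalars k
      (FixedPoints.subalgebra k (MvPolynomial σ k) G) (Set.range h) ha, b, hb⟩
  · rw [Module.Basis.coe_mk]
    exact hs g i

end Homogeneous

end Chevalley

end

noncomputable section

set_option linter.unusedSectionVars false

/-! ### Invariants of a free module with a stable basis span -/

section FreeInvariants

variable {k A V : Type*} [Field k] [CommRing A] [Algebra k A] [AddCommGroup V] [Module k V]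
  [Module A V] [IsScalarTower k A V]

/-- A family that is linearly independent over `k` in the `k`-span of an `A`-basis is linearly
independent over `A`. -/
theorem linearIndependent_of_mem_span_basis [Nontrivial A] {ι κ : Type*} (b : Module.Basis ι A V)
    {c : κ → V} (hc : LinearIndependent k c) (hmem : ∀ j, c j ∈ Submodule.span k (Set.range b)) :
    LinearIndependent A c := by
  classical
  have hinj : Function.Injective (algebraMap k A) := (algebraMap k A).injective
  let S := Submodule.span k (Set.range b)
  let c' : κ → S := fun j => ⟨c j, hmem j⟩
  have hc' : LinearIndependent k c' := LinearIndependent.of_comp S.subtype hc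
  obtain ⟨l, hl⟩ := LinearMap.exists_leftInverse_of_injective _
    (LinearMap.ker_eq_bot.mpr hc')
  -- A k-linear left inverse l of the family on the k-span S extends A-linearly, because V = A ⊗ S.
  -- The extension maps the family to the standard basis.
  let F : V →ₗ[A] (κ →₀ A) := b.constr A fun i =>
    (l ⟨b i, Submodule.subset_span ⟨i, rfl⟩⟩).mapRange (algebraMap k A) (map_zero _)
  have hF : ∀ (v : V) (hv : v ∈ S), F v = (l ⟨v, hv⟩).mapRange (algebraMap k A) (map_zero _) := by
    intro v hv
    induction hv using Submodule.span_induction with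
    | mem v hv =>
      obtain ⟨i, rfl⟩ := hv
      exact b.constr_basis A _ i
    | zero =>
      rw [map_zero, show (⟨0, _⟩ : S) = 0 from rfl, map_zero, Finsupp.mapRange_zero]
    | add x y hx hy hx' hy' =>
      rw [map_add, hx', hy', show (⟨x + y, _⟩ : S) = ⟨x, hx⟩ + ⟨y, hy⟩ from rfl, map_add,
        Finsupp.mapRange_add (map_add _)]
    | smul a x hx hx' =>
      rw [show (⟨a • x, _⟩ : S) = a • ⟨x, hx⟩ from rfl, l.map_smul, ← algebraMap_smul A a x,
        F.map_smul, hx']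
      ext j
      simp [Algebra.smul_def]
  refine LinearIndependent.of_comp F ?_
  have : F ∘ c = fun j => Finsupp.single j (1 : A) := by
    funext j
    have h1 : l (c' j) = Finsupp.single j 1 := by
      have := LinearMap.congr_fun hl (Finsupp.single j 1)
      simpa using this
    rw [Function.comp_apply, hF _ (hmem j), h1, Finsupp.mapRange_single, map_one]
  rw [this]
  exact Finsupp.basisSingleOne.linearIndependent

/-- Invariants of a finite group in a module with a basis spanning a stable subspace form a free
module. -/
theorem free_of_stable_basis [CharZero k] [Nontrivial A] {G : Type*} [Group G] [Fintype G]
    [DistribMulAction G V] [SMulCommClass G k V] [SMulCommClass G A V] [SMulCommClass k A V]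
    {ι : Type*} (b : Module.Basis ι A V)
    (hb : ∀ (g : G) i, g • b i ∈ Submodule.span k (Set.range b)) (N : Submodule A V)
    (hN : ∀ v, v ∈ N ↔ ∀ g : G, g • v = v) : Module.Free A N := by
  -- These are the invariants inside the stable k-span of the basis; any k-basis of S turns out to
  -- be an A-basis of N.
  let S : Submodule k V := Submodule.span k (Set.range b) ⊓ N.restrictScalars k
  let β := Module.Basis.ofVectorSpace k S
  have hβ : ∀ j, (β j : V) ∈ S := fun j => (β j).2
  let c : _ → N := fun j => ⟨β j, (hβ j).2⟩
  have hc : LinearIndependent A c := by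
    refine LinearIndependent.of_comp N.subtype ?_
    refine linearIndependent_of_mem_span_basis b ?_ fun j => (hβ j).1
    exact β.linearIndependent.map' S.subtype (Submodule.ker_subtype _)
  have hST : ∀ s ∈ S, ∃ w ∈ Submodule.span A (Set.range c), (w : V) = s := by
    intro s hs
    have h1 := Submodule.mem_map_of_mem (f := S.subtype) (β.mem_span ⟨s, hs⟩)
    rw [Submodule.map_span] at h1
    have h2 := Submodule.span_le_restrictScalars k A _ h1
    have h3 : Submodule.span A (S.subtype '' Set.range β) =
        (Submodule.span A (Set.range c)).map N.subtype := by
      rw [Submodule.map_span]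
      rw [← Set.range_comp, ← Set.range_comp]
      rfl
    rw [Submodule.restrictScalars_mem, h3] at h2
    obtain ⟨w, hw, rfl⟩ := h2
    exact ⟨w, hw, rfl⟩
  refine Module.Free.of_basis (Module.Basis.mk hc ?_)
  rintro ⟨v, hv⟩ -
  have h1 : v ∈ (Submodule.span A (Set.range c)).map N.subtype := by
    -- An invariant v = ∑ a_i b_i equals its average ∑ a_i R(b_i), and each R(b_i) lies in S.
    rw [← reynolds_eq_self k ((hN v).mp hv), ← b.linearCombination_repr v,
      Finsupp.linearCombination_apply, Finsupp.sum, map_sum]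
    refine Submodule.sum_mem _ fun i _ => ?_
    rw [reynolds_smul]
    refine Submodule.smul_mem _ _ ?_
    obtain ⟨w, hw, hw'⟩ := hST (reynolds k G (b i))
      ⟨reynolds_mem k fun g => hb g i, (hN _).mpr fun g => smul_reynolds k g _⟩
    exact ⟨w, hw, hw'⟩
  obtain ⟨w, hw, hw'⟩ := h1
  have : w = ⟨v, hv⟩ := Subtype.ext hw'
  exact this ▸ hw

end FreeInvariants

/-! ### Noether's finiteness theorem for invariants -/

section Noether

variable (k P G : Type*) [Field k] [CommRing P] [Algebra k P] [Group G] [Finite G]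
  [MulSemiringAction G P] [SMulCommClass G k P] [Algebra.FiniteType k P]

/-- Every element is integral over the invariants, being a root of the product of X − gb over the
group, and an integral algebra of finite type is a finite module. -/
theorem finite_over_fixedPoints : Module.Finite (FixedPoints.subalgebra k P G) P := by
  have : Algebra.IsInvariant (FixedPoints.subalgebra k P G) P G := ⟨fun b hb => ⟨⟨b, hb⟩, rfl⟩⟩
  have := Algebra.IsInvariant.isIntegral (FixedPoints.subalgebra k P G) P G
  have : Algebra.FiniteType (FixedPoints.subalgebra k P G) P :=
    Algebra.FiniteType.of_restrictScalars_finiteType k _ _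
  exact Algebra.IsIntegral.finite

/-- Noether's theorem on invariants of finite groups. -/
theorem fixedPoints_finiteType : Algebra.FiniteType k (FixedPoints.subalgebra k P G) := by
  have := finite_over_fixedPoints k P G
  -- This is the Artin–Tate lemma.
  exact ⟨fg_of_fg_of_fg k (FixedPoints.subalgebra k P G) P Algebra.FiniteType.out
    Module.Finite.fg_top Subtype.val_injective⟩

theorem fixedPoints_isNoetherianRing : IsNoetherianRing (FixedPoints.subalgebra k P G) := by
  have := fixedPoints_finiteType k P G
  exact Algebra.FiniteType.isNoetherianRing k _

end Noether

/-- The monoid algebra, with the diagonal action of groups acting on the coefficients and on the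
monoid. -/
def SymbolAlgebra (P M : Type*) [Semiring P] : Type _ := MonoidAlgebra P M

/-! ### The monoid algebra with the diagonal group action -/

namespace SymbolAlgebra

variable {P M : Type*} [CommRing P] [CommMonoid M]

instance : CommRing (SymbolAlgebra P M) := inferInstanceAs (CommRing (MonoidAlgebra P M))

instance {A : Type*} [CommSemiring A] [Algebra A P] : Algebra A (SymbolAlgebra P M) :=
  inferInstanceAs (Algebra A (MonoidAlgebra P M))

/-- The coefficients. -/
def coeff (f : SymbolAlgebra P M) : M →₀ P := MonoidAlgebra.coeff f

/-- Single terms. -/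
def single (m : M) (p : P) : SymbolAlgebra P M := MonoidAlgebra.single m p

theorem ext {f g : SymbolAlgebra P M} (h : ∀ m, f.coeff m = g.coeff m) : f = g :=
  MonoidAlgebra.ext (Finsupp.ext h)

/-- The element with prescribed coefficients. -/
def ofCoeff (f : M →₀ P) : SymbolAlgebra P M := MonoidAlgebra.ofCoeff f

@[simp] theorem coeff_single (m : M) (p : P) : (single m p).coeff = Finsupp.single m p := rfl

@[simp] theorem coeff_add (f g : SymbolAlgebra P M) : (f + g).coeff = f.coeff + g.coeff := rfl

@[simp] theorem coeff_zero : (0 : SymbolAlgebra P M).coeff = 0 := rfl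

@[simp] theorem coeff_smul {A : Type*} [CommSemiring A] [Algebra A P] (a : A)
    (f : SymbolAlgebra P M) : (a • f).coeff = a • f.coeff := rfl

theorem single_add (m : M) (p p' : P) : single m (p + p') = single m p + single m p' :=
  MonoidAlgebra.single_add ..

theorem induction_linear {motive : SymbolAlgebra P M → Prop} (f : SymbolAlgebra P M)
    (zero : motive 0) (add : ∀ f g, motive f → motive g → motive (f + g))
    (single : ∀ m p, motive (single m p)) : motive f := by
  have : ∀ c : M →₀ P, motive (ofCoeff c) := fun c => by
    induction c using Finsupp.induction_linear with
    | zero => exact zero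
    | add c c' hc hc' => exact add _ _ hc hc'
    | single m p => exact single m p
  exact this f.coeff

section Action

variable {G : Type*} [Group G] [MulSemiringAction G P] [MulDistribMulAction G M]

/-- The diagonal action, by ring homomorphisms. -/
def actionHom (g : G) : SymbolAlgebra P M →+* SymbolAlgebra P M :=
  (MonoidAlgebra.mapRingHom M (MulSemiringAction.toRingHom G P g)).comp
    (MonoidAlgebra.mapDomainRingHom P (MulDistribMulAction.toMonoidHom M g))

theorem actionHom_single (g : G) (m : M) (p : P) :
    actionHom g (single m p) = single (g • m) (g • p) := by
  change MonoidAlgebra.mapRingHom M _ (MonoidAlgebra.mapDomainRingHom P _ _) = _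
  rw [single, MonoidAlgebra.mapDomainRingHom_apply, MonoidAlgebra.mapDomain_single,
    MonoidAlgebra.mapRingHom_single]
  rfl

instance : MulSemiringAction G (SymbolAlgebra P M) where
  smul g f := actionHom g f
  one_smul f := by
    change actionHom 1 f = f
    induction f using induction_linear with
    | zero => exact map_zero _
    | add f g hf hg => rw [map_add, hf, hg]
    | single m p => rw [actionHom_single, one_smul, one_smul]
  mul_smul a b f := by
    change actionHom (a * b) f = actionHom a (actionHom b f)
    induction f using induction_linear with
    | zero => simp only [map_zero]
    | add f g hf hg => simp only [map_add, hf, hg]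
    | single m p => simp only [actionHom_single, mul_smul]
  smul_zero g := map_zero (actionHom g)
  smul_add g := map_add (actionHom g)
  smul_one g := map_one (actionHom g)
  smul_mul g := map_mul (actionHom g)

theorem smul_single (g : G) (m : M) (p : P) : g • single m p = single (g • m) (g • p) :=
  actionHom_single g m p

theorem coeff_group_smul (g : G) (f : SymbolAlgebra P M) (m : M) :
    (g • f).coeff (g • m) = g • f.coeff m := by
  classical
  induction f using induction_linear with
  | zero => simp
  | add f f' hf hf' => simp [hf, hf']
  | single m' p =>
    rw [smul_single, coeff_single, coeff_single, Finsupp.single_apply, Finsupp.single_apply]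
    simp only [smul_left_cancel_iff]
    split_ifs <;> simp

instance {A : Type*} [CommSemiring A] [Algebra A P] [SMulCommClass G A P] :
    SMulCommClass G A (SymbolAlgebra P M) where
  smul_comm g a f := by
    refine ext fun m => ?_
    obtain ⟨m, rfl⟩ := MulAction.surjective g m
    rw [coeff_group_smul, coeff_smul, coeff_smul, Finsupp.smul_apply, Finsupp.smul_apply,
      coeff_group_smul, smul_comm]

variable (k : Type*) [Field k] [Algebra k P] [SMulCommClass G k P]

instance {A : Type*} [CommSemiring A] [Algebra A P] [Algebra k A] [IsScalarTower k A P] :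
    IsScalarTower k A (SymbolAlgebra P M) :=
  inferInstanceAs (IsScalarTower k A (MonoidAlgebra P M))

instance : SMulCommClass G (FixedPoints.subalgebra k P G) (SymbolAlgebra P M) where
  smul_comm g a f := by
    refine ext fun m => ?_
    obtain ⟨m, rfl⟩ := MulAction.surjective g m
    rw [coeff_group_smul]
    change g • ((a : P) * f.coeff m) = (a : P) * (g • f).coeff (g • m)
    rw [coeff_group_smul, smul_mul', a.2 g]

variable (P M G) in
/-- The invariants, as a module over the invariant coefficients. -/
def invariantSubmodule : Submodule (FixedPoints.subalgebra k P G) (SymbolAlgebra P M) where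
  carrier := {f | ∀ g : G, g • f = f}
  zero_mem' g := smul_zero g
  add_mem' hf hf' g := by rw [smul_add, hf g, hf' g]
  smul_mem' a f hf g := by rw [smul_comm, hf g]

/-- The products of monoid elements with the given basis of P form a basis of the monoid algebra.
Its k-span is stable because the action moves the monoid element and applies g to the coefficient.
-/
theorem free_invariantSubmodule [CharZero k] [IsDomain P] [Fintype G] {ι : Type*}
    (b : Module.Basis ι (FixedPoints.subalgebra k P G) P)
    (hb : ∀ (g : G) i, g • b i ∈ Submodule.span k (Set.range b)) :
    Module.Free (FixedPoints.subalgebra k P G) (invariantSubmodule P M G k) := by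
  let B : Module.Basis (Σ _ : M, ι) (FixedPoints.subalgebra k P G) (SymbolAlgebra P M) :=
    (Finsupp.basis fun _ : M => b).map
      (MonoidAlgebra.coeffLinearEquiv (S := P) (M := M) (FixedPoints.subalgebra k P G)).symm
  have hB : ∀ i, B i = single i.1 (b i.2) := fun i => by
    change (MonoidAlgebra.coeffLinearEquiv (FixedPoints.subalgebra k P G)).symm
      ((Finsupp.basis fun _ : M => b) i) = _
    rw [Finsupp.coe_basis]
    rfl
  refine free_of_stable_basis (k := k) (G := G) B (fun g i => ?_) _ fun v => Iff.rfl
  rw [hB, smul_single]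
  let s : P →ₗ[k] SymbolAlgebra P M :=
    { toFun := single (g • i.1)
      map_add' := single_add _
      map_smul' := fun c p => by
        refine ext fun m => ?_
        simp only [coeff_single, coeff_smul, RingHom.id_apply, Finsupp.smul_single] }
  have h1 := Submodule.mem_map_of_mem (f := s) (hb g i.2)
  rw [Submodule.map_span] at h1
  refine Submodule.span_mono ?_ h1
  rintro _ ⟨_, ⟨j, rfl⟩, rfl⟩
  exact ⟨⟨g • i.1, j⟩, hB _⟩

variable {k} in
-- Such a submodule embeds in the finite power P^F, a Noetherian module over the invariants.
theorem fg_of_support_subset [Finite G] [Algebra.FiniteType k P]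
    (N : Submodule (FixedPoints.subalgebra k P G) (SymbolAlgebra P M))
    (F : Finset M) (hF : ∀ f ∈ N, f.coeff.support ⊆ F) : N.FG := by
  have := finite_over_fixedPoints k P G
  have := fixedPoints_isNoetherianRing k P G
  let φ : N →ₗ[FixedPoints.subalgebra k P G] (F → P) :=
    { toFun := fun f m => f.1.coeff m
      map_add' := fun _ _ => rfl
      map_smul' := fun _ _ => rfl }
  have hφ : Function.Injective φ := by
    intro f f' h
    refine Subtype.ext (ext fun m => ?_)
    by_cases hm : m ∈ F
    · exact congrFun h ⟨m, hm⟩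
    · rw [Finsupp.notMem_support_iff.mp fun h => hm (hF _ f.2 h),
        Finsupp.notMem_support_iff.mp fun h => hm (hF _ f'.2 h)]
  have : IsNoetherian (FixedPoints.subalgebra k P G) N := isNoetherian_of_injective φ hφ
  exact Module.Finite.iff_fg.mp inferInstance

theorem finiteType [Monoid.FG M] [Algebra.FiniteType k P] :
    Algebra.FiniteType k (SymbolAlgebra P M) := by
  have h1 : Algebra.FiniteType P (MonoidAlgebra P M) := inferInstance
  change Algebra.FiniteType k (MonoidAlgebra P M)
  exact Algebra.FiniteType.trans (S := P) inferInstance h1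

end Action

end SymbolAlgebra

end

noncomputable section

/-! ### Semilinear transfer of freeness and finite generation -/

section Transfer

variable {R R' M M' : Type*} [Ring R] [Ring R'] [AddCommGroup M] [AddCommGroup M'] [Module R M]
  [Module R' M']

/-- The change of scalars is kept explicit because the same argument serves Γ and its opposite, both
identified with the ring of invariant polynomials. -/
theorem free_of_addEquiv (e : M ≃+ M') (σ : R ≃+* R') (h : ∀ r m, e (r • m) = σ r • e m)
    [Module.Free R' M'] : Module.Free R M := by
  let := RingHomInvPair.of_ringEquiv σ
  let := RingHomInvPair.symm (σ : R →+* R') (σ.symm : R' →+* R)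
  let e' : M ≃ₛₗ[(σ : R →+* R')] M' := { e with map_smul' := h }
  exact Module.Free.of_equiv e'.symm

theorem fg_of_addHom_injective (f : M →+ M') (hf : Function.Injective f) (σ : R ≃+* R')
    (h : ∀ r m, f (r • m) = σ r • f m) (N : Submodule R M)
    (hN : ∀ N' : Submodule R' M', (N' : Set M') = f '' N → N'.FG) : N.FG := by
  let := RingHomInvPair.of_ringEquiv σ
  let f' : M →ₛₗ[(σ : R →+* R')] M' := { f with map_smul' := h }
  exact Submodule.fg_of_fg_map_injective f' hf (hN _ rfl)

end Transfer

/-! ### The opposite ring and right modules -/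

section Opposite

variable {k U P : Type*} [CommRing k] [Ring U] [Algebra k U] [CommRing P] {Γ : Subalgebra k U}

/-- A homomorphism to a commutative ring, on the opposite ring. -/
def Subalgebra.opHom (θ : Γ →+* P) : Γ.op →+* P where
  toFun γ := θ ⟨γ.1.unop, γ.2⟩
  map_zero' := map_zero θ
  map_one' := map_one θ
  map_add' a b := map_add θ ⟨a.1.unop, a.2⟩ ⟨b.1.unop, b.2⟩
  map_mul' a b := (map_mul θ ⟨b.1.unop, b.2⟩ ⟨a.1.unop, a.2⟩).trans (mul_comm _ _)

theorem Subalgebra.opHom_injective {θ : Γ →+* P} (hθ : Function.Injective θ) :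
    Function.Injective (Subalgebra.opHom θ) := fun _ _ h =>
  Subtype.ext (MulOpposite.unop_injective (congrArg Subtype.val (hθ h)))

theorem Subalgebra.range_opHom (θ : Γ →+* P) :
    Set.range (Subalgebra.opHom θ) = Set.range θ := by
  ext p
  constructor
  · rintro ⟨γ, rfl⟩
    exact ⟨_, rfl⟩
  · rintro ⟨γ, rfl⟩
    exact ⟨⟨MulOpposite.op γ.1, γ.2⟩, rfl⟩

end Opposite

/-! ### Modules embedded in the symbol algebra -/

namespace SymbolAlgebra

variable {k P M G Γ U : Type*} [Field k] [CommRing P] [Algebra k P] [CommMonoid M] [Group G]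
  [MulSemiringAction G P] [SMulCommClass G k P] [MulDistribMulAction G M] [Ring Γ]
  [AddCommGroup U] [Module Γ U]
  (θ : Γ →+* P) (hθ : Function.Injective θ) (hθ' : Set.range θ = {p | ∀ g : G, g • p = p})
  (f : U →+ SymbolAlgebra P M) (hf : Function.Injective f)
  (hfθ : ∀ γ u, f (γ • u) = θ γ • f u)

/-- An injective homomorphism with the invariants as its range, as an isomorphism. -/
def fixedPointsEquiv (k : Type*) [Field k] [Algebra k P] [SMulCommClass G k P]
    (θ : Γ →+* P) (hθ : Function.Injective θ) (hθ' : Set.range θ = {p | ∀ g : G, g • p = p}) :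
    Γ ≃+* FixedPoints.subalgebra k P G :=
  RingEquiv.ofBijective (θ.codRestrict (FixedPoints.subalgebra k P G) fun γ => hθ'.le ⟨γ, rfl⟩)
    ⟨fun a b h => hθ (congrArg Subtype.val h), fun p => by
      obtain ⟨γ, hγ⟩ := hθ'.ge p.2
      exact ⟨γ, Subtype.ext hγ⟩⟩

include hθ hθ' hf hfθ in
/-- A module that is isomorphic to the invariants in the symbol algebra is free, when the
coefficient ring has a stable basis. -/
theorem free_of_range_eq_invariants [CharZero k] [IsDomain P] [Fintype G] {ι : Type*}
    (b : Module.Basis ι (FixedPoints.subalgebra k P G) P)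
    (hb : ∀ (g : G) i, g • b i ∈ Submodule.span k (Set.range b))
    (hf' : Set.range f = {r | ∀ g : G, g • r = r}) : Module.Free Γ U := by
  have := free_invariantSubmodule (P := P) (M := M) (G := G) k b hb
  let f' : U →+ invariantSubmodule P M G k :=
    { toFun := fun u => ⟨f u, hf'.le ⟨u, rfl⟩⟩
      map_zero' := Subtype.ext (map_zero f)
      map_add' := fun u v => Subtype.ext (map_add f u v) }
  refine free_of_addEquiv (AddEquiv.ofBijective f'
    ⟨fun u v h => hf (congrArg Subtype.val h), fun r => ?_⟩) (fixedPointsEquiv k θ hθ hθ')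
    fun γ u => Subtype.ext (hfθ γ u)
  obtain ⟨u, hu⟩ := hf'.ge r.2
  exact ⟨u, Subtype.ext hu⟩

variable (k) in
include hθ hθ' hf hfθ in
theorem fg_of_symbols_supported [Finite G] [Algebra.FiniteType k P] (N : Submodule Γ U)
    (F : Finset M) (hF : ∀ u ∈ N, (f u).coeff.support ⊆ F) : N.FG := by
  refine fg_of_addHom_injective f hf (fixedPointsEquiv k θ hθ hθ') hfθ N fun N' hN' => ?_
  refine fg_of_support_subset (k := k) N' F fun r hr => ?_
  obtain ⟨u, hu, rfl⟩ := hN'.le hr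
  exact hF u hu

end SymbolAlgebra

end

noncomputable section

open MvPolynomial

section Torus

variable {n : ℕ}

/-! ## Translations and signed permutations of the polynomial ring -/

theorem MvPolynomial.algEquiv_ext {σ : Type*} {f g : MvPolynomial σ ℂ ≃ₐ[ℂ] MvPolynomial σ ℂ}
    (h : ∀ i, f (X i) = g (X i)) : f = g := by
  apply AlgEquiv.coe_toAlgHom_injective
  exact MvPolynomial.algHom_ext h

/-- The translation `X i ↦ X i - a i`. -/
def polyTranslate (a : Fin n → ℂ) : MvPolynomial (Fin n) ℂ ≃ₐ[ℂ] MvPolynomial (Fin n) ℂ :=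
  AlgEquiv.ofAlgHom (aeval fun i => X i - C (a i)) (aeval fun i => X i + C (a i))
    (MvPolynomial.algHom_ext fun i => by simp) (MvPolynomial.algHom_ext fun i => by simp)

@[simp] theorem polyTranslate_X (a : Fin n → ℂ) (i : Fin n) : polyTranslate a (X i) = X i - C (a i) := by
  simp [polyTranslate]

theorem polyTranslate_add (a b : Fin n → ℂ) : polyTranslate (a + b) = polyTranslate a * polyTranslate b :=
  MvPolynomial.algEquiv_ext fun i => by
    rw [AlgEquiv.mul_apply, polyTranslate_X, polyTranslate_X, map_sub, polyTranslate_X,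
      ← MvPolynomial.algebraMap_eq, AlgEquiv.commutes, Pi.add_apply, map_add]
    ring

/-- Translations by integer vectors. -/
def intTranslate (n : ℕ) :
    Multiplicative (Fin n → ℤ) →* (MvPolynomial (Fin n) ℂ ≃ₐ[ℂ] MvPolynomial (Fin n) ℂ) where
  toFun a := polyTranslate fun i => (a.toAdd i : ℂ)
  map_one' := MvPolynomial.algEquiv_ext fun i => by simp
  map_mul' a b := by
    rw [← polyTranslate_add]
    congr 1
    funext i
    simp

@[simp] theorem intTranslate_X (a : Multiplicative (Fin n → ℤ)) (i : Fin n) :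
    intTranslate n a (X i) = X i - C (a.toAdd i : ℂ) :=
  polyTranslate_X _ i

/-- The signed permutation `X i ↦ δ i * X (π i)`, as a homomorphism. -/
def signedPermHom (π : Equiv.Perm (Fin n)) (δ : Fin n → ℤˣ) :
    MvPolynomial (Fin n) ℂ →ₐ[ℂ] MvPolynomial (Fin n) ℂ :=
  aeval fun i => C ((δ i : ℤ) : ℂ) * X (π i)

theorem signedPermHom_comp (π π' : Equiv.Perm (Fin n)) (δ δ' : Fin n → ℤˣ) :
    (signedPermHom π δ).comp (signedPermHom π' δ') =
      signedPermHom (π * π') (fun i => δ' i * δ (π' i)) :=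
  MvPolynomial.algHom_ext fun i => by
    simp only [signedPermHom, AlgHom.comp_apply, aeval_X, map_mul, algHom_C, algebraMap_eq]
    push_cast
    rw [map_mul, mul_assoc]
    rfl

theorem signedPermHom_one : signedPermHom (1 : Equiv.Perm (Fin n)) 1 = AlgHom.id ℂ _ :=
  MvPolynomial.algHom_ext fun i => by simp [signedPermHom]

/-- The signed permutation `X i ↦ δ i * X (π i)`. -/
def signedPerm (π : Equiv.Perm (Fin n)) (δ : Fin n → ℤˣ) :
    MvPolynomial (Fin n) ℂ ≃ₐ[ℂ] MvPolynomial (Fin n) ℂ :=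
  AlgEquiv.ofAlgHom (signedPermHom π δ) (signedPermHom π⁻¹ fun i => δ (π⁻¹ i))
    (by
      rw [signedPermHom_comp, mul_inv_cancel, ← signedPermHom_one]
      congr 1
      funext i
      exact Int.units_mul_self _)
    (by
      rw [signedPermHom_comp, inv_mul_cancel, ← signedPermHom_one]
      congr 1
      funext i
      simp [Int.units_mul_self])

theorem signedPerm_apply (π : Equiv.Perm (Fin n)) (δ : Fin n → ℤˣ) (p : MvPolynomial (Fin n) ℂ) :
    signedPerm π δ p = signedPermHom π δ p := rfl

@[simp] theorem signedPerm_X (π : Equiv.Perm (Fin n)) (δ : Fin n → ℤˣ) (i : Fin n) :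
    signedPerm π δ (X i) = C ((δ i : ℤ) : ℂ) * X (π i) := by
  rw [signedPerm_apply, signedPermHom, aeval_X]

theorem signedPerm_mul (π π' : Equiv.Perm (Fin n)) (δ δ' : Fin n → ℤˣ) :
    signedPerm π δ * signedPerm π' δ' = signedPerm (π * π') (fun i => δ' i * δ (π' i)) :=
  AlgEquiv.ext fun p => DFunLike.congr_fun (signedPermHom_comp π π' δ δ') p

theorem signedPerm_one : signedPerm (1 : Equiv.Perm (Fin n)) 1 = 1 :=
  AlgEquiv.ext fun p => DFunLike.congr_fun signedPermHom_one p

theorem signedPerm_inv (π : Equiv.Perm (Fin n)) (δ : Fin n → ℤˣ) :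
    (signedPerm π δ)⁻¹ = signedPerm π⁻¹ (fun i => δ (π⁻¹ i)) := by
  refine inv_eq_of_mul_eq_one_right ?_
  rw [signedPerm_mul, mul_inv_cancel, ← signedPerm_one]
  congr 1
  funext i
  exact Int.units_mul_self _

variable (n) in
/-- The group of signed permutations of the variables. -/
def signedPerms : Subgroup (MvPolynomial (Fin n) ℂ ≃ₐ[ℂ] MvPolynomial (Fin n) ℂ) where
  carrier := Set.range fun w : Equiv.Perm (Fin n) × (Fin n → ℤˣ) => signedPerm w.1 w.2
  one_mem' := ⟨1, signedPerm_one⟩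
  mul_mem' := by
    rintro _ _ ⟨w, rfl⟩ ⟨w', rfl⟩
    exact ⟨(_, _), (signedPerm_mul _ _ _ _).symm⟩
  inv_mem' := by
    rintro _ ⟨w, rfl⟩
    exact ⟨(_, _), (signedPerm_inv _ _).symm⟩

instance : Finite (signedPerms n) :=
  (Set.finite_range fun w : Equiv.Perm (Fin n) × (Fin n → ℤˣ) => signedPerm w.1 w.2).to_subtype

theorem signedPerm_mem (π : Equiv.Perm (Fin n)) (δ : Fin n → ℤˣ) :
    signedPerm π δ ∈ signedPerms n :=
  ⟨(π, δ), rfl⟩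

theorem isHomogeneous_signedPerm {g : MvPolynomial (Fin n) ℂ ≃ₐ[ℂ] MvPolynomial (Fin n) ℂ}
    (hg : g ∈ signedPerms n) {p : MvPolynomial (Fin n) ℂ} {d : ℕ} (hp : p.IsHomogeneous d) :
    (g p).IsHomogeneous d := by
  obtain ⟨w, rfl⟩ := hg
  have := hp.aeval (fun i => C ((w.2 i : ℤ) : ℂ) * X (w.1 i))
    (fun i => isHomogeneous_C_mul_X (R := ℂ) ((w.2 i : ℤ) : ℂ) (w.1 i))
  rwa [one_mul] at this

/-- Signed permutations normalize the lattice of translations; this produces both the action on ℤ^n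
and the stability of M under conjugation. -/
theorem signedPerm_mul_intTranslate (π : Equiv.Perm (Fin n)) (δ : Fin n → ℤˣ)
    (a : Multiplicative (Fin n → ℤ)) :
    signedPerm π δ * intTranslate n a = intTranslate n
      (Multiplicative.ofAdd fun i => δ (π⁻¹ i) * a.toAdd (π⁻¹ i)) * signedPerm π δ :=
  MvPolynomial.algEquiv_ext fun i => by
    rw [AlgEquiv.mul_apply, AlgEquiv.mul_apply, intTranslate_X, map_sub, signedPerm_X, map_mul,
      intTranslate_X, ← MvPolynomial.algebraMap_eq, AlgEquiv.commutes, AlgEquiv.commutes, mul_sub,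
      ← map_mul]
    congr 2
    rcases Int.units_eq_one_or (δ i) with h | h <;> simp [h]

theorem intTranslate_injective : Function.Injective (intTranslate n) := by
  intro a b h
  refine Multiplicative.toAdd.injective (funext fun i => ?_)
  have h2 := DFunLike.congr_fun h (X i)
  rw [intTranslate_X, intTranslate_X, sub_right_inj] at h2
  exact_mod_cast C_injective _ _ h2

theorem exists_conj_intTranslate (g : signedPerms n) (a : Multiplicative (Fin n → ℤ)) :
    ∃ b, intTranslate n b = g.1 * intTranslate n a * g.1⁻¹ := by
  obtain ⟨_, w, rfl⟩ := g
  exact ⟨_, by rw [signedPerm_mul_intTranslate, mul_inv_cancel_right]⟩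

/-- The action of signed permutations on integer vectors. -/
instance : SMul (signedPerms n) (Multiplicative (Fin n → ℤ)) where
  smul g a := (exists_conj_intTranslate g a).choose

theorem intTranslate_smul (g : signedPerms n) (a : Multiplicative (Fin n → ℤ)) :
    intTranslate n (g • a) = g.1 * intTranslate n a * g.1⁻¹ :=
  (exists_conj_intTranslate g a).choose_spec

/-- The chosen vector is determined by the conjugated translation, so the axioms are identities
between conjugates. -/
instance : MulDistribMulAction (signedPerms n) (Multiplicative (Fin n → ℤ)) where
  one_smul a := intTranslate_injective (by rw [intTranslate_smul]; simp)
  mul_smul g h a := intTranslate_injective (by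
    rw [intTranslate_smul, intTranslate_smul, intTranslate_smul, Subgroup.coe_mul]
    group)
  smul_one g := intTranslate_injective (by rw [intTranslate_smul]; simp)
  smul_mul g a b := intTranslate_injective (by
    rw [intTranslate_smul, map_mul, map_mul, intTranslate_smul, intTranslate_smul]
    group)

/-! ## The field of rational functions -/

/-- The embedding of the polynomial ring in the field of rational functions that sends `X i` to
`t i - 1`; the signed permutations act linearly in these coordinates. -/
def ratEmb (n : ℕ) : MvPolynomial (Fin n) ℂ →ₐ[ℂ] RatFuncField n :=
  (IsScalarTower.toAlgHom ℂ (MvPolynomial (Fin n) ℂ) (RatFuncField n)).comp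
    (polyTranslate fun _ => 1).toAlgHom

theorem ratEmb_apply (p : MvPolynomial (Fin n) ℂ) :
    ratEmb n p = algebraMap _ (RatFuncField n) (polyTranslate (fun _ => 1) p) := rfl

theorem ratEmb_X (i : Fin n) : ratEmb n (X i) = ratVar i - 1 := by
  rw [ratEmb_apply, polyTranslate_X, map_sub, map_one, map_one]
  rfl

theorem ratVar_eq (i : Fin n) : ratVar i = ratEmb n (X i + 1) := by
  rw [map_add, map_one, ratEmb_X, sub_add_cancel]

theorem ratEmb_injective : Function.Injective (ratEmb n) :=
  (IsFractionRing.injective (MvPolynomial (Fin n) ℂ) (RatFuncField n)).comp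
    (polyTranslate fun _ => 1).injective

theorem exists_ratEmb_div (x : RatFuncField n) :
    ∃ p q : MvPolynomial (Fin n) ℂ, q ≠ 0 ∧ x = ratEmb n p / ratEmb n q := by
  obtain ⟨p, q, hq, rfl⟩ := IsFractionRing.div_surjective (A := MvPolynomial (Fin n) ℂ) x
  refine ⟨(polyTranslate fun _ => 1).symm p, (polyTranslate fun _ => 1).symm q, ?_, ?_⟩
  · rw [Ne, EmbeddingLike.map_eq_zero_iff]
    exact nonZeroDivisors.ne_zero hq
  · rw [ratEmb_apply, ratEmb_apply, AlgEquiv.apply_symm_apply, AlgEquiv.apply_symm_apply]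

/-- The extension of automorphisms of the polynomial ring to the field of rational functions,
along `ratEmb`. -/
def extendAut (n : ℕ) : (MvPolynomial (Fin n) ℂ ≃ₐ[ℂ] MvPolynomial (Fin n) ℂ) →*
    (RatFuncField n ≃ₐ[ℂ] RatFuncField n) :=
  (IsFractionRing.fieldEquivOfAlgEquivHom ℂ (RatFuncField n)).comp
    (MulAut.conj (polyTranslate fun _ : Fin n => (1 : ℂ))).toMonoidHom

theorem extendAut_ratEmb (g : MvPolynomial (Fin n) ℂ ≃ₐ[ℂ] MvPolynomial (Fin n) ℂ)
    (p : MvPolynomial (Fin n) ℂ) : extendAut n g (ratEmb n p) = ratEmb n (g p) := by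
  rw [ratEmb_apply, ratEmb_apply]
  refine (IsFractionRing.fieldEquivOfAlgEquiv_algebraMap ℂ _ _ _ _).trans ?_
  congr 1
  change MulAut.conj (polyTranslate fun _ => 1) g (polyTranslate (fun _ => 1) p) = _
  rw [MulAut.conj_apply, AlgEquiv.mul_apply, AlgEquiv.mul_apply, ← AlgEquiv.mul_apply _⁻¹,
    inv_mul_cancel, AlgEquiv.one_apply]

theorem ratFunc_algEquiv_ext {f g : RatFuncField n ≃ₐ[ℂ] RatFuncField n}
    (h : ∀ i, f (ratVar i) = g (ratVar i)) : f = g := by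
  have h1 : f.toAlgHom.comp (ratEmb n) = g.toAlgHom.comp (ratEmb n) :=
    MvPolynomial.algHom_ext fun i => by
      change f (ratEmb n (X i)) = g (ratEmb n (X i))
      rw [ratEmb_X, map_sub, map_sub, h, map_one, map_one]
  have h2 : ∀ p, f (ratEmb n p) = g (ratEmb n p) := fun p => DFunLike.congr_fun h1 p
  refine AlgEquiv.ext fun x => ?_
  obtain ⟨p, q, _, rfl⟩ := exists_ratEmb_div x
  rw [map_div₀, map_div₀, h2, h2]

theorem extendAut_injective : Function.Injective (extendAut n) := fun f g h => by
  refine AlgEquiv.ext fun p => ratEmb_injective ?_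
  rw [← extendAut_ratEmb, ← extendAut_ratEmb, h]

theorem extendAut_intTranslate_ratVar (a : Multiplicative (Fin n → ℤ)) (i : Fin n) :
    extendAut n (intTranslate n a) (ratVar i) = ratVar i - (a.toAdd i : RatFuncField n) := by
  rw [ratVar_eq, extendAut_ratEmb, map_add, intTranslate_X, map_one, map_add, map_add, map_sub,
    ← MvPolynomial.algebraMap_eq, AlgHom.commutes, map_intCast]
  ring

/-- The shift automorphisms, indexed by integer vectors. -/
def shift (n : ℕ) : Multiplicative (Fin n → ℤ) →* shiftMonoid n :=
  ((extendAut n).comp (intTranslate n)).codRestrict (shiftMonoid n) fun a =>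
    ⟨a.toAdd, extendAut_intTranslate_ratVar a⟩

theorem coe_shift (a : Multiplicative (Fin n → ℤ)) :
    (shift n a : RatFuncField n ≃ₐ[ℂ] RatFuncField n) = extendAut n (intTranslate n a) := rfl

theorem shift_surjective : Function.Surjective (shift n) := by
  rintro ⟨m, a, ha⟩
  refine ⟨Multiplicative.ofAdd a, Subtype.ext (ratFunc_algEquiv_ext fun i => ?_)⟩
  rw [coe_shift, extendAut_intTranslate_ratVar]
  exact (ha i).symm

theorem shift_injective : Function.Injective (shift n) := fun _ _ h =>
  intTranslate_injective (extendAut_injective (congrArg Subtype.val h))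

theorem shift_apply_ratEmb (a : Multiplicative (Fin n → ℤ)) (p : MvPolynomial (Fin n) ℂ) :
    (shift n a : RatFuncField n ≃ₐ[ℂ] RatFuncField n) (ratEmb n p) =
      ratEmb n (intTranslate n a p) := by
  rw [coe_shift, extendAut_ratEmb]

theorem extendAut_conj_mem {g : MvPolynomial (Fin n) ℂ ≃ₐ[ℂ] MvPolynomial (Fin n) ℂ}
    (hg : g ∈ signedPerms n) {m : RatFuncField n ≃ₐ[ℂ] RatFuncField n} (hm : m ∈ shiftMonoid n) :
    extendAut n g * m * (extendAut n g)⁻¹ ∈ shiftMonoid n := by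
  obtain ⟨a, ha⟩ := shift_surjective ⟨m, hm⟩
  obtain ⟨b, hb⟩ := exists_conj_intTranslate ⟨g, hg⟩ a
  rw [← Subtype.coe_mk m hm, ← ha, coe_shift, ← map_mul, ← map_inv, ← map_mul, ← hb]
  exact (shift n b).2

/-- Conjugation of shifts by a signed permutation. -/
def conjShift (g : signedPerms n) : shiftMonoid n →* shiftMonoid n where
  toFun m := ⟨extendAut n g * m * (extendAut n g)⁻¹, extendAut_conj_mem g.2 m.2⟩
  map_one' := Subtype.ext (by simp)
  map_mul' m m' := Subtype.ext (by
    change extendAut n g * (m * m' : RatFuncField n ≃ₐ[ℂ] RatFuncField n) * (extendAut n g)⁻¹ =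
      (extendAut n g * m * (extendAut n g)⁻¹) * (extendAut n g * m' * (extendAut n g)⁻¹)
    group)

theorem coe_conjShift (g : signedPerms n) (m : shiftMonoid n) :
    (conjShift g m : RatFuncField n ≃ₐ[ℂ] RatFuncField n) =
      extendAut n g * m * (extendAut n g)⁻¹ := rfl

theorem conjShift_shift (g : signedPerms n) (a : Multiplicative (Fin n → ℤ)) :
    conjShift g (shift n a) = shift n (g • a) := by
  refine Subtype.ext ?_
  rw [coe_conjShift, coe_shift, coe_shift, intTranslate_smul, map_mul, map_mul, map_inv]

theorem signedPerm_smul (π : Equiv.Perm (Fin n)) (δ : Fin n → ℤˣ)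
    (a : Multiplicative (Fin n → ℤ)) :
    (⟨signedPerm π δ, signedPerm_mem π δ⟩ : signedPerms n) • a =
      Multiplicative.ofAdd fun i => δ (π⁻¹ i) * a.toAdd (π⁻¹ i) := by
  apply intTranslate_injective
  rw [intTranslate_smul, signedPerm_mul_intTranslate, mul_inv_cancel_right]

/-- The equivariance needed for writing coefficients to the right of the shifts. -/
theorem smul_intTranslate_apply (g : signedPerms n) (a : Multiplicative (Fin n → ℤ))
    (p : MvPolynomial (Fin n) ℂ) :
    intTranslate n (g • a) (g • p) = g • intTranslate n a p := by
  rw [intTranslate_smul]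
  change g.1 (intTranslate n a ((g.1)⁻¹ (g.1 p))) = g.1 (intTranslate n a p)
  rw [← AlgEquiv.mul_apply (g.1)⁻¹, inv_mul_cancel, AlgEquiv.one_apply]

end Torus

end

noncomputable section

open MvPolynomial

/-! ### The skew monoid ring of shifts and the conjugation action -/

section Torus

variable {n : ℕ}

/-- The skew monoid algebra of the shifts over the field of rational functions. -/
abbrev ShiftAlgebra (n : ℕ) : Type := SkewMonoidAlgebra (RatFuncField n) (shiftMonoid n)

namespace ShiftAlgebra

/-- The embedding of the coefficient field. -/
def coeffHom (n : ℕ) : RatFuncField n →ₐ[ℂ] ShiftAlgebra n :=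
  { SkewMonoidAlgebra.singleOneRingHom with
    commutes' := fun _ => rfl }

theorem smul_def (m : shiftMonoid n) (r : RatFuncField n) :
    m • r = (m : RatFuncField n ≃ₐ[ℂ] RatFuncField n) r := rfl

theorem shift_smul_ratEmb (a : Multiplicative (Fin n → ℤ)) (p : MvPolynomial (Fin n) ℂ) :
    shift n a • ratEmb n p = ratEmb n (intTranslate n a p) :=
  shift_apply_ratEmb a p

theorem shift_smul_ratVar (a : Multiplicative (Fin n → ℤ)) (i : Fin n) :
    shift n a • ratVar i = ratVar i - (a.toAdd i : RatFuncField n) :=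
  extendAut_intTranslate_ratVar a i

/-- The identity (gmg⁻¹)(g r) = g(m r) makes the semilinear action multiplicative on the skew monoid
ring. -/
theorem conjShift_smul_extendAut (g : signedPerms n) (m : shiftMonoid n) (r : RatFuncField n) :
    conjShift g m • extendAut n g r = extendAut n g (m • r) := by
  rw [smul_def, smul_def, coe_conjShift, AlgEquiv.mul_apply, AlgEquiv.mul_apply,
    ← AlgEquiv.mul_apply _⁻¹, inv_mul_cancel, AlgEquiv.one_apply]

/-- The semilinear action of signed permutations, `∑ r m ↦ ∑ g (r) (g m g⁻¹)`. -/
def conjHom (g : signedPerms n) : ShiftAlgebra n →ₐ[ℂ] ShiftAlgebra n :=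
  SkewMonoidAlgebra.liftNCAlgHom ((coeffHom n).comp (extendAut n g).toAlgHom)
    ((SkewMonoidAlgebra.of (RatFuncField n) (shiftMonoid n)).comp (conjShift g)) (by
    intro r m
    have h1 : ((coeffHom n).comp (extendAut n g).toAlgHom) (m • r) =
      SkewMonoidAlgebra.single 1 (extendAut n g (m • r)) := rfl
    have h2 : ((coeffHom n).comp (extendAut n g).toAlgHom) r =
      SkewMonoidAlgebra.single 1 (extendAut n g r) := rfl
    rw [h1, h2, MonoidHom.comp_apply, SkewMonoidAlgebra.of_apply,
      SkewMonoidAlgebra.single_mul_single, SkewMonoidAlgebra.single_mul_single, one_mul, mul_one,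
      smul_one, mul_one, one_mul, conjShift_smul_extendAut])

theorem conjHom_single (g : signedPerms n) (m : shiftMonoid n) (r : RatFuncField n) :
    conjHom g (SkewMonoidAlgebra.single m r) =
      SkewMonoidAlgebra.single (conjShift g m) (extendAut n g r) := by
  have h : conjHom g (SkewMonoidAlgebra.single m r) =
      SkewMonoidAlgebra.single 1 (extendAut n g r) *
        SkewMonoidAlgebra.single (conjShift g m) 1 := SkewMonoidAlgebra.liftNC_single _ _ _ _
  rw [h, SkewMonoidAlgebra.single_mul_single, one_mul, smul_one, mul_one]

theorem conjShift_injective (g : signedPerms n) : Function.Injective (conjShift g) := by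
  intro m m' h
  have := congrArg Subtype.val h
  rw [coe_conjShift, coe_conjShift] at this
  exact Subtype.ext (mul_left_cancel (mul_right_cancel this))

theorem coeff_conjHom (g : signedPerms n) (f : ShiftAlgebra n) (m : shiftMonoid n) :
    (conjHom g f).coeff (conjShift g m) = extendAut n g (f.coeff m) := by
  classical
  induction f using SkewMonoidAlgebra.induction_on' with
  | single m' r =>
    rw [conjHom_single, SkewMonoidAlgebra.coeff_single, SkewMonoidAlgebra.coeff_single,
      Finsupp.single_apply, Finsupp.single_apply]
    simp only [(conjShift_injective g).eq_iff]
    split_ifs <;> simp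
  | add f f' hf hf' =>
    rw [map_add, SkewMonoidAlgebra.coeff_add, SkewMonoidAlgebra.coeff_add, Finsupp.add_apply,
      Finsupp.add_apply, hf, hf', map_add]

theorem conjShift_surjective (g : signedPerms n) : Function.Surjective (conjShift g) := by
  intro m
  obtain ⟨a, rfl⟩ := shift_surjective m
  exact ⟨shift n (g⁻¹ • a), by rw [conjShift_shift, smul_inv_smul]⟩

/-- Links invariance under the ring homomorphism with the coefficientwise description of
`skewInvariants`. -/
theorem conjHom_eq_self_iff (g : signedPerms n) (f : ShiftAlgebra n) :
    conjHom g f = f ↔ ∀ m, f.coeff (conjShift g m) = extendAut n g (f.coeff m) := by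
  constructor
  · intro h m
    rw [← coeff_conjHom, h]
  · intro h
    refine SkewMonoidAlgebra.ext fun m => ?_
    obtain ⟨m, rfl⟩ := conjShift_surjective g m
    rw [coeff_conjHom, h]

end ShiftAlgebra

/-- The basis vectors of the lattice of shifts. -/
def shiftGen (i : Fin n) : Multiplicative (Fin n → ℤ) := Multiplicative.ofAdd (Pi.single i 1)

namespace TorusWeyl

open SkewMonoidAlgebra
open scoped IsMulCommutative

/-! ## Normal forms in the localized Weyl algebra -/

theorem t_comm (i j : Fin n) : (t i : TorusWeyl n) * t j = t j * t i := by
  rcases eq_or_ne i j with rfl | h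
  · rfl
  have h1 : Commute (d i : TorusWeyl n) (d j) := d_comm i j
  have h2 : Commute (d i : TorusWeyl n) (x j) := d_mul_x_of_ne h
  have h3 : Commute (x i : TorusWeyl n) (d j) :=
    (show Commute (d j : TorusWeyl n) (x i) from d_mul_x_of_ne h.symm).symm
  have h4 : Commute (x i : TorusWeyl n) (x j) := x_comm i j
  exact (h1.mul_right h2).mul_left (h3.mul_right h4)

theorem isMulCommutative_adjoin_t :
    IsMulCommutative (Algebra.adjoin ℂ (Set.range (t (n := n)))) :=
  Algebra.isMulCommutative_adjoin ℂ (by rintro _ ⟨i, rfl⟩ _ ⟨j, rfl⟩; exact t_comm i j)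

theorem polynomials_comm {a b : TorusWeyl n} (ha : a ∈ polynomials n) (hb : b ∈ polynomials n) :
    a * b = b * a := by
  have := isMulCommutative_adjoin_t (n := n)
  exact congrArg Subtype.val
    (mul_comm (⟨a, ha⟩ : Algebra.adjoin ℂ (Set.range (t (n := n)))) ⟨b, hb⟩)

/-- The homomorphism from the polynomial ring with `X i ↦ t i - 1`. -/
def polyHom (n : ℕ) : MvPolynomial (Fin n) ℂ →ₐ[ℂ] TorusWeyl n :=
  have := isMulCommutative_adjoin_t (n := n)
  (Algebra.adjoin ℂ (Set.range (t (n := n)))).val.comp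
    (aeval fun i =>
    (⟨t i, Algebra.subset_adjoin ⟨i, rfl⟩⟩ : Algebra.adjoin ℂ (Set.range (t (n := n)))) - 1)

theorem polyHom_X (i : Fin n) : polyHom n (X i) = t i - 1 := by
  have := isMulCommutative_adjoin_t (n := n)
  have h : aeval (R := ℂ) (fun i =>
      (⟨t i, Algebra.subset_adjoin ⟨i, rfl⟩⟩ : Algebra.adjoin ℂ (Set.range (t (n := n)))) - 1)
      (X i) = (⟨t i, Algebra.subset_adjoin ⟨i, rfl⟩⟩ : Algebra.adjoin ℂ (Set.range t)) - 1 :=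
    aeval_X _ _
  exact congrArg Subtype.val h

theorem range_polyHom : (polyHom n).range = polynomials n := by
  apply le_antisymm
  · rintro _ ⟨p, rfl⟩
    induction p using MvPolynomial.induction_on with
    | C a =>
      rw [← MvPolynomial.algebraMap_eq]
      change polyHom n (algebraMap ℂ _ a) ∈ _
      rw [AlgHom.commutes]
      exact Subalgebra.algebraMap_mem _ a
    | add p q hp hq => rw [map_add]; exact add_mem hp hq
    | mul_X p i hp =>
      rw [map_mul]
      refine mul_mem hp ?_
      change polyHom n (X i) ∈ _
      rw [polyHom_X]
      exact sub_mem (t_mem_polynomials i) (one_mem _)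
  · refine Algebra.adjoin_le ?_
    rintro _ ⟨i, rfl⟩
    exact ⟨X i + 1, by
      change polyHom n (X i + 1) = _
      rw [map_add, polyHom_X, map_one, sub_add_cancel]⟩

theorem x_mul_t_self (i : Fin n) : (x i : TorusWeyl n) * t i = (t i - 1) * x i := by
  rw [t, d_mul_x_self, add_sub_cancel_right, ← d_mul_x_self, mul_assoc]

theorem x_mul_t_of_ne {i j : Fin n} (h : j ≠ i) : (x i : TorusWeyl n) * t j = t j * x i := by
  rw [t, ← mul_assoc, ← d_mul_x_of_ne h, mul_assoc, x_comm, mul_assoc]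

theorem x_mul_polyHom (i : Fin n) (p : MvPolynomial (Fin n) ℂ) :
    x i * polyHom n p = polyHom n (intTranslate n (shiftGen i) p) * x i := by
  induction p using MvPolynomial.induction_on with
  | C a =>
    rw [← MvPolynomial.algebraMap_eq, AlgEquiv.commutes, AlgHom.commutes]
    exact (Algebra.commutes a (x i)).symm
  | add p q hp hq => rw [map_add, map_add, map_add, mul_add, add_mul, hp, hq]
  | mul_X p j hp =>
    have h : (x i : TorusWeyl n) * (t j - 1) =
        polyHom n (intTranslate n (shiftGen i) (X j)) * x i := by
      rw [intTranslate_X, map_sub, polyHom_X, ← MvPolynomial.algebraMap_eq, AlgHom.commutes]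
      rcases eq_or_ne j i with rfl | h
      · rw [mul_sub, x_mul_t_self, mul_one]
        simp [shiftGen, sub_mul]
      · rw [mul_sub, x_mul_t_of_ne h, mul_one]
        simp [shiftGen, sub_mul, h]
    rw [map_mul, map_mul, map_mul, ← mul_assoc, hp, mul_assoc, mul_assoc, polyHom_X, h]

theorem y_mul_polyHom (i : Fin n) (p : MvPolynomial (Fin n) ℂ) :
    y i * polyHom n p = polyHom n (intTranslate n (shiftGen i)⁻¹ p) * y i := by
  have h := x_mul_polyHom i (intTranslate n (shiftGen i)⁻¹ p)
  rw [← AlgEquiv.mul_apply, ← map_mul, mul_inv_cancel, map_one, AlgEquiv.one_apply] at h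
  rw [← mul_one (polyHom n p), ← x_y i, ← mul_assoc (polyHom n p), ← h, ← mul_assoc, ← mul_assoc,
    y_x, one_mul]

/-- The coordinates as units. -/
def xUnit (i : Fin n) : (TorusWeyl n)ˣ := ⟨x i, y i, x_y i, y_x i⟩

theorem xUnit_commute : Pairwise fun i j => ∀ a b : Multiplicative ℤ,
    Commute (zpowersHom (TorusWeyl n)ˣ (xUnit i) a) (zpowersHom (TorusWeyl n)ˣ (xUnit j) b) :=
  fun i j _ a b => by
    have h : Commute (xUnit i) (xUnit j) := Units.ext (x_comm i j)
    simpa using h.zpow_zpow a.toAdd b.toAdd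

/-- The monomials in the coordinates and their inverses. -/
def xPow (n : ℕ) : Multiplicative (Fin n → ℤ) →* (TorusWeyl n)ˣ :=
  (MonoidHom.noncommPiCoprod (fun i => zpowersHom (TorusWeyl n)ˣ (xUnit i)) xUnit_commute).comp
  (MulEquiv.piMultiplicative fun _ : Fin n => ℤ).toMonoidHom

theorem xPow_shiftGen (i : Fin n) : xPow n (shiftGen i) = xUnit i := by
  have h : MulEquiv.piMultiplicative (fun _ : Fin n => ℤ) (shiftGen i) =
      Pi.mulSingle i (Multiplicative.ofAdd 1) := by
    funext j
    rcases eq_or_ne j i with rfl | h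
    · simp [shiftGen]
    · simp [shiftGen, h]
  rw [xPow, MonoidHom.comp_apply, MulEquiv.toMonoidHom_eq_coe, MonoidHom.coe_coe, h,
    MonoidHom.noncommPiCoprod_mulSingle]
  simp

end TorusWeyl

end Torus

end

noncomputable section

open MvPolynomial

section Torus

variable {n : ℕ}

theorem closure_range_shiftGen : Subgroup.closure (Set.range (shiftGen (n := n))) = ⊤ := by
  refine eq_top_iff.mpr fun a _ => ?_
  have h : a = ∏ i, shiftGen i ^ a.toAdd i := by
    refine Multiplicative.toAdd.injective (funext fun j => ?_)
    simp [shiftGen, toAdd_prod, Finset.sum_apply, Pi.single_apply]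
  rw [h]
  exact Subgroup.prod_mem _ fun i _ =>
    Subgroup.zpow_mem _ (Subgroup.subset_closure (Set.mem_range_self i)) _

namespace TorusWeyl

open SkewMonoidAlgebra

/-- The map that sends a family of polynomials `p a` to `∑ p a * x ^ a`. -/
def normalForm (n : ℕ) :
    (Multiplicative (Fin n → ℤ) →₀ MvPolynomial (Fin n) ℂ) →ₗ[ℂ] TorusWeyl n :=
  Finsupp.lsum ℂ fun a => (LinearMap.mulRight ℂ (xPow n a : TorusWeyl n)).comp
    (polyHom n).toLinearMap

theorem normalForm_single (a : Multiplicative (Fin n → ℤ)) (p : MvPolynomial (Fin n) ℂ) :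
    normalForm n (Finsupp.single a p) = polyHom n p * xPow n a := by
  simp [normalForm]

theorem t_mul_y (i : Fin n) : (t i : TorusWeyl n) * y i = d i := by
  rw [t, mul_assoc, x_y, mul_one]

/-- The span of the normal forms is a left ideal: x_i and y_i move past a polynomial at the cost of
a translation, t_i acts on the polynomial coefficient, and ∂_i = t_i y_i. Since it contains 1, it is
everything. -/
theorem mul_mem_range_normalForm {u v : TorusWeyl n} (hv : v ∈ LinearMap.range (normalForm n)) :
    u * v ∈ LinearMap.range (normalForm n) := by
  have key : ∀ w : TorusWeyl n, (∀ a p, w * (polyHom n p * xPow n a) ∈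
      LinearMap.range (normalForm n)) → ∀ v ∈ LinearMap.range (normalForm n),
      w * v ∈ LinearMap.range (normalForm n) := by
    rintro w hw _ ⟨f, rfl⟩
    induction f using Finsupp.induction_linear with
    | zero => rw [map_zero, mul_zero]; exact zero_mem _
    | add f f' hf hf' => rw [map_add, mul_add]; exact add_mem hf hf'
    | single a p => rw [normalForm_single]; exact hw a p
  have hx : ∀ i, ∀ v ∈ LinearMap.range (normalForm n),
      x i * v ∈ LinearMap.range (normalForm n) := fun i => key _ fun a p => by
    refine ⟨Finsupp.single (shiftGen i * a) (intTranslate n (shiftGen i) p), ?_⟩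
    rw [normalForm_single, ← mul_assoc, x_mul_polyHom, map_mul, xPow_shiftGen, Units.val_mul,
      ← mul_assoc]
    rfl
  have hy : ∀ i, ∀ v ∈ LinearMap.range (normalForm n),
      y i * v ∈ LinearMap.range (normalForm n) := fun i => key _ fun a p => by
    refine ⟨Finsupp.single ((shiftGen i)⁻¹ * a) (intTranslate n (shiftGen i)⁻¹ p), ?_⟩
    rw [normalForm_single, ← mul_assoc, y_mul_polyHom, map_mul, map_inv (xPow n), xPow_shiftGen,
      Units.val_mul, ← mul_assoc]
    rfl
  have ht : ∀ i, ∀ v ∈ LinearMap.range (normalForm n),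
      t i * v ∈ LinearMap.range (normalForm n) := fun i => key _ fun a p => by
    refine ⟨Finsupp.single a ((X i + 1) * p), ?_⟩
    rw [normalForm_single, map_mul, map_add, polyHom_X, map_one, sub_add_cancel, mul_assoc]
  obtain ⟨u, rfl⟩ : ∃ a, mk n a = u := RingQuot.mkAlgHom_surjective ℂ (TorusRel n) u
  induction u using FreeAlgebra.induction generalizing v with
  | grade0 r =>
    rw [AlgHom.commutes, ← Algebra.smul_def]
    exact Submodule.smul_mem _ r hv
  | grade1 a =>
    cases a with
    | x i => exact hx i v hv
    | y i => exact hy i v hv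
    | d i =>
      change d i * v ∈ _
      rw [← t_mul_y, mul_assoc]
      exact ht i _ (hy i v hv)
  | mul a b ha hb => rw [map_mul, mul_assoc]; exact ha (hb hv)
  | add a b ha hb => rw [map_add, add_mul]; exact add_mem (ha hv) (hb hv)

theorem normalForm_surjective : Function.Surjective (normalForm n) := by
  intro u
  have h : (1 : TorusWeyl n) ∈ LinearMap.range (normalForm n) :=
    ⟨Finsupp.single 1 1, by rw [normalForm_single]; simp⟩
  have := mul_mem_range_normalForm (u := u) h
  rwa [mul_one] at this

/-! ## The embedding in the skew monoid algebra -/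

theorem shift_smul_algebraMap (a : Multiplicative (Fin n → ℤ)) (w : ℂ) :
    shift n a • algebraMap ℂ (RatFuncField n) w = algebraMap ℂ (RatFuncField n) w :=
  AlgEquiv.commutes (shift n a : RatFuncField n ≃ₐ[ℂ] RatFuncField n) w

theorem shiftGen_inv_smul_ratVar (i j : Fin n) :
    shift n (shiftGen i)⁻¹ • (ratVar j : RatFuncField n) = ratVar j + if i = j then 1 else 0 := by
  rw [ShiftAlgebra.shift_smul_ratVar]
  rcases eq_or_ne i j with rfl | h
  · simp [shiftGen]
  · simp [shiftGen, h, h.symm]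

theorem shiftGen_smul_ratVar (i j : Fin n) :
    shift n (shiftGen i) • (ratVar j : RatFuncField n) = ratVar j - if i = j then 1 else 0 := by
  rw [ShiftAlgebra.shift_smul_ratVar]
  rcases eq_or_ne i j with rfl | h
  · simp [shiftGen]
  · simp [shiftGen, h, h.symm]

theorem single_shift_mul (a b : Multiplicative (Fin n → ℤ)) (r s : RatFuncField n) :
    (single (shift n a) r * single (shift n b) s : ShiftAlgebra n) =
      single (shift n (a * b)) (r * shift n a • s) := by
  rw [single_mul_single, map_mul]

variable (c : ℂˣ)

theorem algebraMap_inv_mul :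
    algebraMap ℂ (RatFuncField n) ((c⁻¹ : ℂˣ) : ℂ) * algebraMap ℂ (RatFuncField n) (c : ℂ) = 1 := by
  rw [← map_mul, Units.inv_mul, map_one]

/-- Images of the `x i`. -/
def shiftX (i : Fin n) : ShiftAlgebra n := single (shift n (shiftGen i)) (algebraMap ℂ _ (c : ℂ))

/-- Images of the `y i`. -/
def shiftY (i : Fin n) : ShiftAlgebra n :=
  single (shift n (shiftGen i)⁻¹) (algebraMap ℂ _ ((c⁻¹ : ℂˣ) : ℂ))

/-- Images of the `d i`. -/
def shiftD (i : Fin n) : ShiftAlgebra n :=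
  single (shift n (shiftGen i)⁻¹) (algebraMap ℂ _ ((c⁻¹ : ℂˣ) : ℂ) * ratVar i)

theorem shiftX_comm (i j : Fin n) : shiftX c i * shiftX c j = shiftX c j * shiftX c i := by
  rw [shiftX, shiftX, single_shift_mul, single_shift_mul, shift_smul_algebraMap,
    shift_smul_algebraMap, mul_comm (shiftGen i)]

theorem shiftX_shiftY (i : Fin n) : shiftX c i * shiftY c i = 1 := by
  rw [shiftX, shiftY, single_shift_mul, shift_smul_algebraMap, mul_inv_cancel, mul_comm,
    algebraMap_inv_mul, map_one, SkewMonoidAlgebra.one_def]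

theorem shiftY_shiftX (i : Fin n) : shiftY c i * shiftX c i = 1 := by
  rw [shiftX, shiftY, single_shift_mul, shift_smul_algebraMap, inv_mul_cancel,
    algebraMap_inv_mul, map_one, SkewMonoidAlgebra.one_def]

theorem shiftD_comm (i j : Fin n) : shiftD c i * shiftD c j = shiftD c j * shiftD c i := by
  rcases eq_or_ne i j with rfl | h
  · rfl
  rw [shiftD, shiftD, single_shift_mul, single_shift_mul, smul_mul', smul_mul',
    shift_smul_algebraMap, shift_smul_algebraMap, mul_comm (shiftGen i)⁻¹,
    shiftGen_inv_smul_ratVar, shiftGen_inv_smul_ratVar, if_neg h, if_neg h.symm, add_zero,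
    add_zero, mul_comm (_ * ratVar i)]

theorem shiftD_mul_shiftX (i j : Fin n) : shiftD c i * shiftX c j =
    single (shift n ((shiftGen i)⁻¹ * shiftGen j)) (ratVar i) := by
  rw [shiftD, shiftX, single_shift_mul, shift_smul_algebraMap, mul_right_comm, algebraMap_inv_mul,
    one_mul]

theorem shiftX_mul_shiftD (i j : Fin n) : shiftX c j * shiftD c i =
    single (shift n ((shiftGen i)⁻¹ * shiftGen j)) (ratVar i - if j = i then 1 else 0) := by
  rw [shiftD, shiftX, single_shift_mul, smul_mul', shift_smul_algebraMap, shiftGen_smul_ratVar,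
    ← mul_assoc, mul_comm (algebraMap _ _ (c : ℂ)), algebraMap_inv_mul, one_mul,
    mul_comm (shiftGen j)]

theorem shiftD_shiftX (i j : Fin n) :
    shiftD c i * shiftX c j - shiftX c j * shiftD c i = if i = j then 1 else 0 := by
  rw [shiftD_mul_shiftX, shiftX_mul_shiftD, sub_eq_iff_eq_add]
  rcases eq_or_ne i j with rfl | h
  · rw [if_pos rfl, if_pos rfl, inv_mul_cancel, map_one, SkewMonoidAlgebra.one_def, ← single_add,
      add_sub_cancel]
  · rw [if_neg h, if_neg h.symm, sub_zero, zero_add]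

/-- The homomorphism to the skew monoid algebra, with `x i ↦ c * σ i`. -/
def toShift : TorusWeyl n →ₐ[ℂ] ShiftAlgebra n :=
  lift (shiftX c) (shiftY c) (shiftD c) (shiftX_comm c) (shiftD_comm c) (shiftD_shiftX c)
    (shiftX_shiftY c) (shiftY_shiftX c)

theorem toShift_x (i : Fin n) :
    toShift c (x i) = single (shift n (shiftGen i)) (algebraMap ℂ _ (c : ℂ)) := lift_x ..

theorem toShift_y (i : Fin n) :
    toShift c (y i) = single (shift n (shiftGen i)⁻¹) (algebraMap ℂ _ ((c⁻¹ : ℂˣ) : ℂ)) := lift_y ..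

theorem toShift_d (i : Fin n) : toShift c (d i) =
    single (shift n (shiftGen i)⁻¹) (algebraMap ℂ _ ((c⁻¹ : ℂˣ) : ℂ) * ratVar i) := lift_d ..

theorem toShift_t (i : Fin n) : toShift c (t i) = single 1 (ratVar i) := by
  rw [t, map_mul, toShift_x, toShift_d]
  refine (shiftD_mul_shiftX c i i).trans ?_
  rw [inv_mul_cancel, map_one]

theorem toShift_polyHom (p : MvPolynomial (Fin n) ℂ) :
    toShift c (polyHom n p) = single 1 (ratEmb n p) := by
  have h : (toShift c).comp (polyHom n) = (ShiftAlgebra.coeffHom n).comp (ratEmb n) :=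
    MvPolynomial.algHom_ext fun i => by
      rw [AlgHom.comp_apply, AlgHom.comp_apply, polyHom_X, ratEmb_X, map_sub, map_sub, map_one,
        map_one, toShift_t]
      rfl
  exact DFunLike.congr_fun h p

/-- Each x_i contributes one factor c, so the exponent of c is the total degree of the monomial; it
suffices to compare two homomorphisms on the generators of ℤ^n. -/
theorem toShift_xPow (a : Multiplicative (Fin n → ℤ)) : toShift c (xPow n a) =
    single (shift n a) (algebraMap ℂ _ ((c ^ (∑ i, a.toAdd i) : ℂˣ) : ℂ)) := by
  let f : Multiplicative (Fin n → ℤ) →* ShiftAlgebra n :=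
    ((toShift (n := n) c).toRingHom.toMonoidHom.comp (Units.coeHom _)).comp (xPow n)
  let g : Multiplicative (Fin n → ℤ) →* ShiftAlgebra n :=
    { toFun := fun a => single (shift n a) (algebraMap ℂ _ ((c ^ (∑ i, a.toAdd i) : ℂˣ) : ℂ))
      map_one' := by
        rw [map_one, toAdd_one]
        simp
      map_mul' := fun a b => by
        rw [single_mul_single, shift_smul_algebraMap, ← map_mul, ← map_mul, ← Units.val_mul,
          ← zpow_add, ← Finset.sum_add_distrib]
        rfl }
  have h : f = g := by
    refine MonoidHom.eq_of_eqOn_dense closure_range_shiftGen ?_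
    rintro _ ⟨i, rfl⟩
    change toShift c (xPow n (shiftGen i)) =
      single (shift n (shiftGen i)) (algebraMap ℂ _ ((c ^ (∑ j, (shiftGen i).toAdd j) : ℂˣ) : ℂ))
    have h1 : ∑ j, (shiftGen i).toAdd j = 1 := by simp [shiftGen]
    rw [h1, zpow_one, xPow_shiftGen]
    exact toShift_x c i
  exact DFunLike.congr_fun h a

theorem toShift_normalForm (f : Multiplicative (Fin n → ℤ) →₀ MvPolynomial (Fin n) ℂ)
    (a : Multiplicative (Fin n → ℤ)) :
    (toShift c (normalForm n f)).coeff (shift n a) =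
      ratEmb n (C ((c ^ (∑ i, a.toAdd i) : ℂˣ) : ℂ) * f a) := by
  classical
  induction f using Finsupp.induction_linear with
  | zero => simp
  | add f f' hf hf' =>
    rw [map_add, map_add, SkewMonoidAlgebra.coeff_add, Finsupp.add_apply, hf, hf', Finsupp.add_apply, mul_add,
      map_add]
  | single b p =>
    rw [normalForm_single, map_mul, toShift_polyHom, toShift_xPow, single_mul_single, one_mul,
      one_smul, coeff_single, Finsupp.single_apply, Finsupp.single_apply]
    simp only [shift_injective.eq_iff]
    split_ifs with h
    · rw [h, map_mul, ← MvPolynomial.algebraMap_eq, AlgHom.commutes, mul_comm]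
    · rw [mul_zero, map_zero]

/-- The coefficients of the image recover, up to the units c^|a|, the polynomials of a normal form.
So the normal form is unique as well, with no separate basis theorem for the Weyl algebra. -/
theorem toShift_injective : Function.Injective (toShift (n := n) c) := by
  rw [injective_iff_map_eq_zero]
  intro u hu
  obtain ⟨f, rfl⟩ := normalForm_surjective u
  have h : f = 0 := Finsupp.ext fun a => by
    have h1 := toShift_normalForm c f a
    rw [hu, SkewMonoidAlgebra.coeff_zero, Finsupp.zero_apply, eq_comm, map_eq_zero_iff _ ratEmb_injective] at h1
    refine (mul_eq_zero.mp h1).resolve_left ?_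
    rw [C_eq_zero]
    exact Units.ne_zero _
  rw [h, map_zero]

theorem mem_range_toShift_iff (f : ShiftAlgebra n) :
    f ∈ Set.range (toShift c) ↔ ∀ m, f.coeff m ∈ Set.range (ratEmb n) := by
  classical
  constructor
  · rintro ⟨u, rfl⟩ m
    obtain ⟨a, rfl⟩ := shift_surjective m
    obtain ⟨f, rfl⟩ := normalForm_surjective u
    exact ⟨_, (toShift_normalForm c f a).symm⟩
  · intro h
    choose p hp using h
    have hp0 : ∀ m, p m = 0 ↔ f.coeff m = 0 := fun m => by
      rw [← hp, map_eq_zero_iff _ ratEmb_injective]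
    let q : Multiplicative (Fin n → ℤ) →₀ MvPolynomial (Fin n) ℂ :=
      Finsupp.ofSupportFinite (fun a => C (((c ^ (∑ i, a.toAdd i))⁻¹ : ℂˣ) : ℂ) * p (shift n a)) (by
        refine (Set.Finite.preimage shift_injective.injOn f.coeff.support.finite_toSet).subset ?_
        intro a ha
        rw [Set.mem_preimage, Finset.mem_coe, Finsupp.mem_support_iff, Ne, ← hp0]
        intro h
        exact ha (by change _ * _ = _; rw [h, mul_zero]))
    refine ⟨normalForm n q, SkewMonoidAlgebra.ext fun m => ?_⟩
    obtain ⟨a, rfl⟩ := shift_surjective m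
    rw [toShift_normalForm]
    change ratEmb n (_ * (_ * _)) = _
    rw [← mul_assoc, ← map_mul, Units.mul_inv, map_one, one_mul, hp]

/-! ## Equivariance -/

/-- The signs of a sign change. -/
def flipSign (s : Finset (Fin n)) (i : Fin n) : ℤˣ := if i ∈ s then -1 else 1

/-- Linear in X_i = t_i − 1 means affine in t_i: a sign change is t_i ↦ 2 − t_i. -/
theorem extendAut_signedPerm_ratVar (π : Equiv.Perm (Fin n)) (δ : Fin n → ℤˣ) (i : Fin n) :
    extendAut n (signedPerm π δ) (ratVar i) =
      ((δ i : ℤ) : RatFuncField n) * (ratVar (π i) - 1) + 1 := by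
  rw [ratVar_eq, extendAut_ratEmb, map_add, map_one, map_add, map_one, signedPerm_X, map_mul,
    ratEmb_X, ← MvPolynomial.algebraMap_eq, AlgHom.commutes, map_intCast]

theorem signedPerm_smul_shiftGen (π : Equiv.Perm (Fin n)) (δ : Fin n → ℤˣ) (i : Fin n) :
    (⟨signedPerm π δ, signedPerm_mem π δ⟩ : signedPerms n) • shiftGen i =
      shiftGen (π i) ^ (δ i : ℤ) := by
  rw [signedPerm_smul]
  refine Multiplicative.toAdd.injective (funext fun j => ?_)
  rcases eq_or_ne j (π i) with rfl | h
  · simp [shiftGen]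
  · have h2 : π⁻¹ j ≠ i := fun h' => h (by rw [← h']; simp)
    change (δ (π⁻¹ j) : ℤ) * Pi.single (M := fun _ => ℤ) i 1 (π⁻¹ j) = _
    rw [Pi.single_eq_of_ne h2]
    simp [shiftGen, h]

theorem toShift_perm (π : Equiv.Perm (Fin n)) (u : TorusWeyl n) : toShift c (perm π u) =
    ShiftAlgebra.conjHom ⟨signedPerm π 1, signedPerm_mem π 1⟩ (toShift c u) := by
  have key : (toShift c).comp (perm π).toAlgHom =
      (ShiftAlgebra.conjHom ⟨signedPerm π 1, signedPerm_mem π 1⟩).comp (toShift c) := by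
    apply algHom_ext
    · intro i
      change toShift c (perm π (x i)) = ShiftAlgebra.conjHom _ (toShift c (x i))
      rw [perm_x, toShift_x, toShift_x, ShiftAlgebra.conjHom_single, conjShift_shift,
        signedPerm_smul_shiftGen, AlgEquiv.commutes]
      simp
    · intro i
      change toShift c (perm π (y i)) = ShiftAlgebra.conjHom _ (toShift c (y i))
      rw [show perm π (y i) = y (π i) by simp [perm, permHom], toShift_y, toShift_y,
        ShiftAlgebra.conjHom_single, conjShift_shift, smul_inv',
        signedPerm_smul_shiftGen, AlgEquiv.commutes]
      simp
    · intro i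
      change toShift c (perm π (d i)) = ShiftAlgebra.conjHom _ (toShift c (d i))
      rw [perm_d, toShift_d, toShift_d, ShiftAlgebra.conjHom_single, conjShift_shift, smul_inv',
        signedPerm_smul_shiftGen, map_mul, AlgEquiv.commutes, extendAut_signedPerm_ratVar]
      simp
  exact DFunLike.congr_fun key u

theorem smul_single_units (δ : ℤˣ) (m : shiftMonoid n) (r : RatFuncField n) :
    (δ : ℤ) • (single m r : ShiftAlgebra n) = single m (algebraMap ℂ _ ((δ : ℤ) : ℂ) * r) := by
  rw [map_intCast]
  rcases Int.units_eq_one_or δ with rfl | rfl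
  · simp
  · simp [single_neg]

/-- The sign change sends x_i to δx_i⁻¹, with image δc⁻¹σ_i⁻¹, while conjugation sends cσ_i to
cσ_i⁻¹. The two agree exactly when c² = δ. -/
theorem toShift_flip {δ : ℤˣ} (hc : (c : ℂ) * c = (δ : ℤ)) (s : Finset (Fin n)) (u : TorusWeyl n) :
    toShift c (flip δ s u) = ShiftAlgebra.conjHom
      ⟨signedPerm 1 (flipSign s), signedPerm_mem 1 (flipSign s)⟩ (toShift c u) := by
  have hδ : (((δ : ℤ) : ℂ)) * ((δ : ℤ) : ℂ) = 1 := by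
    rcases Int.units_eq_one_or δ with rfl | rfl <;> simp
  have hc0 : (c : ℂ) * ((c⁻¹ : ℂˣ) : ℂ) = 1 := Units.mul_inv c
  have h1 : ((δ : ℤ) : ℂ) * ((c⁻¹ : ℂˣ) : ℂ) = c := by
    rw [← hc, mul_assoc, hc0, mul_one]
  have h2 : ((δ : ℤ) : ℂ) * c = ((c⁻¹ : ℂˣ) : ℂ) := by
    linear_combination ((c⁻¹ : ℂˣ) : ℂ) * hδ - ((δ : ℤ) : ℂ) * h1
  have key : (toShift c).comp (flip δ s).toAlgHom =
      (ShiftAlgebra.conjHom ⟨signedPerm 1 (flipSign s), signedPerm_mem 1 (flipSign s)⟩).comp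
        (toShift c) := by
    apply algHom_ext
    · intro i
      change toShift c (flip δ s (x i)) = ShiftAlgebra.conjHom _ (toShift c (x i))
      rw [flip_x, toShift_x, ShiftAlgebra.conjHom_single, conjShift_shift,
        signedPerm_smul_shiftGen, AlgEquiv.commutes]
      by_cases hi : i ∈ s
      · rw [if_pos hi, map_zsmul, toShift_y, smul_single_units, ← map_mul, h1]
        simp [flipSign, hi]
      · rw [if_neg hi, toShift_x]
        simp [flipSign, hi]
    · intro i
      change toShift c (flip δ s (y i)) = ShiftAlgebra.conjHom _ (toShift c (y i))
      rw [show flip δ s (y i) = if i ∈ s then (δ : ℤ) • x i else y i by simp [flip, flipY],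
        toShift_y, ShiftAlgebra.conjHom_single, conjShift_shift, smul_inv',
        signedPerm_smul_shiftGen, AlgEquiv.commutes]
      by_cases hi : i ∈ s
      · rw [if_pos hi, map_zsmul, toShift_x, smul_single_units, ← map_mul, h2]
        simp [flipSign, hi]
      · rw [if_neg hi, toShift_y]
        simp [flipSign, hi]
    · intro i
      change toShift c (flip δ s (d i)) = ShiftAlgebra.conjHom _ (toShift c (d i))
      rw [flip_d, toShift_d, ShiftAlgebra.conjHom_single, conjShift_shift, smul_inv',
        signedPerm_smul_shiftGen, map_mul, AlgEquiv.commutes, extendAut_signedPerm_ratVar]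
      by_cases hi : i ∈ s
      -- Here −δx_i²∂_i maps to −δc²σ_i²·c⁻¹t_iσ_i⁻¹ = δc(2 − t_i)σ_i, since σ_i² shifts t_i by 2,
      -- and conjugation gives c⁻¹(2 − t_i)σ_i; finally δc = c⁻¹.
      · rw [if_pos hi, map_neg, map_zsmul, map_mul, map_pow, toShift_x, toShift_d, pow_two,
          single_mul_single, single_mul_single, smul_single_units, ← single_neg, smul_mul',
          ← map_mul, ← map_mul, shift_smul_algebraMap, shift_smul_algebraMap,
          ShiftAlgebra.shift_smul_ratVar, mul_inv_cancel_right]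
        have h3 : ((flipSign s i : ℤˣ) : ℤ) = -1 := by simp [flipSign, hi]
        have h4 : Multiplicative.toAdd (shiftGen i * shiftGen i) i = 2 := by simp [shiftGen]
        rw [h3, h4, zpow_neg, zpow_one, inv_inv, Equiv.Perm.one_apply]
        congr 1
        have h5 := congrArg (algebraMap ℂ (RatFuncField n)) h2
        have h6 := congrArg (algebraMap ℂ (RatFuncField n)) hc0
        rw [map_mul] at h5 h6
        rw [map_one] at h6
        rw [Int.cast_neg, Int.cast_one, Int.cast_ofNat]
        linear_combination (2 - ratVar i) * (algebraMap ℂ (RatFuncField n) ((δ : ℤ) : ℂ) *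
          algebraMap ℂ (RatFuncField n) (c : ℂ) * h6 + h5)
      · rw [if_neg hi, toShift_d]
        simp [flipSign, hi]
  exact DFunLike.congr_fun key u

end TorusWeyl

end Torus

end

noncomputable section

open MvPolynomial

section Torus

variable {n : ℕ}

/-! ## Reflections among the signed permutations -/

/-- A reflection: it is the identity modulo a nonzero linear form. -/
def IsPolyReflection (g : signedPerms n) : Prop :=
  ∃ α : MvPolynomial (Fin n) ℂ, α ≠ 0 ∧ α.IsHomogeneous 1 ∧ ∀ p, α ∣ p - g • p

/-- The operator 1 − g is a twisted derivation, so divisibility need only be checked on the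
variables. -/
theorem dvd_sub_smul {g : signedPerms n} {α : MvPolynomial (Fin n) ℂ}
    (h : ∀ i, α ∣ X i - g • X i) (p : MvPolynomial (Fin n) ℂ) : α ∣ p - g • p := by
  induction p using MvPolynomial.induction_on with
  | C a =>
    have : g • (C a : MvPolynomial (Fin n) ℂ) = C a := AlgEquiv.commutes g.1 a
    rw [this, sub_self]
    exact dvd_zero _
  | add p q hp hq =>
    rw [smul_add, add_sub_add_comm]
    exact dvd_add hp hq
  | mul_X p i hp =>
    rw [smul_mul', show p * X i - g • p * g • X i = p * (X i - g • X i) + (p - g • p) * g • X i by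
      ring]
    exact dvd_add ((h i).mul_left p) (hp.mul_right _)

/-- Signed permutations as elements of the group. -/
def signedPermOf (π : Equiv.Perm (Fin n)) (δ : Fin n → ℤˣ) : signedPerms n :=
  ⟨signedPerm π δ, signedPerm_mem π δ⟩

theorem signedPermOf_smul_X (π : Equiv.Perm (Fin n)) (δ : Fin n → ℤˣ) (i : Fin n) :
    signedPermOf π δ • (X i : MvPolynomial (Fin n) ℂ) = C ((δ i : ℤ) : ℂ) * X (π i) :=
  signedPerm_X π δ i

theorem signedPermOf_mul (π π' : Equiv.Perm (Fin n)) (δ δ' : Fin n → ℤˣ) :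
    signedPermOf π δ * signedPermOf π' δ' = signedPermOf (π * π') (fun i => δ' i * δ (π' i)) :=
  Subtype.ext (signedPerm_mul π π' δ δ')

theorem X_add_C_mul_X_ne_zero {i j : Fin n} (h : i ≠ j) (a : ℂ) :
    (X i + C a * X j : MvPolynomial (Fin n) ℂ) ≠ 0 := fun h0 => by
  have h1 := congrArg (MvPolynomial.eval (Pi.single i 1)) h0
  simp [h.symm] at h1

/-- The linear form is X_i − δ_i X_j. Both sorts of root are covered: δ_i = 1 gives the
transposition and δ_i = −1 the transposition combined with two sign changes. -/
theorem isPolyReflection_swap {i j : Fin n} (h : i ≠ j) {δ : Fin n → ℤˣ} (hij : δ i = δ j)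
    (hδ : ∀ k, k ≠ i → k ≠ j → δ k = 1) : IsPolyReflection (signedPermOf (Equiv.swap i j) δ) := by
  refine ⟨X i + C (-((δ i : ℤ) : ℂ)) * X j, X_add_C_mul_X_ne_zero h _,
    (isHomogeneous_X _ _).add (isHomogeneous_C_mul_X _ _), dvd_sub_smul fun k => ?_⟩
  rw [signedPermOf_smul_X]
  rcases eq_or_ne k i with rfl | hi
  · rw [Equiv.swap_apply_left, map_neg, neg_mul, ← sub_eq_add_neg]
  rcases eq_or_ne k j with rfl | hj
  · rw [Equiv.swap_apply_right, hij]
    rcases Int.units_eq_one_or (δ k) with h1 | h1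
    · rw [h1]
      exact ⟨-1, by simp; ring⟩
    · rw [h1]
      exact ⟨1, by simp [add_comm]⟩
  · rw [Equiv.swap_apply_of_ne_of_ne hi hj, hδ k hi hj]
    simp

theorem isPolyReflection_flip (i : Fin n) :
    IsPolyReflection (signedPermOf 1 (TorusWeyl.flipSign {i})) := by
  refine ⟨X i, X_ne_zero i, isHomogeneous_X _ _, dvd_sub_smul fun k => ?_⟩
  rw [signedPermOf_smul_X]
  rcases eq_or_ne k i with rfl | hi
  · refine Dvd.dvd.sub ?_ ?_
    · rfl
    · exact dvd_mul_left _ _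
  · simp [TorusWeyl.flipSign, hi]

/-- Turns generation by reflections inside all signed permutations into generation of the subgroup
as a group in its own right, as Chevalley's theorem requires. -/
theorem closure_reflections_eq_top {T : Set (signedPerms n)}
    (hT : ∀ t ∈ T, t ∈ Subgroup.closure {r | r ∈ Subgroup.closure T ∧ IsPolyReflection r}) :
    Subgroup.closure {r : Subgroup.closure T | IsPolyReflection r.1} = ⊤ := by
  refine eq_top_iff.mpr fun x _ => ?_
  have h1 : x.1 ∈ (Subgroup.closure {r : Subgroup.closure T | IsPolyReflection r.1}).map
      (Subgroup.closure T).subtype := by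
    rw [MonoidHom.map_closure]
    refine Subgroup.closure_mono ?_ ((Subgroup.closure_le _).mpr hT x.2)
    rintro r ⟨hr, hr'⟩
    exact ⟨⟨r, hr⟩, hr', rfl⟩
  obtain ⟨y, hy, hxy⟩ := h1
  rwa [← Subtype.ext (a1 := y) (a2 := x) hxy]

/-- Permutations among the signed permutations. -/
def permsHom (n : ℕ) : Equiv.Perm (Fin n) →* signedPerms n where
  toFun π := signedPermOf π 1
  map_one' := Subtype.ext signedPerm_one
  map_mul' π π' := by rw [signedPermOf_mul]; rfl

theorem perm_mem_closure_reflections {T : Set (signedPerms n)}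
    (hT : Set.range (permsHom n) ⊆ T) (π : Equiv.Perm (Fin n)) :
    permsHom n π ∈ Subgroup.closure {r | r ∈ Subgroup.closure T ∧ IsPolyReflection r} := by
  have h : π ∈ Subgroup.closure {σ : Equiv.Perm (Fin n) | σ.IsSwap} := by
    rw [Equiv.Perm.closure_isSwap]; trivial
  rw [← Subgroup.mem_comap]
  refine (Subgroup.closure_le _).mpr ?_ h
  rintro _ ⟨i, j, hij, rfl⟩
  exact Subgroup.subset_closure ⟨Subgroup.subset_closure (hT ⟨_, rfl⟩),
    isPolyReflection_swap hij rfl fun _ _ _ => rfl⟩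

/-- Type D contains no single sign change, so the signs are removed in pairs: changing the signs of
i and j is the product of the reflections in X_i + X_j and X_i − X_j. -/
theorem flip_mem_closure_reflections {T : Set (signedPerms n)}
    (hT : Set.range (permsHom n) ⊆ T)
    (hT' : ∀ s : Finset (Fin n), Even s.card → signedPermOf 1 (TorusWeyl.flipSign s) ∈ T)
    (s : Finset (Fin n)) (hs : Even s.card) : signedPermOf 1 (TorusWeyl.flipSign s) ∈
      Subgroup.closure {r | r ∈ Subgroup.closure T ∧ IsPolyReflection r} := by
  induction s using Finset.strongInduction with
  | H s ih =>
    rcases Nat.lt_or_ge 1 s.card with h | h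
    · obtain ⟨i, hi, j, hj, hij⟩ := Finset.one_lt_card.mp h
      have h1 : signedPermOf 1 (TorusWeyl.flipSign s) =
          signedPermOf 1 (TorusWeyl.flipSign ((s.erase i).erase j)) *
          (signedPermOf (Equiv.swap i j) (TorusWeyl.flipSign {i, j}) *
            permsHom n (Equiv.swap i j)) := by
        change _ = _ * (_ * signedPermOf (Equiv.swap i j) 1)
        rw [signedPermOf_mul, signedPermOf_mul, Equiv.swap_mul_self, one_mul]
        congr 1
        funext k
        simp only [TorusWeyl.flipSign, Finset.mem_erase, Finset.mem_insert, Finset.mem_singleton,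
          Pi.one_apply, one_mul, Equiv.Perm.one_apply]
        rcases eq_or_ne k i with rfl | hki
        · simp [hi]
        rcases eq_or_ne k j with rfl | hkj
        · simp [hj]
        · simp [Equiv.swap_apply_of_ne_of_ne hki hkj, hki, hkj]
      have hc : ((s.erase i).erase j).card = s.card - 2 := by
        rw [Finset.card_erase_of_mem (Finset.mem_erase.mpr ⟨hij.symm, hj⟩),
          Finset.card_erase_of_mem hi]
        rfl
      rw [h1]
      refine Subgroup.mul_mem _ (ih _ ?_ ?_) (Subgroup.mul_mem _ ?_
        (perm_mem_closure_reflections hT _))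
      · exact (Finset.erase_subset _ _).trans_ssubset (Finset.erase_ssubset hi)
      · rw [hc]
        exact (Nat.even_sub h).mpr (by simp [hs])
      · refine Subgroup.subset_closure ⟨?_, isPolyReflection_swap hij ?_ ?_⟩
        · have h2 : signedPermOf (Equiv.swap i j) (TorusWeyl.flipSign {i, j}) =
              permsHom n (Equiv.swap i j) * signedPermOf 1 (TorusWeyl.flipSign {i, j}) := by
            change _ = signedPermOf _ 1 * _
            rw [signedPermOf_mul, mul_one]
            congr 1
            funext k
            simp
          rw [h2]
          refine Subgroup.mul_mem _ (Subgroup.subset_closure (hT ⟨_, rfl⟩))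
            (Subgroup.subset_closure (hT' _ ?_))
          rw [Finset.card_pair hij]
          exact even_two
        · simp [TorusWeyl.flipSign]
        · intro k hki hkj
          simp [TorusWeyl.flipSign, hki, hkj]
    · have h0 : s = ∅ := by
        rw [← Finset.card_eq_zero]
        rcases hs with ⟨m, hm⟩
        omega
      have h1 : signedPermOf 1 (TorusWeyl.flipSign s) = 1 := by
        rw [h0]
        exact Subtype.ext signedPerm_one
      rw [h1]
      exact one_mem _

/-! ## Invariants under the actions on the two algebras -/

theorem ShiftAlgebra.conjHom_mul (g h : signedPerms n) (f : ShiftAlgebra n) :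
    conjHom (g * h) f = conjHom g (conjHom h f) := by
  refine SkewMonoidAlgebra.ext fun m => ?_
  obtain ⟨m, rfl⟩ := conjShift_surjective (g * h) m
  have h1 : conjShift (g * h) m = conjShift g (conjShift h m) := Subtype.ext (by
    rw [coe_conjShift, coe_conjShift, coe_conjShift, Subgroup.coe_mul, map_mul]
    group)
  rw [coeff_conjHom, h1, coeff_conjHom, coeff_conjHom, Subgroup.coe_mul, map_mul,
    AlgEquiv.mul_apply]

theorem ShiftAlgebra.conjHom_one (f : ShiftAlgebra n) : conjHom 1 f = f := by
  rw [conjHom_eq_self_iff]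
  intro m
  have h1 : conjShift 1 m = m := Subtype.ext (by rw [coe_conjShift]; simp)
  rw [h1]
  simp

/-- The signed permutations that fix an element. -/
def ShiftAlgebra.conjStabilizer (f : ShiftAlgebra n) : Subgroup (signedPerms n) where
  carrier := {g | conjHom g f = f}
  one_mem' := conjHom_one f
  mul_mem' {g h} hg hh := by
    change conjHom (g * h) f = f
    rw [conjHom_mul, hh, hg]
  inv_mem' {g} hg := by
    change conjHom g⁻¹ f = f
    conv_lhs => rw [← show conjHom g f = f from hg]
    rw [← conjHom_mul, inv_mul_cancel, conjHom_one]

namespace TorusWeyl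

/-- The group `H` of signed permutations describes the action of `W` by means of the
embedding `toShift c`. -/
def IsModel (W : Subgroup (TorusWeyl n ≃ₐ[ℂ] TorusWeyl n)) (c : ℂˣ)
    (H : Subgroup (signedPerms n)) : Prop :=
  ∀ u, u ∈ invariants W ↔ ∀ g ∈ H, ShiftAlgebra.conjHom g (toShift c u) = toShift c u

/-- Invariance is tested on generators on both sides, so matching generators suffice; no isomorphism
between the two groups is needed. -/
theorem isModel_closure {c : ℂˣ} {ι : Type*} {a : ι → TorusWeyl n ≃ₐ[ℂ] TorusWeyl n}
    {b : ι → signedPerms n}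
    (h : ∀ i u, toShift c (a i u) = ShiftAlgebra.conjHom (b i) (toShift c u)) :
    IsModel (Subgroup.closure (Set.range a)) c (Subgroup.closure (Set.range b)) := by
  intro u
  have h1 : u ∈ invariants (Subgroup.closure (Set.range a)) ↔ ∀ i, a i u = u := by
    constructor
    · intro hu i
      exact hu ⟨a i, Subgroup.subset_closure ⟨i, rfl⟩⟩
    · rintro hu ⟨w, hw⟩
      change w ∈ MulAction.stabilizer (TorusWeyl n ≃ₐ[ℂ] TorusWeyl n) u
      refine (Subgroup.closure_le _).mpr ?_ hw
      rintro _ ⟨i, rfl⟩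
      exact hu i
  have h2 : (∀ g ∈ Subgroup.closure (Set.range b),
      ShiftAlgebra.conjHom g (toShift c u) = toShift c u) ↔
      ∀ i, ShiftAlgebra.conjHom (b i) (toShift c u) = toShift c u := by
    constructor
    · intro hu i
      exact hu _ (Subgroup.subset_closure ⟨i, rfl⟩)
    · intro hu
      change Subgroup.closure (Set.range b) ≤ ShiftAlgebra.conjStabilizer (toShift c u)
      refine (Subgroup.closure_le _).mpr ?_
      rintro _ ⟨i, rfl⟩
      exact hu i
  rw [h1, h2]
  exact forall_congr' fun i => by rw [← h, (toShift_injective c).eq_iff]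

theorem exists_isModel {W : Subgroup (TorusWeyl n ≃ₐ[ℂ] TorusWeyl n)}
    (hW : W ∈ ({groupS n, groupB n, groupD n} : Set (Subgroup (TorusWeyl n ≃ₐ[ℂ] TorusWeyl n)))) :
    ∃ (c : ℂˣ) (H : Subgroup (signedPerms n)), IsModel W c H ∧
      Subgroup.closure {r : H | IsPolyReflection r.1} = ⊤ := by
  rcases hW with rfl | rfl | rfl
  · refine ⟨1, _, isModel_closure (b := permsHom n) (toShift_perm 1), closure_reflections_eq_top ?_⟩
    rintro _ ⟨π, rfl⟩
    exact perm_mem_closure_reflections subset_rfl π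
  -- For type B the sign in ε_i(x_i) = −x_i⁻¹ requires c² = −1. In the other two cases c = 1.
  · refine ⟨Units.mk0 Complex.I Complex.I_ne_zero, _, ?_, closure_reflections_eq_top
      (T := Set.range (Sum.elim (permsHom n) fun i => signedPermOf 1 (flipSign {i}))) ?_⟩
    · rw [groupB, ← Set.Sum.elim_range]
      refine isModel_closure ?_
      rintro (π | i) u
      · exact toShift_perm _ π u
      · exact toShift_flip _ (by simp) _ u
    · rintro _ ⟨π | i, rfl⟩
      · refine perm_mem_closure_reflections ?_ π
        rintro _ ⟨π, rfl⟩
        exact ⟨Sum.inl π, rfl⟩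
      · exact Subgroup.subset_closure ⟨Subgroup.subset_closure ⟨Sum.inr i, rfl⟩,
          isPolyReflection_flip i⟩
  · refine ⟨1, _, ?_, closure_reflections_eq_top
      (T := Set.range (Sum.elim (permsHom n) fun s : {s : Finset (Fin n) // Even s.card} =>
        signedPermOf 1 (flipSign s))) ?_⟩
    · have h : {g : TorusWeyl n ≃ₐ[ℂ] TorusWeyl n | ∃ s : Finset (Fin n), Even s.card ∧
          g = flip 1 s} = Set.range fun s : {s : Finset (Fin n) // Even s.card} => flip 1 s.1 := by
        ext g
        constructor
        · rintro ⟨s, hs, rfl⟩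
          exact ⟨⟨s, hs⟩, rfl⟩
        · rintro ⟨s, rfl⟩
          exact ⟨s.1, s.2, rfl⟩
      rw [groupD, h, ← Set.Sum.elim_range]
      refine isModel_closure ?_
      rintro (π | s) u
      · exact toShift_perm _ π u
      · exact toShift_flip _ (by simp) _ u
    · have hP : Set.range (permsHom n) ⊆ Set.range (Sum.elim (permsHom n)
          fun s : {s : Finset (Fin n) // Even s.card} => signedPermOf 1 (flipSign s.1)) := by
        rintro _ ⟨π, rfl⟩
        exact ⟨Sum.inl π, rfl⟩
      rintro _ ⟨π | s, rfl⟩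
      · exact perm_mem_closure_reflections hP π
      · exact flip_mem_closure_reflections hP (fun s hs => ⟨Sum.inr ⟨s, hs⟩, rfl⟩) s.1 s.2

end TorusWeyl

end Torus

end

noncomputable section

open MvPolynomial

/-! ### Artin's theorem on finite groups of field automorphisms -/

section FiniteGroups

variable {F E : Type*} [Field F] [Field E] [Algebra F E]

theorem finiteDimensional_fixedField (H : Subgroup (E ≃ₐ[F] E)) [Finite H] :
    FiniteDimensional (IntermediateField.fixedField H) E :=
  inferInstanceAs (FiniteDimensional (FixedPoints.subfield H E) E)

theorem isGalois_fixedField (H : Subgroup (E ≃ₐ[F] E)) [Finite H] :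
    IsGalois (IntermediateField.fixedField H) E :=
  inferInstanceAs (IsGalois (FixedPoints.subfield H E) E)

/-- E need not be algebraic over F; an automorphism fixing the fixed field is regarded as an
automorphism over it, and Artin's theorem places it in H. -/
theorem fixingSubgroup_fixedField_of_finite (H : Subgroup (E ≃ₐ[F] E)) [Finite H] :
    (IntermediateField.fixedField H).fixingSubgroup = H := by
  refine le_antisymm (fun σ hσ => ?_) ((IntermediateField.le_iff_le _ _).mp le_rfl)
  let σ' : E ≃ₐ[FixedPoints.subfield H E] E :=
    { σ.toRingEquiv with
      commutes' := fun r => (IntermediateField.mem_fixingSubgroup_iff _ _).mp hσ r r.2 }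
  obtain ⟨h, hh⟩ := FixedPoints.toAlgAut_surjective H E σ'
  have : (h : E ≃ₐ[F] E) = σ := AlgEquiv.ext fun x => DFunLike.congr_fun hh x
  exact this ▸ h.2

end FiniteGroups

/-! ### Invariant rational functions and the skew invariants -/

section Torus

variable {n : ℕ} (H : Subgroup (signedPerms n))

/-- The action of signed permutations on the field of rational functions. -/
def galoisImage : Subgroup (RatFuncField n ≃ₐ[ℂ] RatFuncField n) :=
  H.map ((extendAut n).comp (signedPerms n).subtype)

instance : Finite (galoisImage H) :=
  (Set.Finite.image _ (Set.toFinite (H : Set (signedPerms n)))).to_subtype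

theorem extendAut_mem_galoisImage {g : signedPerms n} (hg : g ∈ H) :
    extendAut n g.1 ∈ galoisImage H :=
  ⟨g, hg, rfl⟩

/-- The norm, that is, the product of all translates of q by the finite group. -/
theorem exists_invariant_multiple {q : MvPolynomial (Fin n) ℂ} (hq : q ≠ 0) :
    ∃ N, N ≠ 0 ∧ q ∣ N ∧ ∀ g : H, g • N = N := by
  have := Fintype.ofFinite H
  refine ⟨∏ g : H, g • q, Finset.prod_ne_zero_iff.mpr fun g _ => ?_, ?_, fun g => ?_⟩
  · exact (smul_ne_zero_iff_ne g).mpr hq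
  · have := Finset.dvd_prod_of_mem (fun g : H => g • q) (Finset.mem_univ 1)
    rwa [one_smul] at this
  · rw [Finset.smul_prod']
    refine Fintype.prod_equiv (Equiv.mulLeft g) _ _ fun h => ?_
    rw [Equiv.coe_mulLeft, mul_smul]

/-- Common invariant denominators. -/
theorem exists_invariant_denominator {κ : Type*} (s : Finset κ) (r : κ → RatFuncField n) :
    ∃ N : MvPolynomial (Fin n) ℂ, N ≠ 0 ∧ (∀ g : H, g • N = N) ∧
      ∀ m ∈ s, r m * ratEmb n N ∈ Set.range (ratEmb n) := by
  choose p q hq hr using fun m => exists_ratEmb_div (r m)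
  obtain ⟨N, hN, hqN, hN'⟩ := exists_invariant_multiple H (Finset.prod_ne_zero_iff.mpr
    fun m (_ : m ∈ s) => hq m)
  refine ⟨N, hN, hN', fun m hm => ?_⟩
  obtain ⟨q', rfl⟩ := (Finset.dvd_prod_of_mem q hm).trans hqN
  refine ⟨p m * q', ?_⟩
  have : ratEmb n (q m) ≠ 0 := (map_ne_zero_iff _ ratEmb_injective).mpr (hq m)
  rw [hr, map_mul, map_mul]
  field_simp

/-- An invariant fraction can be written with an invariant denominator, and then its numerator is
invariant too. -/
theorem adjoin_invariants : IntermediateField.adjoin ℂ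
    (ratEmb n '' {p | ∀ g : H, g • p = p}) = IntermediateField.fixedField (galoisImage H) := by
  apply le_antisymm
  · rw [IntermediateField.adjoin_le_iff]
    rintro _ ⟨p, hp, rfl⟩ ⟨_, g, hg, rfl⟩
    change extendAut n g.1 (ratEmb n p) = ratEmb n p
    rw [extendAut_ratEmb]
    exact congrArg _ (hp ⟨g, hg⟩)
  · intro x hx
    obtain ⟨N, hN, hN', hx'⟩ := exists_invariant_denominator H {()} fun _ => x
    obtain ⟨p, hp⟩ := hx' () (Finset.mem_singleton_self _)
    have hp' : ∀ g : H, g • p = p := fun g => by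
      apply ratEmb_injective
      have h1 : extendAut n g.1.1 x = x := hx ⟨_, extendAut_mem_galoisImage H g.2⟩
      have h2 : extendAut n g.1.1 (ratEmb n N) = ratEmb n N := by
        rw [extendAut_ratEmb]
        exact congrArg _ (hN' g)
      change ratEmb n (g.1.1 p) = _
      rw [← extendAut_ratEmb, hp, map_mul, h1, h2]
    have hx2 : x = ratEmb n p / ratEmb n N := by
      rw [hp, mul_div_cancel_right₀]
      exact (map_ne_zero_iff _ ratEmb_injective).mpr hN
    rw [hx2]
    exact div_mem (IntermediateField.subset_adjoin _ _ ⟨p, hp', rfl⟩)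
      (IntermediateField.subset_adjoin _ _ ⟨N, hN', rfl⟩)

/-- If two shifts agree on K, their quotient lies in the finite Galois group and has finite order,
whereas the lattice of shifts is torsion-free. -/
theorem eq_of_eq_on_fixedField {m m' : RatFuncField n ≃ₐ[ℂ] RatFuncField n}
    (hm : m ∈ shiftMonoid n) (hm' : m' ∈ shiftMonoid n)
    (h : ∀ a ∈ IntermediateField.fixedField (galoisImage H), m a = m' a) : m = m' := by
  obtain ⟨a, ha⟩ := shift_surjective ⟨m, hm⟩
  obtain ⟨b, hb⟩ := shift_surjective ⟨m', hm'⟩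
  have h1 : m⁻¹ * m' ∈ galoisImage H := by
    rw [← fixingSubgroup_fixedField_of_finite (galoisImage H),
      IntermediateField.mem_fixingSubgroup_iff]
    intro x hx
    rw [AlgEquiv.mul_apply, ← h x hx, ← AlgEquiv.mul_apply, inv_mul_cancel, AlgEquiv.one_apply]
  have ha' : m = extendAut n (intTranslate n a) := by rw [← coe_shift, ha]
  have hb' : m' = extendAut n (intTranslate n b) := by rw [← coe_shift, hb]
  have h2 : m⁻¹ * m' = extendAut n (intTranslate n (a⁻¹ * b)) := by
    rw [ha', hb', map_mul, map_mul, map_inv, map_inv]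
  obtain ⟨k, hk, hk'⟩ := isOfFinOrder_iff_pow_eq_one.mp
    ((isOfFinOrder_of_finite (⟨_, h1⟩ : galoisImage H)))
  have h3 : (m⁻¹ * m') ^ k = 1 := congrArg Subtype.val hk'
  rw [h2, ← map_pow, ← map_pow, ← map_one (extendAut n), extendAut_injective.eq_iff,
    ← map_one (intTranslate n), intTranslate_injective.eq_iff] at h3
  have h4 : a⁻¹ * b = 1 := by
    refine Multiplicative.toAdd.injective (funext fun i => ?_)
    have := congrFun (congrArg Multiplicative.toAdd h3) i
    rw [toAdd_pow, toAdd_one, Pi.smul_apply, Pi.zero_apply] at this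
    rw [toAdd_one, Pi.zero_apply]
    exact (smul_eq_zero.mp this).resolve_left (Nat.pos_iff_ne_zero.mp hk)
  rw [h4, map_one, map_one] at h2
  exact (inv_mul_eq_one.mp h2)

/-- Coefficients of elements that are invariant under `G`. -/
theorem mem_skewInvariants_iff (f : ShiftAlgebra n) :
    f ∈ skewInvariants (IntermediateField.fixedField (galoisImage H)) (shiftMonoid n) ↔
      ∀ g ∈ H, ShiftAlgebra.conjHom g f = f := by
  simp only [skewInvariants, Set.mem_ofPred_eq, fixingSubgroup_fixedField_of_finite]
  constructor
  · intro h g hg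
    rw [ShiftAlgebra.conjHom_eq_self_iff]
    exact fun m => h _ (extendAut_mem_galoisImage H hg) _ _ (coe_conjShift g m)
  · rintro h _ ⟨g, hg, rfl⟩ m m' hm
    have h1 := (ShiftAlgebra.conjHom_eq_self_iff g f).mp (h g hg) m
    have h2 : m' = conjShift g m := Subtype.ext (hm.trans (coe_conjShift g m).symm)
    rw [h2, h1]
    rfl

end Torus

end

noncomputable section

open MvPolynomial

section Torus

variable {n : ℕ}

open TorusWeyl

/-! ## The symbol algebra and the skew monoid algebra -/

/-- The algebra of symbols of the elements of the localized Weyl algebra. -/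
abbrev TorusSymbols (n : ℕ) : Type :=
  SymbolAlgebra (MvPolynomial (Fin n) ℂ) (Multiplicative (Fin n → ℤ))

/-- The additive map `∑ p a ↦ ∑ (τ a p) σ ^ a`. -/
def symbolMap (τ : Multiplicative (Fin n → ℤ) → MvPolynomial (Fin n) ℂ ≃ₐ[ℂ] MvPolynomial (Fin n) ℂ) :
    TorusSymbols n →+ ShiftAlgebra n where
  toFun f := Finsupp.liftAddHom (fun a => (SkewMonoidAlgebra.singleAddHom (shift n a)).comp
    ((ratEmb n : MvPolynomial (Fin n) ℂ →+ RatFuncField n).comp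
      (τ a : MvPolynomial (Fin n) ℂ →+ MvPolynomial (Fin n) ℂ))) f.coeff
  map_zero' := by rw [SymbolAlgebra.coeff_zero, map_zero]
  map_add' f g := by rw [SymbolAlgebra.coeff_add, map_add]

section symbolMap

variable {τ : Multiplicative (Fin n → ℤ) → MvPolynomial (Fin n) ℂ ≃ₐ[ℂ] MvPolynomial (Fin n) ℂ}

theorem symbolMap_single (a : Multiplicative (Fin n → ℤ)) (p : MvPolynomial (Fin n) ℂ) :
    symbolMap τ (SymbolAlgebra.single a p) =
      SkewMonoidAlgebra.single (shift n a) (ratEmb n (τ a p)) := by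
  change Finsupp.liftAddHom _ (Finsupp.single a p) = _
  rw [Finsupp.liftAddHom_apply_single]
  rfl

theorem coeff_symbolMap
    (f : TorusSymbols n)
    (a : Multiplicative (Fin n → ℤ)) :
    (symbolMap τ f).coeff (shift n a) = ratEmb n (τ a (f.coeff a)) := by
  classical
  induction f using SymbolAlgebra.induction_linear with
  | zero => simp
  | add f g hf hg =>
    rw [map_add, SkewMonoidAlgebra.coeff_add, Finsupp.add_apply, hf, hg, SymbolAlgebra.coeff_add,
      Finsupp.add_apply, map_add, map_add]
  | single b p =>
    rw [symbolMap_single, SkewMonoidAlgebra.coeff_single, SymbolAlgebra.coeff_single,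
      Finsupp.single_apply, Finsupp.single_apply]
    simp only [shift_injective.eq_iff]
    split_ifs with h
    · rw [h]
    · simp

theorem symbolMap_injective : Function.Injective (symbolMap τ) := by
  intro f g h
  refine SymbolAlgebra.ext fun a => (τ a).injective (ratEmb_injective ?_)
  rw [← coeff_symbolMap, h, coeff_symbolMap]

/-- Each τ_a permutes the polynomials, so the image does not depend on τ: left and right coefficient
forms describe the same elements. -/
theorem mem_range_symbolMap_iff (f : ShiftAlgebra n) :
    f ∈ Set.range (symbolMap τ) ↔ ∀ m, f.coeff m ∈ Set.range (ratEmb n) := by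
  constructor
  · rintro ⟨g, rfl⟩ m
    obtain ⟨a, rfl⟩ := shift_surjective m
    exact ⟨_, (coeff_symbolMap g a).symm⟩
  · intro h
    choose p hp using h
    have hp0 : ∀ m, p m = 0 ↔ f.coeff m = 0 := fun m => by
      rw [← hp, map_eq_zero_iff _ ratEmb_injective]
    let q : Multiplicative (Fin n → ℤ) →₀ MvPolynomial (Fin n) ℂ :=
      Finsupp.ofSupportFinite (fun a => (τ a)⁻¹ (p (shift n a))) (by
        refine (Set.Finite.preimage shift_injective.injOn f.coeff.support.finite_toSet).subset ?_
        intro a ha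
        rw [Set.mem_preimage, Finset.mem_coe, Finsupp.mem_support_iff, Ne, ← hp0]
        intro h
        exact ha (by change (τ a)⁻¹ _ = _; rw [h, map_zero]))
    refine ⟨SymbolAlgebra.ofCoeff q, SkewMonoidAlgebra.ext fun m => ?_⟩
    obtain ⟨a, rfl⟩ := shift_surjective m
    rw [coeff_symbolMap, ← hp]
    change ratEmb n (τ a ((τ a)⁻¹ _)) = _
    rw [← AlgEquiv.mul_apply, mul_inv_cancel, AlgEquiv.one_apply]

theorem conjHom_symbolMap
    (hτ : ∀ (g : signedPerms n) a p, τ (g • a) (g • p) = g • τ a p) (g : signedPerms n)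
    (f : TorusSymbols n) :
    ShiftAlgebra.conjHom g (symbolMap τ f) = symbolMap τ (g • f) := by
  induction f using SymbolAlgebra.induction_linear with
  | zero => simp
  | add f g hf hg => rw [map_add, map_add, hf, hg, smul_add, map_add]
  | single a p =>
    rw [symbolMap_single, ShiftAlgebra.conjHom_single, conjShift_shift, SymbolAlgebra.smul_single,
      symbolMap_single, hτ, extendAut_ratEmb]
    rfl

theorem symbolMap_one_smul (q : MvPolynomial (Fin n) ℂ)
    (f : TorusSymbols n) :
    symbolMap (1 : Multiplicative (Fin n → ℤ) →* _) (q • f) =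
      SkewMonoidAlgebra.single 1 (ratEmb n q) * symbolMap (1 : Multiplicative (Fin n → ℤ) →* _) f := by
  refine SkewMonoidAlgebra.ext fun m => ?_
  obtain ⟨a, rfl⟩ := shift_surjective m
  rw [coeff_symbolMap, SkewMonoidAlgebra.coeff_single_one_mul, coeff_symbolMap,
    SymbolAlgebra.coeff_smul, Finsupp.smul_apply, smul_eq_mul, map_mul, map_mul]
  rfl

/-- As σ^a p = τ_a(p)σ^a, this choice of τ writes coefficients on the right, and right
multiplication becomes coefficientwise. It reduces right modules to the argument for left modules.
-/
theorem symbolMap_intTranslate_smul (q : MvPolynomial (Fin n) ℂ)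
    (f : TorusSymbols n) :
    symbolMap (intTranslate n) (q • f) =
      symbolMap (intTranslate n) f * SkewMonoidAlgebra.single 1 (ratEmb n q) := by
  refine SkewMonoidAlgebra.ext fun m => ?_
  obtain ⟨a, rfl⟩ := shift_surjective m
  rw [coeff_symbolMap, SkewMonoidAlgebra.coeff_mul_single_one, coeff_symbolMap,
    SymbolAlgebra.coeff_smul, Finsupp.smul_apply, smul_eq_mul, map_mul, map_mul,
    ShiftAlgebra.shift_smul_ratEmb, mul_comm]

end symbolMap

/-! ## The algebra of invariants -/

/-- The isomorphism of the polynomial ring with the subalgebra `ℂ[t 1, …, t n]`. -/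
def polyEquiv (n : ℕ) : MvPolynomial (Fin n) ℂ ≃ₐ[ℂ] polynomials n :=
  (AlgEquiv.ofInjective (polyHom n) (fun p q h => by
    have h1 := congrArg (toShift 1) h
    rw [toShift_polyHom, toShift_polyHom] at h1
    exact ratEmb_injective (SkewMonoidAlgebra.single_injective 1 h1))).trans
  (Subalgebra.equivOfEq _ _ range_polyHom)

theorem coe_polyEquiv (p : MvPolynomial (Fin n) ℂ) : (polyEquiv n p : TorusWeyl n) = polyHom n p :=
  rfl

/-- The embedding of `ℂ[t 1, …, t n]` in the field of rational functions. -/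
def coeffEmb (n : ℕ) : polynomials n →ₐ[ℂ] RatFuncField n :=
  (ratEmb n).comp (polyEquiv n).symm.toAlgHom

theorem coeffEmb_polyEquiv (p : MvPolynomial (Fin n) ℂ) :
    coeffEmb n (polyEquiv n p) = ratEmb n p :=
  congrArg (ratEmb n) ((polyEquiv n).symm_apply_apply p)

theorem coeffEmb_injective : Function.Injective (coeffEmb n) :=
  ratEmb_injective.comp (polyEquiv n).symm.injective

theorem toShift_coe (c : ℂˣ) (u : polynomials n) :
    toShift c (u : TorusWeyl n) = SkewMonoidAlgebra.single 1 (coeffEmb n u) := by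
  obtain ⟨p, rfl⟩ := (polyEquiv n).surjective u
  rw [coeffEmb_polyEquiv, coe_polyEquiv, toShift_polyHom]

theorem coeffEmb_t (i : Fin n) : coeffEmb n ⟨t i, t_mem_polynomials i⟩ = ratVar i := by
  have h := toShift_coe 1 ⟨t i, t_mem_polynomials i⟩
  rw [toShift_t] at h
  exact (SkewMonoidAlgebra.single_injective 1 h).symm

variable {W : Subgroup (TorusWeyl n ≃ₐ[ℂ] TorusWeyl n)} {c : ℂˣ} {H : Subgroup (signedPerms n)}

theorem single_invariant_iff (g : signedPerms n) (p : MvPolynomial (Fin n) ℂ) :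
    ShiftAlgebra.conjHom g (SkewMonoidAlgebra.single 1 (ratEmb n p)) =
      SkewMonoidAlgebra.single 1 (ratEmb n p) ↔ g • p = p := by
  rw [ShiftAlgebra.conjHom_single, map_one, (SkewMonoidAlgebra.single_injective 1).eq_iff,
    extendAut_ratEmb, ratEmb_injective.eq_iff]
  rfl

/-- The embedding of the invariants in the skew monoid algebra. -/
def invariantsEmb (W : Subgroup (TorusWeyl n ≃ₐ[ℂ] TorusWeyl n)) (c : ℂˣ) :
    invariants W →ₐ[ℂ] ShiftAlgebra n :=
  (toShift c).comp (invariants W).val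

theorem invariantsEmb_injective : Function.Injective (invariantsEmb W c) :=
  (toShift_injective c).comp Subtype.val_injective

theorem mem_range_invariantsEmb_iff (hW : IsModel W c H) (f : ShiftAlgebra n) :
    f ∈ Set.range (invariantsEmb W c) ↔ (∀ m, f.coeff m ∈ Set.range (ratEmb n)) ∧
      ∀ g ∈ H, ShiftAlgebra.conjHom g f = f := by
  rw [← mem_range_toShift_iff c]
  constructor
  · rintro ⟨u, rfl⟩
    exact ⟨⟨u, rfl⟩, (hW u).mp u.2⟩
  · rintro ⟨⟨u, rfl⟩, h⟩
    exact ⟨⟨u, (hW u).mpr h⟩, rfl⟩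

/-- The embedding of the invariant polynomials in the field of rational functions. -/
abbrev invariantCoeffEmb (W : Subgroup (TorusWeyl n ≃ₐ[ℂ] TorusWeyl n)) :
    invariantPolynomials W →ₐ[ℂ] RatFuncField n :=
  (coeffEmb n).comp (invariantPolynomialsIncl W)

theorem invariantCoeffEmb_injective : Function.Injective (invariantCoeffEmb W) :=
  coeffEmb_injective.comp fun _ _ h =>
    Subtype.ext (Subtype.ext (congrArg (fun u : polynomials n => (u : TorusWeyl n)) h))

theorem invariantsEmb_coe (c : ℂˣ) (γ : invariantPolynomials W) :
    invariantsEmb W c γ = SkewMonoidAlgebra.single 1 (invariantCoeffEmb W γ) :=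
  toShift_coe c (invariantPolynomialsIncl W γ)

/-- The invariant polynomials, as elements of the polynomial ring. -/
def toInvariantPoly (W : Subgroup (TorusWeyl n ≃ₐ[ℂ] TorusWeyl n)) :
    invariantPolynomials W →+* MvPolynomial (Fin n) ℂ :=
  ((polyEquiv n).symm.toAlgHom.comp (invariantPolynomialsIncl W)).toRingHom

theorem ratEmb_toInvariantPoly (γ : invariantPolynomials W) :
    ratEmb n (toInvariantPoly W γ) = invariantCoeffEmb W γ := rfl

theorem range_toInvariantPoly (hW : IsModel W c H) : Set.range (toInvariantPoly W) =
    {p : MvPolynomial (Fin n) ℂ | ∀ g : H, g • p = p} := by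
  ext p
  constructor
  · rintro ⟨γ, rfl⟩ g
    have h1 := (hW γ.1.1).mp γ.1.2 g g.2
    have h2 : toShift c γ.1.1 = SkewMonoidAlgebra.single 1 (ratEmb n (toInvariantPoly W γ)) :=
      invariantsEmb_coe c γ
    rw [h2] at h1
    exact (single_invariant_iff g.1 _).mp h1
  · intro hp
    refine ⟨⟨⟨polyHom n p, (hW _).mpr fun g hg => ?_⟩, (polyEquiv n p).2⟩, ?_⟩
    · rw [toShift_polyHom]
      exact (single_invariant_iff g p).mpr (hp ⟨g, hg⟩)
    · exact (polyEquiv n).symm_apply_apply p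

theorem toInvariantPoly_injective : Function.Injective (toInvariantPoly W) := fun _ _ h =>
  invariantCoeffEmb_injective (congrArg (ratEmb n) h)

theorem fracField_invariantCoeffEmb (hW : IsModel W c H) :
    fracField (invariantCoeffEmb W) = IntermediateField.fixedField (galoisImage H) := by
  rw [← adjoin_invariants, ← range_toInvariantPoly hW, ← Set.range_comp]
  rfl

section

variable {τ : Multiplicative (Fin n → ℤ) → MvPolynomial (Fin n) ℂ ≃ₐ[ℂ] MvPolynomial (Fin n) ℂ}
  (hW : IsModel W c H) (hτ : ∀ (g : signedPerms n) a p, τ (g • a) (g • p) = g • τ a p)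

theorem exists_symbol (W : Subgroup (TorusWeyl n ≃ₐ[ℂ] TorusWeyl n)) (c : ℂˣ)
    (τ : Multiplicative (Fin n → ℤ) → MvPolynomial (Fin n) ℂ ≃ₐ[ℂ] MvPolynomial (Fin n) ℂ)
    (u : invariants W) : ∃ f : TorusSymbols n, symbolMap τ f = invariantsEmb W c u :=
  (mem_range_symbolMap_iff _).mpr ((mem_range_toShift_iff c _).mp ⟨u, rfl⟩)

/-- The symbol of an invariant. -/
def symbol (W : Subgroup (TorusWeyl n ≃ₐ[ℂ] TorusWeyl n)) (c : ℂˣ)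
    (τ : Multiplicative (Fin n → ℤ) → MvPolynomial (Fin n) ℂ ≃ₐ[ℂ] MvPolynomial (Fin n) ℂ) :
    invariants W →+ TorusSymbols n where
  toFun u := (exists_symbol W c τ u).choose
  map_zero' := symbolMap_injective (τ := τ) (by
    rw [(exists_symbol W c τ 0).choose_spec, map_zero, map_zero])
  map_add' u v := symbolMap_injective (τ := τ) (by
    rw [(exists_symbol W c τ (u + v)).choose_spec, map_add, map_add,
      (exists_symbol W c τ u).choose_spec, (exists_symbol W c τ v).choose_spec])

theorem symbolMap_symbol (u : invariants W) :
    symbolMap τ (symbol W c τ u) = invariantsEmb W c u := (exists_symbol W c τ u).choose_spec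

theorem symbol_eq_iff (u : invariants W) (f : TorusSymbols n) :
    symbol W c τ u = f ↔ invariantsEmb W c u = symbolMap τ f := by
  rw [← symbolMap_symbol (τ := τ), symbolMap_injective.eq_iff]

theorem symbol_injective : Function.Injective (symbol W c τ) := fun u v h => by
  apply invariantsEmb_injective (c := c)
  rw [← symbolMap_symbol (τ := τ), h, symbolMap_symbol]

include hW hτ in
-- The decisive translation: as an additive group U is the ring of diagonal invariants of the group
-- algebra, for any equivariant twist τ.
theorem range_symbol : Set.range (symbol W c τ) = {f | ∀ g : H, g • f = f} := by
  have key : ∀ f : TorusSymbols n, (∀ g ∈ H, ShiftAlgebra.conjHom g (symbolMap τ f) =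
      symbolMap τ f) ↔ ∀ g : H, g • f = f := fun f => by
    constructor
    · intro h g
      have h1 := h g g.2
      rw [conjHom_symbolMap hτ, symbolMap_injective.eq_iff] at h1
      exact h1
    · intro h g hg
      rw [conjHom_symbolMap hτ]
      exact congrArg (symbolMap τ) (h ⟨g, hg⟩)
  ext f
  rw [Set.mem_ofPred_eq, ← key]
  constructor
  · rintro ⟨u, rfl⟩
    rw [symbolMap_symbol]
    exact ((mem_range_invariantsEmb_iff hW _).mp ⟨u, rfl⟩).2
  · intro h
    obtain ⟨u, hu⟩ := (mem_range_invariantsEmb_iff hW (symbolMap τ f)).mpr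
      ⟨(mem_range_symbolMap_iff (τ := τ) _).mp ⟨f, rfl⟩, h⟩
    exact ⟨u, (symbol_eq_iff u f).mpr hu⟩

theorem coeff_symbol_eq_zero_iff (u : invariants W) (a : Multiplicative (Fin n → ℤ)) :
    (symbol W c τ u).coeff a = 0 ↔ (invariantsEmb W c u).coeff (shift n a) = 0 := by
  rw [← symbolMap_symbol (τ := τ), coeff_symbolMap, map_eq_zero_iff _ ratEmb_injective,
    EmbeddingLike.map_eq_zero_iff (f := τ a)]

/-- Elements with supports in a finite set have symbols with supports in a finite set. -/
theorem exists_support_symbol_subset (F : Finset (shiftMonoid n)) :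
    ∃ F' : Finset (Multiplicative (Fin n → ℤ)), ∀ u : invariants W,
      (invariantsEmb W c u).support ⊆ F → (symbol W c τ u).coeff.support ⊆ F' := by
  classical
  refine ⟨F.preimage (shift n) shift_injective.injOn, fun u hu a ha => ?_⟩
  rw [Finset.mem_preimage]
  refine hu (SkewMonoidAlgebra.mem_support_iff.mpr ?_)
  rw [Finsupp.mem_support_iff, Ne, coeff_symbol_eq_zero_iff] at ha
  exact ha

end

theorem one_smul_compat (g : signedPerms n) (a : Multiplicative (Fin n → ℤ))
    (p : MvPolynomial (Fin n) ℂ) :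
    (1 : Multiplicative (Fin n → ℤ) →* (MvPolynomial (Fin n) ℂ ≃ₐ[ℂ] MvPolynomial (Fin n) ℂ))
      (g • a) (g • p) = g • (1 : Multiplicative (Fin n → ℤ) →* (MvPolynomial (Fin n) ℂ ≃ₐ[ℂ]
        MvPolynomial (Fin n) ℂ)) a p := rfl

theorem symbol_smul (γ : invariantPolynomials W) (u : invariants W) :
    symbol W c (1 : Multiplicative (Fin n → ℤ) →* _) (γ • u) =
      toInvariantPoly W γ • symbol W c (1 : Multiplicative (Fin n → ℤ) →* _) u := by
  rw [symbol_eq_iff, symbolMap_one_smul, symbolMap_symbol, ratEmb_toInvariantPoly,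
    ← invariantsEmb_coe c γ, ← map_mul]
  rfl

theorem symbol_op_smul (γ : (invariantPolynomials W).op) (u : invariants W) :
    symbol W c (intTranslate n) (γ • u) =
      Subalgebra.opHom (toInvariantPoly W) γ • symbol W c (intTranslate n) u := by
  have h : ratEmb n (Subalgebra.opHom (toInvariantPoly W) γ) = invariantCoeffEmb W ⟨γ.1.unop, γ.2⟩ := rfl
  rw [symbol_eq_iff, symbolMap_intTranslate_smul, symbolMap_symbol, h,
    ← invariantsEmb_coe c, ← map_mul]
  rfl

/-! ## Freeness and finiteness -/

theorem isHomogeneous_smul (g : H) (p : MvPolynomial (Fin n) ℂ) (d : ℕ) (hp : p.IsHomogeneous d) :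
    (g • p).IsHomogeneous d :=
  isHomogeneous_signedPerm g.1.2 hp

/-- One Chevalley basis serves both sides: the trivial twist gives the left structure and the twist
by translations the right one. -/
theorem free_invariants (hW : IsModel W c H)
    (hH : Subgroup.closure {r : H | IsPolyReflection r.1} = ⊤) :
    Module.Free (invariantPolynomials W) (invariants W) ∧
      Module.Free (invariantPolynomials W).op (invariants W) := by
  have := Fintype.ofFinite H
  obtain ⟨ι, b, hb⟩ := exists_stable_basis (k := ℂ) (σ := Fin n) (G := H) isHomogeneous_smul hH
  constructor
  · exact SymbolAlgebra.free_of_range_eq_invariants (k := ℂ) (P := MvPolynomial (Fin n) ℂ)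
      (M := Multiplicative (Fin n → ℤ)) (G := H) (U := invariants W) (toInvariantPoly W)
      toInvariantPoly_injective (range_toInvariantPoly hW)
      (symbol W c (1 : Multiplicative (Fin n → ℤ) →* _)) symbol_injective symbol_smul b hb
      (range_symbol hW one_smul_compat)
  · exact SymbolAlgebra.free_of_range_eq_invariants (k := ℂ) (P := MvPolynomial (Fin n) ℂ)
      (M := Multiplicative (Fin n → ℤ)) (G := H) (U := invariants W)
      (Subalgebra.opHom (toInvariantPoly W)) (Subalgebra.opHom_injective toInvariantPoly_injective)
      ((Subalgebra.range_opHom _).trans (range_toInvariantPoly hW))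
      (symbol W c (intTranslate n)) symbol_injective symbol_op_smul b hb
      (range_symbol hW smul_intTranslate_apply)

/-- The common source of the left Harish-Chandra condition and the left order condition. -/
theorem fg_left_of_support_subset (hW : IsModel W c H)
    (N : Submodule (invariantPolynomials W) (invariants W)) (F : Finset (shiftMonoid n))
    (hF : ∀ u ∈ N, (invariantsEmb W c u).support ⊆ F) : N.FG := by
  obtain ⟨F', hF'⟩ := exists_support_symbol_subset (W := W) (c := c)
    (τ := (1 : Multiplicative (Fin n → ℤ) →* _)) F
  exact SymbolAlgebra.fg_of_symbols_supported ℂ (P := MvPolynomial (Fin n) ℂ)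
    (M := Multiplicative (Fin n → ℤ)) (G := H) (U := invariants W) (toInvariantPoly W)
    toInvariantPoly_injective (range_toInvariantPoly hW)
    (symbol W c (1 : Multiplicative (Fin n → ℤ) →* _)) symbol_injective
    symbol_smul N F' fun u hu => hF' u (hF u hu)

theorem fg_right_of_support_subset (hW : IsModel W c H)
    (N : Submodule (invariantPolynomials W).op (invariants W)) (F : Finset (shiftMonoid n))
    (hF : ∀ u ∈ N, (invariantsEmb W c u).support ⊆ F) : N.FG := by
  obtain ⟨F', hF'⟩ := exists_support_symbol_subset (W := W) (c := c) (τ := intTranslate n) F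
  exact SymbolAlgebra.fg_of_symbols_supported ℂ (P := MvPolynomial (Fin n) ℂ)
    (M := Multiplicative (Fin n → ℤ)) (G := H) (U := invariants W)
    (Subalgebra.opHom (toInvariantPoly W)) (Subalgebra.opHom_injective toInvariantPoly_injective)
    ((Subalgebra.range_opHom _).trans (range_toInvariantPoly hW))
    (symbol W c (intTranslate n)) symbol_injective symbol_op_smul N F'
    fun u hu => hF' u (hF u hu)

end Torus

end

noncomputable section

open MvPolynomial

section CoeffRing

variable {k L : Type*} [Field k] [Field L] [Algebra k L] (K : IntermediateField k L)
  (M : Submonoid (L ≃ₐ[k] L))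

instance coeffRing.module : Module (coeffRing K M) (SkewMonoidAlgebra L M) := inferInstance

instance coeffRing.opModule : Module (coeffRing K M).op (SkewMonoidAlgebra L M) := inferInstance

end CoeffRing

section Torus

variable {n : ℕ}

open TorusWeyl

/-! ### Supports in the skew monoid ring -/

namespace ShiftAlgebra

open SkewMonoidAlgebra

theorem support_single_one_mul (r : RatFuncField n) (f : ShiftAlgebra n) :
    (single 1 r * f).support ⊆ f.support := fun m hm => by
  rw [SkewMonoidAlgebra.mem_support_iff, coeff_single_one_mul] at hm
  exact SkewMonoidAlgebra.mem_support_iff.mpr (right_ne_zero_of_mul hm)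

theorem support_mul_single_one (r : RatFuncField n) (f : ShiftAlgebra n) :
    (f * single 1 r).support ⊆ f.support := fun m hm => by
  rw [SkewMonoidAlgebra.mem_support_iff, coeff_mul_single_one] at hm
  exact SkewMonoidAlgebra.mem_support_iff.mpr (left_ne_zero_of_mul hm)

theorem support_add_subset {F : Finset (shiftMonoid n)} {f f' : ShiftAlgebra n}
    (hf : f.support ⊆ F) (hf' : f'.support ⊆ F) : (f + f').support ⊆ F := fun m hm => by
  by_contra hmF
  rw [SkewMonoidAlgebra.mem_support_iff, SkewMonoidAlgebra.coeff_add, Finsupp.add_apply,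
    SkewMonoidAlgebra.notMem_support_iff.mp fun h => hmF (hf h), SkewMonoidAlgebra.notMem_support_iff.mp fun h => hmF (hf' h),
    add_zero] at hm
  exact hm rfl

theorem support_zero_subset (F : Finset (shiftMonoid n)) :
    (0 : ShiftAlgebra n).support ⊆ F := by
  rw [SkewMonoidAlgebra.support_zero]
  exact Finset.empty_subset F

theorem conjHom_single_one (g : signedPerms n) (r : RatFuncField n) :
    conjHom g (single 1 r) = single 1 (extendAut n g r) := by
  rw [conjHom_single, map_one]

end ShiftAlgebra

variable {W : Subgroup (TorusWeyl n ≃ₐ[ℂ] TorusWeyl n)} {c : ℂˣ} {H : Subgroup (signedPerms n)}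

/-! ## The Harish-Chandra property -/

theorem support_smul_subset (γ : invariantPolynomials W) (u : invariants W) :
    (invariantsEmb W c (γ • u)).support ⊆ (invariantsEmb W c u).support := by
  change (invariantsEmb W c ((γ : invariants W) * u)).support ⊆ _
  rw [map_mul, invariantsEmb_coe]
  exact ShiftAlgebra.support_single_one_mul _ _

theorem support_op_smul_subset (γ : (invariantPolynomials W).op) (u : invariants W) :
    (invariantsEmb W c (γ • u)).support ⊆ (invariantsEmb W c u).support := by
  change (invariantsEmb W c (u * ((⟨γ.1.unop, γ.2⟩ : invariantPolynomials W) :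
    invariants W))).support ⊆ _
  rw [map_mul, invariantsEmb_coe]
  exact ShiftAlgebra.support_mul_single_one _ _

theorem support_bimodule_subset {u v : invariants W}
    (hv : ∃ a ∈ invariantPolynomials W, ∃ b ∈ invariantPolynomials W, v = a * u * b) :
    (invariantsEmb W c v).support ⊆ (invariantsEmb W c u).support := by
  obtain ⟨a, ha, b, hb, rfl⟩ := hv
  exact (support_op_smul_subset ⟨MulOpposite.op b, hb⟩ (a * u)).trans
    (support_smul_subset ⟨a, ha⟩ u)

/-- Everything in ΓuΓ is supported in the finite support of u. -/
theorem isHarishChandra_invariantPolynomials (hW : IsModel W c H) :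
    IsHarishChandra (invariantPolynomials W) where
  comm a ha b hb := Subtype.ext (polynomials_comm ha hb)
  fg_left u := by
    refine fg_left_of_support_subset hW _ (invariantsEmb W c u).support fun v hv => ?_
    induction hv using Submodule.span_induction with
    | mem v hv => exact support_bimodule_subset hv
    | zero => rw [map_zero]; exact ShiftAlgebra.support_zero_subset _
    | add v v' _ _ h h' => rw [map_add]; exact ShiftAlgebra.support_add_subset h h'
    | smul γ v _ h => exact (support_smul_subset γ v).trans h
  fg_right u := by
    refine fg_right_of_support_subset hW _ (invariantsEmb W c u).support fun v hv => ?_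
    induction hv using Submodule.span_induction with
    | mem v hv => exact support_bimodule_subset hv
    | zero => rw [map_zero]; exact ShiftAlgebra.support_zero_subset _
    | add v v' _ _ h h' => rw [map_add]; exact ShiftAlgebra.support_add_subset h h'
    | smul γ v _ h => exact (support_op_smul_subset γ v).trans h

/-! ## The Galois order -/

variable (H) in
/-- The invariant rational functions. -/
abbrev ratInvariants : IntermediateField ℂ (RatFuncField n) :=
  IntermediateField.fixedField (galoisImage H)

theorem conjHom_single_ratInvariants {g : signedPerms n} (hg : g ∈ H) {r : RatFuncField n}
    (hr : r ∈ ratInvariants H) : ShiftAlgebra.conjHom g (SkewMonoidAlgebra.single 1 r) =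
      SkewMonoidAlgebra.single 1 r := by
  have h : extendAut n g.1 r = r := hr ⟨_, extendAut_mem_galoisImage H hg⟩
  rw [ShiftAlgebra.conjHom_single_one, h]

theorem ratEmb_mem_ratInvariants {p : MvPolynomial (Fin n) ℂ} (hp : ∀ g : H, g • p = p) :
    ratEmb n p ∈ ratInvariants H := by
  rw [ratInvariants, ← adjoin_invariants]
  exact IntermediateField.subset_adjoin _ _ ⟨p, hp, rfl⟩

theorem invariantsEmb_mem_skewInvariants (hW : IsModel W c H) (u : invariants W) :
    invariantsEmb W c u ∈ skewInvariants (ratInvariants H) (shiftMonoid n) :=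
  (mem_skewInvariants_iff H _).mpr ((mem_range_invariantsEmb_iff hW _).mp ⟨u, rfl⟩).2

theorem span_left_eq (hW : IsModel W c H) :
    (Submodule.span (coeffRing (ratInvariants H) (shiftMonoid n))
      (Set.range (invariantsEmb W c)) : Set (ShiftAlgebra n)) =
      skewInvariants (ratInvariants H) (shiftMonoid n) := by
  ext f
  constructor
  · intro hf
    induction hf using Submodule.span_induction with
    | mem f hf =>
      obtain ⟨u, rfl⟩ := hf
      exact invariantsEmb_mem_skewInvariants hW u
    | zero => exact (mem_skewInvariants_iff H _).mpr fun g _ => map_zero _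
    | add f f' _ _ h h' =>
      rw [mem_skewInvariants_iff] at h h' ⊢
      exact fun g hg => by rw [map_add, h g hg, h' g hg]
    | smul r f _ h =>
      rw [mem_skewInvariants_iff] at h ⊢
      obtain ⟨_, r, hr, rfl⟩ := r
      intro g hg
      change ShiftAlgebra.conjHom g (SkewMonoidAlgebra.single 1 r * f) =
        SkewMonoidAlgebra.single 1 r * f
      rw [map_mul, h g hg, conjHom_single_ratInvariants hg hr]
  · intro hf
    rw [mem_skewInvariants_iff] at hf
    -- An invariant common denominator N makes Nf an H-fixed element with polynomial coefficients,
    -- hence an element of U, and N⁻¹ lies in K.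
    obtain ⟨N, hN, hN', hN2⟩ := exists_invariant_denominator H f.support fun m => f.coeff m
    obtain ⟨u, hu⟩ := (mem_range_invariantsEmb_iff hW
      (SkewMonoidAlgebra.single 1 (ratEmb n N) * f)).mpr ⟨fun m => by
        rw [SkewMonoidAlgebra.coeff_single_one_mul, mul_comm]
        by_cases hm : m ∈ f.support
        · exact hN2 m hm
        · exact ⟨0, by rw [SkewMonoidAlgebra.notMem_support_iff.mp hm, zero_mul, map_zero]⟩,
      fun g hg => by
        rw [map_mul, hf g hg, conjHom_single_ratInvariants hg (ratEmb_mem_ratInvariants hN')]⟩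
    have hN0 : ratEmb n N ≠ 0 := (map_ne_zero_iff _ ratEmb_injective).mpr hN
    have h1 : f = SkewMonoidAlgebra.single 1 (ratEmb n N)⁻¹ * invariantsEmb W c u := by
      rw [hu, ← mul_assoc, SkewMonoidAlgebra.single_mul_single, one_mul, one_smul,
        inv_mul_cancel₀ hN0, SkewMonoidAlgebra.single_one_one, one_mul]
    rw [h1]
    exact Submodule.smul_mem _ (⟨_, _, inv_mem (ratEmb_mem_ratInvariants hN'), rfl⟩ :
      coeffRing (ratInvariants H) (shiftMonoid n)) (Submodule.subset_span ⟨u, rfl⟩)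

theorem span_right_eq (hW : IsModel W c H) :
    (Submodule.span (coeffRing (ratInvariants H) (shiftMonoid n)).op
      (Set.range (invariantsEmb W c)) : Set (ShiftAlgebra n)) =
      skewInvariants (ratInvariants H) (shiftMonoid n) := by
  ext f
  constructor
  · intro hf
    induction hf using Submodule.span_induction with
    | mem f hf =>
      obtain ⟨u, rfl⟩ := hf
      exact invariantsEmb_mem_skewInvariants hW u
    | zero => exact (mem_skewInvariants_iff H _).mpr fun g _ => map_zero _
    | add f f' _ _ h h' =>
      rw [mem_skewInvariants_iff] at h h' ⊢
      exact fun g hg => by rw [map_add, h g hg, h' g hg]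
    | smul r f _ h =>
      rw [mem_skewInvariants_iff] at h ⊢
      obtain ⟨r', r, hr, hr'⟩ := r
      intro g hg
      change ShiftAlgebra.conjHom g (f * r'.unop) = f * r'.unop
      rw [← hr']
      change ShiftAlgebra.conjHom g (f * SkewMonoidAlgebra.single 1 r) =
        f * SkewMonoidAlgebra.single 1 r
      rw [map_mul, h g hg, conjHom_single_ratInvariants hg hr]
  · intro hf
    rw [mem_skewInvariants_iff] at hf
    -- The coefficient of fN at m is r_m·m(N), so the denominators to be cleared are those of
    -- m⁻¹(r_m).
    obtain ⟨N, hN, hN', hN2⟩ := exists_invariant_denominator H f.support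
      fun m => (m : RatFuncField n ≃ₐ[ℂ] RatFuncField n)⁻¹ (f.coeff m)
    obtain ⟨u, hu⟩ := (mem_range_invariantsEmb_iff hW
      (f * SkewMonoidAlgebra.single 1 (ratEmb n N))).mpr ⟨fun m => by
        rw [SkewMonoidAlgebra.coeff_mul_single_one]
        by_cases hm : m ∈ f.support
        · obtain ⟨p, hp⟩ := hN2 m hm
          obtain ⟨a, rfl⟩ := shift_surjective m
          refine ⟨intTranslate n a p, ?_⟩
          rw [← shift_apply_ratEmb, hp, map_mul, ← AlgEquiv.mul_apply, mul_inv_cancel,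
            AlgEquiv.one_apply]
          rfl
        · exact ⟨0, by rw [SkewMonoidAlgebra.notMem_support_iff.mp hm, zero_mul, map_zero]⟩,
      fun g hg => by
        rw [map_mul, hf g hg, conjHom_single_ratInvariants hg (ratEmb_mem_ratInvariants hN')]⟩
    have hN0 : ratEmb n N ≠ 0 := (map_ne_zero_iff _ ratEmb_injective).mpr hN
    have h1 : f = invariantsEmb W c u * SkewMonoidAlgebra.single 1 (ratEmb n N)⁻¹ := by
      rw [hu, mul_assoc, SkewMonoidAlgebra.single_mul_single, one_mul, one_smul,
        mul_inv_cancel₀ hN0, SkewMonoidAlgebra.single_one_one, mul_one]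
    rw [h1]
    exact Submodule.smul_mem _ (⟨MulOpposite.op (SkewMonoidAlgebra.single 1 (ratEmb n N)⁻¹), _,
      inv_mem (ratEmb_mem_ratInvariants hN'), rfl⟩ :
      (coeffRing (ratInvariants H) (shiftMonoid n)).op) (Submodule.subset_span ⟨u, rfl⟩)

theorem invariantCoeffEmb_mem (hW : IsModel W c H) (γ : invariantPolynomials W) :
    invariantCoeffEmb W γ ∈ ratInvariants H := by
  rw [ratInvariants, ← fracField_invariantCoeffEmb hW]
  exact IntermediateField.subset_adjoin _ _ ⟨γ, rfl⟩

theorem exists_fg_left (hW : IsModel W c H)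
    (V : Submodule (coeffRing (ratInvariants H) (shiftMonoid n)) (ShiftAlgebra n)) (hV : V.FG) :
    ∃ N : Submodule (invariantPolynomials W) (invariants W),
      (N : Set (invariants W)) = invariantsEmb W c ⁻¹' V ∧ N.FG := by
  classical
  let N : Submodule (invariantPolynomials W) (invariants W) :=
    { carrier := invariantsEmb W c ⁻¹' V
      zero_mem' := by
        rw [Set.mem_preimage, map_zero]
        exact V.zero_mem
      add_mem' := fun {u v} hu hv => by
        rw [Set.mem_preimage, map_add]
        exact V.add_mem hu hv
      smul_mem' := fun γ u hu => by
        change invariantsEmb W c ((γ : invariants W) * u) ∈ V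
        rw [map_mul, invariantsEmb_coe]
        exact V.smul_mem (⟨_, _, invariantCoeffEmb_mem hW γ, rfl⟩ :
          coeffRing (ratInvariants H) (shiftMonoid n)) hu }
  refine ⟨N, rfl, ?_⟩
  obtain ⟨s, rfl⟩ := hV
  -- Scalars from K do not enlarge supports, so all of V is supported in the union of the supports
  -- of its finitely many generators.
  have key : ∀ f ∈ Submodule.span (coeffRing (ratInvariants H) (shiftMonoid n))
      (s : Set (ShiftAlgebra n)), f.support ⊆ s.biUnion fun f => f.support := fun f hf => ?_
  · exact fg_left_of_support_subset hW N (s.biUnion fun f => f.support) fun u hu => key _ hu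
  induction hf using Submodule.span_induction with
  | mem f hf => exact Finset.subset_biUnion_of_mem (fun f : ShiftAlgebra n => f.support) hf
  | zero => exact ShiftAlgebra.support_zero_subset _
  | add f f' _ _ h h' => exact ShiftAlgebra.support_add_subset h h'
  | smul r f _ h =>
    obtain ⟨_, r, hr, rfl⟩ := r
    exact (ShiftAlgebra.support_single_one_mul r f).trans h

theorem exists_fg_right (hW : IsModel W c H)
    (V : Submodule (coeffRing (ratInvariants H) (shiftMonoid n)).op (ShiftAlgebra n))
    (hV : V.FG) : ∃ N : Submodule (invariantPolynomials W).op (invariants W),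
      (N : Set (invariants W)) = invariantsEmb W c ⁻¹' V ∧ N.FG := by
  classical
  let N : Submodule (invariantPolynomials W).op (invariants W) :=
    { carrier := invariantsEmb W c ⁻¹' V
      zero_mem' := by
        rw [Set.mem_preimage, map_zero]
        exact V.zero_mem
      add_mem' := fun {u v} hu hv => by
        rw [Set.mem_preimage, map_add]
        exact V.add_mem hu hv
      smul_mem' := fun γ u hu => by
        change invariantsEmb W c (u * ((⟨γ.1.unop, γ.2⟩ : invariantPolynomials W) :
          invariants W)) ∈ V
        rw [map_mul, invariantsEmb_coe]
        exact V.smul_mem (⟨MulOpposite.op (SkewMonoidAlgebra.single 1 _), _,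
          invariantCoeffEmb_mem hW ⟨γ.1.unop, γ.2⟩, rfl⟩ :
          (coeffRing (ratInvariants H) (shiftMonoid n)).op) hu }
  refine ⟨N, rfl, ?_⟩
  obtain ⟨s, rfl⟩ := hV
  have key : ∀ f ∈ Submodule.span (coeffRing (ratInvariants H) (shiftMonoid n)).op
      (s : Set (ShiftAlgebra n)), f.support ⊆ s.biUnion fun f => f.support := fun f hf => ?_
  · exact fg_right_of_support_subset hW N (s.biUnion fun f => f.support) fun u hu => key _ hu
  induction hf using Submodule.span_induction with
  | mem f hf => exact Finset.subset_biUnion_of_mem (fun f : ShiftAlgebra n => f.support) hf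
  | zero => exact ShiftAlgebra.support_zero_subset _
  | add f f' _ _ h h' => exact ShiftAlgebra.support_add_subset h h'
  | smul r f _ h =>
    obtain ⟨r', r, hr, hr'⟩ := r
    refine Finset.Subset.trans ?_ h
    change (f * r'.unop).support ⊆ f.support
    rw [← hr']
    exact ShiftAlgebra.support_mul_single_one r f

theorem isGaloisRing (hW : IsModel W c H)
    (hfg : ∃ s : Finset (invariants W), Algebra.adjoin ℂ
      ((invariantPolynomials W : Set (invariants W)) ∪ (s : Set (invariants W))) = ⊤) :
    IsGaloisRing (invariantPolynomials W) (shiftMonoid n) (invariantCoeffEmb W)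
      (invariantsEmb W c) where
  injective_coeff := invariantCoeffEmb_injective
  finiteDimensional := by
    rw [fracField_invariantCoeffEmb hW]
    exact finiteDimensional_fixedField _
  isGalois := by
    rw [fracField_invariantCoeffEmb hW]
    exact isGalois_fixedField _
  conj_mem := by
    rw [fracField_invariantCoeffEmb hW, fixingSubgroup_fixedField_of_finite]
    rintro _ ⟨g, hg, rfl⟩ m hm
    exact extendAut_conj_mem g.2 hm
  eq_of_restrict := by
    rw [fracField_invariantCoeffEmb hW]
    exact fun m hm m' hm' h => eq_of_eq_on_fixedField H hm hm' h
  map_coeff := invariantsEmb_coe c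
  injective := invariantsEmb_injective
  finitelyGenerated := hfg
  span_left := by
    rw [fracField_invariantCoeffEmb hW]
    exact span_left_eq hW
  span_right := by
    rw [fracField_invariantCoeffEmb hW]
    exact span_right_eq hW

theorem isGaloisOrder (hW : IsModel W c H)
    (hfg : ∃ s : Finset (invariants W), Algebra.adjoin ℂ
      ((invariantPolynomials W : Set (invariants W)) ∪ (s : Set (invariants W))) = ⊤) :
    IsGaloisOrder (invariantPolynomials W) (shiftMonoid n) (invariantCoeffEmb W)
      (invariantsEmb W c) :=
  ⟨{ isGaloisRing hW hfg with
      fg_left := by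
        rw [fracField_invariantCoeffEmb hW]
        exact fun V hV _ => exists_fg_left hW V hV },
    { isGaloisRing hW hfg with
      fg_right := by
        rw [fracField_invariantCoeffEmb hW]
        exact fun V hV _ => exists_fg_right hW V hV }⟩

end Torus

end

noncomputable section

open MvPolynomial

section Torus

variable {n : ℕ}

open TorusWeyl

/-! ## The degree filtration -/

/-- Polynomials of degree less than `d`. -/
def lowDeg (n d : ℕ) : Submodule ℂ (MvPolynomial (Fin n) ℂ) :=
  restrictSupport ℂ {m | m.degree < d}

theorem lowDeg_mono {d e : ℕ} (h : d ≤ e) : lowDeg n d ≤ lowDeg n e :=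
  restrictSupport_mono _ fun _ hm => lt_of_lt_of_le hm h

theorem mem_lowDeg {d : ℕ} {p : MvPolynomial (Fin n) ℂ} :
    p ∈ lowDeg n d ↔ ∀ m, MvPolynomial.coeff m p ≠ 0 → m.degree < d := by
  rw [lowDeg, mem_restrictSupport_iff]
  exact forall_congr' fun m => by rw [Finset.mem_coe, MvPolynomial.mem_support_iff]; rfl

/-- The bounds are strict: the degrees are at most d − 1 and e − 1, which accounts for the extra 1.
The strict convention makes the zeroth step of the filtration zero. -/
theorem mul_mem_lowDeg {d e f : ℕ} (hf : d + e ≤ f + 1) {p q : MvPolynomial (Fin n) ℂ}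
    (hp : p ∈ lowDeg n d) (hq : q ∈ lowDeg n e) : p * q ∈ lowDeg n f := by
  classical
  rw [mem_lowDeg] at *
  intro m hm
  have h1 := support_mul p q (MvPolynomial.mem_support_iff.mpr hm)
  obtain ⟨a, ha, b, hb, rfl⟩ := Finset.mem_add.mp h1
  have h2 := hp a (MvPolynomial.mem_support_iff.mp ha)
  have h3 := hq b (MvPolynomial.mem_support_iff.mp hb)
  rw [map_add]
  omega

theorem MvPolynomial.IsHomogeneous.mem_lowDeg {d : ℕ} {p : MvPolynomial (Fin n) ℂ}
    (hp : p.IsHomogeneous d) : p ∈ lowDeg n (d + 1) := by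
  rw [_root_.mem_lowDeg]
  intro m hm
  have h : m.degree = d := by
    rw [Finsupp.degree_eq_weight_one]
    exact hp hm
  omega

theorem sub_homogeneousComponent_mem_lowDeg {d : ℕ} {p : MvPolynomial (Fin n) ℂ}
    (hp : p ∈ lowDeg n (d + 1)) : p - homogeneousComponent d p ∈ lowDeg n d := by
  rw [mem_lowDeg] at *
  intro m hm
  rw [coeff_sub, coeff_homogeneousComponent] at hm
  split_ifs at hm with h
  · rw [sub_self] at hm
    exact absurd rfl hm
  · rw [sub_zero] at hm
    have := hp m hm
    omega

/-- A translation does not change leading forms. This holds for constants and variables and passes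
to products by expanding τ(pq) − pq in τp − p and τq − q. -/
theorem intTranslate_sub_mem_lowDeg (a : Multiplicative (Fin n → ℤ)) {e : ℕ}
    {q : MvPolynomial (Fin n) ℂ} (hq : q ∈ lowDeg n (e + 1)) :
    intTranslate n a q - q ∈ lowDeg n e := by
  have hmul : ∀ {p q : MvPolynomial (Fin n) ℂ} {d e : ℕ}, p ∈ lowDeg n (d + 1) →
      intTranslate n a p - p ∈ lowDeg n d → q ∈ lowDeg n (e + 1) →
      intTranslate n a q - q ∈ lowDeg n e →
      p * q ∈ lowDeg n (d + e + 1) ∧ intTranslate n a (p * q) - p * q ∈ lowDeg n (d + e) := by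
    intro p q d e hp hp' hq hq'
    refine ⟨mul_mem_lowDeg (by omega) hp hq, ?_⟩
    have h1 : intTranslate n a (p * q) - p * q = (intTranslate n a p - p) * q +
        ((intTranslate n a p - p) * (intTranslate n a q - q) +
          p * (intTranslate n a q - q)) := by
      rw [map_mul]
      ring
    rw [h1]
    exact add_mem (mul_mem_lowDeg (by omega) hp' hq) (add_mem
      (mul_mem_lowDeg (by omega) hp' hq') (mul_mem_lowDeg (by omega) hp hq'))
  have hone : (1 : MvPolynomial (Fin n) ℂ) ∈ lowDeg n (0 + 1) ∧
      intTranslate n a 1 - 1 ∈ lowDeg n 0 := by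
    refine ⟨(isHomogeneous_one _ _).mem_lowDeg, ?_⟩
    rw [map_one, sub_self]
    exact zero_mem _
  have hmon : ∀ m : Fin n →₀ ℕ, (monomial m 1 : MvPolynomial (Fin n) ℂ) ∈
      lowDeg n (m.degree + 1) ∧
      intTranslate n a (monomial m 1) - monomial m 1 ∈ lowDeg n m.degree := by
    intro m
    induction m using Finsupp.induction_linear with
    | zero => simpa using hone
    | add m m' hm hm' =>
      have h1 : (monomial (m + m') 1 : MvPolynomial (Fin n) ℂ) = monomial m 1 * monomial m' 1 := by
        rw [monomial_mul, one_mul]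
      rw [h1, map_add]
      exact hmul hm.1 hm.2 hm'.1 hm'.2
    | single i k =>
      rw [Finsupp.degree_single, ← X_pow_eq_monomial]
      induction k with
      | zero => simpa using hone
      | succ k ih =>
        rw [pow_succ]
        refine hmul ih.1 ih.2 (isHomogeneous_X _ _).mem_lowDeg ?_
        rw [intTranslate_X, sub_sub_cancel_left]
        exact neg_mem (isHomogeneous_C _ _).mem_lowDeg
  have hq' : q ∈ Submodule.span ℂ ((monomial · (1 : ℂ)) '' {m : Fin n →₀ ℕ | m.degree < e + 1}) := by
    rw [← restrictSupport_eq_span]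
    exact hq
  clear hq
  induction hq' using Submodule.span_induction with
  | mem q h =>
    obtain ⟨m, hm, rfl⟩ := h
    exact lowDeg_mono (Nat.lt_succ_iff.mp hm) (hmon m).2
  | zero => rw [map_zero, sub_zero]; exact zero_mem _
  | add p q hp hq ihp ihq =>
    rw [map_add, add_sub_add_comm]
    exact add_mem ihp ihq
  | smul c p hp ihp =>
    rw [map_smul, ← smul_sub]
    exact Submodule.smul_mem _ c ihp

/-! ## Products of symbols -/

/-- The biadditive extension of a family of products of coefficients. -/
def symbolProd (β : Multiplicative (Fin n → ℤ) → MvPolynomial (Fin n) ℂ →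
    MvPolynomial (Fin n) ℂ → MvPolynomial (Fin n) ℂ) (f g : TorusSymbols n) : TorusSymbols n :=
  f.coeff.sum fun a p => g.coeff.sum fun b q => SymbolAlgebra.single (a * b) (β a p q)

theorem coeff_symbolProd_mem {β : Multiplicative (Fin n → ℤ) → MvPolynomial (Fin n) ℂ →
    MvPolynomial (Fin n) ℂ → MvPolynomial (Fin n) ℂ} {f g : TorusSymbols n}
    {C : Submodule ℂ (MvPolynomial (Fin n) ℂ)}
    (h : ∀ a b, β a (f.coeff a) (g.coeff b) ∈ C) (m : Multiplicative (Fin n → ℤ)) :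
    (symbolProd β f g).coeff m ∈ C := by
  classical
  let ev : TorusSymbols n →+ MvPolynomial (Fin n) ℂ :=
    { toFun := fun f => f.coeff m
      map_zero' := rfl
      map_add' := fun _ _ => rfl }
  change ev (symbolProd β f g) ∈ C
  rw [symbolProd, Finsupp.sum, map_sum]
  refine C.sum_mem fun a _ => ?_
  rw [Finsupp.sum, map_sum]
  refine C.sum_mem fun b _ => ?_
  change (Finsupp.single (a * b) (β a (f.coeff a) (g.coeff b))) m ∈ C
  rw [Finsupp.single_apply]
  split_ifs
  · exact h a b
  · exact C.zero_mem

theorem mul_eq_symbolProd (f g : TorusSymbols n) : f * g = symbolProd (fun _ p q => p * q) f g :=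
  MonoidAlgebra.mul_def f g

theorem symbolProd_sub (β β' : Multiplicative (Fin n → ℤ) → MvPolynomial (Fin n) ℂ →
    MvPolynomial (Fin n) ℂ → MvPolynomial (Fin n) ℂ) (f g : TorusSymbols n) :
    symbolProd β f g - symbolProd β' f g = symbolProd (fun a p q => β a p q - β' a p q) f g := by
  have h : ∀ (m : Multiplicative (Fin n → ℤ)) (p q : MvPolynomial (Fin n) ℂ),
      (SymbolAlgebra.single m (p - q) : TorusSymbols n) =
        SymbolAlgebra.single m p - SymbolAlgebra.single m q := fun m p q => by
    rw [eq_sub_iff_add_eq, ← SymbolAlgebra.single_add, sub_add_cancel]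
  simp only [symbolProd, Finsupp.sum, h, Finset.sum_sub_distrib]

/-- The product that corresponds to the product of the skew monoid algebra. -/
def starProd (f g : TorusSymbols n) : TorusSymbols n :=
  symbolProd (fun a p q => p * intTranslate n a q) f g

/-- The map from symbols, in the left normal form. -/
abbrev leftSymbolMap (n : ℕ) : TorusSymbols n →+ ShiftAlgebra n :=
  symbolMap (1 : Multiplicative (Fin n → ℤ) →* _)

theorem leftSymbolMap_eq_sum (f : TorusSymbols n) : leftSymbolMap n f =
    f.coeff.sum fun a p => SkewMonoidAlgebra.single (shift n a) (ratEmb n p) := rfl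

theorem leftSymbolMap_starProd (f g : TorusSymbols n) :
    leftSymbolMap n (starProd f g) = leftSymbolMap n f * leftSymbolMap n g := by
  rw [leftSymbolMap_eq_sum f, leftSymbolMap_eq_sum g, starProd, symbolProd, Finsupp.sum, map_sum,
    Finsupp.sum, Finset.sum_mul]
  refine Finset.sum_congr rfl fun a _ => ?_
  rw [Finsupp.sum, map_sum, Finsupp.sum, Finset.mul_sum]
  refine Finset.sum_congr rfl fun b _ => ?_
  rw [symbolMap_single, SkewMonoidAlgebra.single_mul_single, ← map_mul,
    ShiftAlgebra.shift_smul_ratEmb, ← map_mul]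
  rfl

theorem leftSymbolMap_smul (r : ℂ) (f : TorusSymbols n) :
    leftSymbolMap n (r • f) = algebraMap ℂ _ r * leftSymbolMap n f := by
  have h : (r • f : TorusSymbols n) = (C r : MvPolynomial (Fin n) ℂ) • f :=
    SymbolAlgebra.ext fun a => by
      rw [SymbolAlgebra.coeff_smul, SymbolAlgebra.coeff_smul, Finsupp.smul_apply,
        Finsupp.smul_apply, smul_eq_mul, smul_eq_C_mul]
  rw [h, leftSymbolMap, symbolMap_one_smul, ← MvPolynomial.algebraMap_eq, AlgHom.commutes]
  rfl

theorem leftSymbolMap_one : leftSymbolMap n 1 = 1 := by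
  have h : (1 : TorusSymbols n) = SymbolAlgebra.single 1 1 := rfl
  rw [h, leftSymbolMap, symbolMap_single, map_one (shift n), map_one, map_one]
  rfl

/-- Symbols whose coefficients have degree less than `d`. -/
def lowSymbols (n d : ℕ) : Submodule ℂ (TorusSymbols n) where
  carrier := {f | ∀ a, f.coeff a ∈ lowDeg n d}
  zero_mem' _ := zero_mem _
  add_mem' hf hg a := add_mem (hf a) (hg a)
  smul_mem' c _ hf a := Submodule.smul_mem _ c (hf a)

theorem lowSymbols_mono {d e : ℕ} (h : d ≤ e) : lowSymbols n d ≤ lowSymbols n e :=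
  fun _ hf a => lowDeg_mono h (hf a)

theorem exists_mem_lowSymbols (f : TorusSymbols n) : ∃ d, f ∈ lowSymbols n d := by
  refine ⟨f.coeff.support.sup (fun a => (f.coeff a).totalDegree) + 1, fun a => ?_⟩
  rw [mem_lowDeg]
  intro m hm
  have h1 : a ∈ f.coeff.support := by
    rw [Finsupp.mem_support_iff]
    intro h
    rw [h] at hm
    exact hm rfl
  have h2 := Finset.le_sup (f := fun a => (f.coeff a).totalDegree) h1
  have h3 : m.degree ≤ (f.coeff a).totalDegree :=
    le_totalDegree (MvPolynomial.mem_support_iff.mpr hm)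
  change (f.coeff a).totalDegree ≤ _ at h2
  omega

theorem eq_zero_of_mem_lowSymbols_zero {f : TorusSymbols n} (hf : f ∈ lowSymbols n 0) :
    f = 0 := by
  refine SymbolAlgebra.ext fun a => MvPolynomial.ext _ _ fun m => ?_
  by_contra h
  exact Nat.not_lt_zero _ (mem_lowDeg.mp (hf a) m h)

theorem mul_mem_lowSymbols {d e k : ℕ} (hk : d + e ≤ k + 1) {f g : TorusSymbols n}
    (hf : f ∈ lowSymbols n d) (hg : g ∈ lowSymbols n e) : f * g ∈ lowSymbols n k := by
  rw [mul_eq_symbolProd]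
  exact fun m => coeff_symbolProd_mem (fun a b => mul_mem_lowDeg hk (hf a) (hg b)) m

/-- The product of the skew monoid ring deforms the commutative one by terms of lower degree, so the
associated graded algebra is commutative. -/
theorem starProd_sub_mul_mem {d e : ℕ} {f g : TorusSymbols n}
    (hf : f ∈ lowSymbols n (d + 1)) (hg : g ∈ lowSymbols n (e + 1)) :
    starProd f g - f * g ∈ lowSymbols n (d + e) := by
  rw [mul_eq_symbolProd, starProd, symbolProd_sub]
  refine fun m => coeff_symbolProd_mem (fun a b => ?_) m
  rw [← mul_sub]
  exact mul_mem_lowDeg (by omega) (hf a) (intTranslate_sub_mem_lowDeg a (hg b))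

/-- The homogeneous component of degree `d` of the coefficients. -/
def symbolComponent (d : ℕ) : TorusSymbols n →ₗ[ℂ] TorusSymbols n where
  toFun f := SymbolAlgebra.ofCoeff (f.coeff.mapRange (homogeneousComponent d) (map_zero _))
  map_add' _ _ := SymbolAlgebra.ext fun _ => map_add (homogeneousComponent d) _ _
  map_smul' c _ := SymbolAlgebra.ext fun _ => map_smul (homogeneousComponent d) c _

theorem coeff_symbolComponent (d : ℕ) (f : TorusSymbols n) (a : Multiplicative (Fin n → ℤ)) :
    (symbolComponent d f).coeff a = homogeneousComponent d (f.coeff a) := rfl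

theorem sub_symbolComponent_mem {d : ℕ} {f : TorusSymbols n} (hf : f ∈ lowSymbols n (d + 1)) :
    f - symbolComponent d f ∈ lowSymbols n d :=
  fun a => sub_homogeneousComponent_mem_lowDeg (hf a)

/-- Symbols with homogeneous coefficients of degree `d`. -/
def homogeneousSymbols (n d : ℕ) : Submodule ℂ (TorusSymbols n) where
  carrier := {f | ∀ a, f.coeff a ∈ homogeneousSubmodule (Fin n) ℂ d}
  zero_mem' _ := zero_mem _
  add_mem' hf hg a := add_mem (hf a) (hg a)
  smul_mem' c _ hf a := Submodule.smul_mem _ c (hf a)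

theorem symbolComponent_mem (d : ℕ) (f : TorusSymbols n) :
    symbolComponent d f ∈ homogeneousSymbols n d :=
  fun a => homogeneousComponent_isHomogeneous d (f.coeff a)

theorem homogeneousSymbols_le (d : ℕ) : homogeneousSymbols n d ≤ lowSymbols n (d + 1) :=
  fun _ hf a => MvPolynomial.IsHomogeneous.mem_lowDeg (hf a)

theorem symbolComponent_of_mem {d e : ℕ} {f : TorusSymbols n} (hf : f ∈ homogeneousSymbols n e) :
    symbolComponent d f = if d = e then f else 0 := by
  refine SymbolAlgebra.ext fun a => ?_
  rw [coeff_symbolComponent, homogeneousComponent_of_mem (hf a)]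
  split_ifs <;> rfl

theorem mul_mem_homogeneousSymbols {d e : ℕ} {f g : TorusSymbols n}
    (hf : f ∈ homogeneousSymbols n d) (hg : g ∈ homogeneousSymbols n e) :
    f * g ∈ homogeneousSymbols n (d + e) := by
  rw [mul_eq_symbolProd]
  exact fun m => coeff_symbolProd_mem (C := homogeneousSubmodule (Fin n) ℂ (d + e))
    (fun a b => MvPolynomial.IsHomogeneous.mul (hf a) (hg b)) m

theorem one_mem_homogeneousSymbols : (1 : TorusSymbols n) ∈ homogeneousSymbols n 0 := by
  classical
  intro a
  change Finsupp.single (1 : Multiplicative (Fin n → ℤ)) (1 : MvPolynomial (Fin n) ℂ) a ∈ _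
  rw [Finsupp.single_apply]
  split_ifs
  · exact isHomogeneous_one _ _
  · exact zero_mem _

theorem sum_symbolComponent {d : ℕ} {f : TorusSymbols n} (hf : f ∈ lowSymbols n d) :
    f = ∑ i ∈ Finset.range d, symbolComponent i f := by
  induction d generalizing f with
  | zero => rw [Finset.range_zero, Finset.sum_empty, eq_zero_of_mem_lowSymbols_zero hf]
  | succ d ih =>
    have h1 := ih (sub_symbolComponent_mem hf)
    have h2 : ∀ i ∈ Finset.range d, symbolComponent i (f - symbolComponent d f) =
        symbolComponent i f := fun i hi => by
      rw [map_sub, symbolComponent_of_mem (symbolComponent_mem d f),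
        if_neg (Finset.mem_range.mp hi).ne, sub_zero]
    rw [Finset.sum_congr rfl h2] at h1
    rw [Finset.sum_range_succ, ← h1, sub_add_cancel]

variable {H : Subgroup (signedPerms n)}

theorem smul_symbolComponent (g : H) (d : ℕ) (f : TorusSymbols n) :
    g • symbolComponent d f = symbolComponent d (g • f) := by
  have := Fintype.ofFinite H
  refine SymbolAlgebra.ext fun a => ?_
  obtain ⟨a, rfl⟩ := MulAction.surjective g a
  change (g • symbolComponent d f).coeff (g • a) = (symbolComponent d (g • f)).coeff (g • a)
  have h : ∀ p, g • homogeneousComponent d p = homogeneousComponent d (g • p) := fun p =>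
    smul_homogeneousComponent (k := ℂ) (σ := Fin n) (G := H) isHomogeneous_smul g p d
  refine (SymbolAlgebra.coeff_group_smul g (symbolComponent d f) a).trans ?_
  rw [coeff_symbolComponent, coeff_symbolComponent, h]
  exact congrArg _ (SymbolAlgebra.coeff_group_smul g f a).symm

/-- The invariant symbols are generated by finitely many homogeneous ones. -/
theorem exists_homogeneous_generators (H : Subgroup (signedPerms n)) :
    ∃ S : Set (TorusSymbols n), S.Finite ∧ (∀ f ∈ S, ∀ g : H, g • f = f) ∧
      (∀ f ∈ S, ∃ d, f ∈ homogeneousSymbols n d) ∧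
      ∀ f : TorusSymbols n, (∀ g : H, g • f = f) → f ∈ Algebra.adjoin ℂ S := by
  have h1 : Algebra.FiniteType ℂ (TorusSymbols n) := SymbolAlgebra.finiteType ℂ
  obtain ⟨s, hs⟩ := (fixedPoints_finiteType ℂ (TorusSymbols n) H).out
  choose d hd using fun f : TorusSymbols n => exists_mem_lowSymbols f
  -- The homogeneous components of Noether's generators; they are still invariant because the action
  -- preserves degrees.
  let S : Set (TorusSymbols n) := ⋃ f ∈ s, (fun i => symbolComponent i f.1) '' Finset.range (d f.1)
  refine ⟨S, ?_, ?_, ?_, ?_⟩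
  · exact s.finite_toSet.biUnion fun f _ => (Finset.finite_toSet _).image _
  · intro f hf g
    obtain ⟨f, _, i, _, rfl⟩ := Set.mem_iUnion₂.mp hf
    change g • symbolComponent i f.1 = symbolComponent i f.1
    rw [smul_symbolComponent, f.2 g]
  · intro f hf
    obtain ⟨f, _, i, _, rfl⟩ := Set.mem_iUnion₂.mp hf
    exact ⟨i, symbolComponent_mem i _⟩
  · intro f hf
    have h2 : (⟨f, hf⟩ : FixedPoints.subalgebra ℂ (TorusSymbols n) H) ∈ Algebra.adjoin ℂ
        (s : Set (FixedPoints.subalgebra ℂ (TorusSymbols n) H)) := by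
      rw [hs]; trivial
    have h3 : (FixedPoints.subalgebra ℂ (TorusSymbols n) H).val ⟨f, hf⟩ ∈
        (Algebra.adjoin ℂ (s : Set (FixedPoints.subalgebra ℂ (TorusSymbols n) H))).map
          (FixedPoints.subalgebra ℂ (TorusSymbols n) H).val := ⟨_, h2, rfl⟩
    rw [AlgHom.map_adjoin] at h3
    refine Algebra.adjoin_le ?_ h3
    rintro _ ⟨r, hr, rfl⟩
    change r.1 ∈ Algebra.adjoin ℂ S
    rw [sum_symbolComponent (hd r.1)]
    exact Subalgebra.sum_mem _ fun i hi => Algebra.subset_adjoin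
      (Set.mem_iUnion₂.mpr ⟨r, hr, i, hi, rfl⟩)

/-! ## Finite generation of the invariants -/

variable {W : Subgroup (TorusWeyl n ≃ₐ[ℂ] TorusWeyl n)} {c : ℂˣ}

/-- The symbol in the left normal form. -/
abbrev leftSymbol (W : Subgroup (TorusWeyl n ≃ₐ[ℂ] TorusWeyl n)) (c : ℂˣ) :
    invariants W →+ TorusSymbols n :=
  symbol W c (1 : Multiplicative (Fin n → ℤ) →* _)

theorem leftSymbol_mul (u v : invariants W) :
    leftSymbol W c (u * v) = starProd (leftSymbol W c u) (leftSymbol W c v) := by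
  rw [symbol_eq_iff, map_mul]
  refine Eq.trans ?_ (leftSymbolMap_starProd _ _).symm
  rw [symbolMap_symbol, symbolMap_symbol]

theorem leftSymbol_smul (r : ℂ) (u : invariants W) :
    leftSymbol W c (r • u) = r • leftSymbol W c u := by
  rw [symbol_eq_iff]
  refine Eq.trans ?_ (leftSymbolMap_smul _ _).symm
  rw [symbolMap_symbol, Algebra.smul_def, map_mul, AlgHom.commutes]

theorem leftSymbol_one : leftSymbol W c 1 = 1 := by
  rw [symbol_eq_iff, map_one]
  exact leftSymbolMap_one.symm

/-- Lifts to U of homogeneous generators of the commutative algebra of invariant symbols generate U: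
leading symbols are matched and the degree descends. -/
theorem exists_finset_adjoin_eq_top (hW : IsModel W c H) :
    ∃ s : Finset (invariants W), Algebra.adjoin ℂ (s : Set (invariants W)) = ⊤ := by
  obtain ⟨S, hSfin, hSinv, hShom, hS⟩ := exists_homogeneous_generators H
  have hrange := range_symbol (c := c) hW one_smul_compat
  have hTfin : (leftSymbol W c ⁻¹' S).Finite := hSfin.preimage symbol_injective.injOn
  refine ⟨hTfin.toFinset, ?_⟩
  rw [Set.Finite.coe_toFinset]
  set B := Algebra.adjoin ℂ (leftSymbol W c ⁻¹' S) with hB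
  -- A monomial in the generators is the leading part of the symbol of the corresponding product in
  -- U, up to lower degree.
  have hmon : ∀ r ∈ Submonoid.closure S, ∃ e, r ∈ homogeneousSymbols n e ∧
      ∃ b ∈ B, r - leftSymbol W c b ∈ lowSymbols n e := by
    intro r hr
    induction hr using Submonoid.closure_induction with
    | mem r hr =>
      obtain ⟨e, he⟩ := hShom r hr
      obtain ⟨b, rfl⟩ := hrange.ge (hSinv r hr)
      exact ⟨e, he, b, Algebra.subset_adjoin hr, by rw [sub_self]; exact zero_mem _⟩
    | one =>
      exact ⟨0, one_mem_homogeneousSymbols, 1, one_mem _, by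
        rw [leftSymbol_one, sub_self]; exact zero_mem _⟩
    | mul r r' _ _ h h' =>
      obtain ⟨e, he, b, hb, hbr⟩ := h
      obtain ⟨e', he', b', hb', hbr'⟩ := h'
      refine ⟨e + e', mul_mem_homogeneousSymbols he he', b * b', mul_mem hb hb', ?_⟩
      have h1 : leftSymbol W c b ∈ lowSymbols n (e + 1) := by
        have := sub_mem (homogeneousSymbols_le e he) (lowSymbols_mono (Nat.le_succ e) hbr)
        rwa [sub_sub_cancel] at this
      have h1' : leftSymbol W c b' ∈ lowSymbols n (e' + 1) := by
        have := sub_mem (homogeneousSymbols_le e' he') (lowSymbols_mono (Nat.le_succ e') hbr')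
        rwa [sub_sub_cancel] at this
      have h2 : r * r' - leftSymbol W c (b * b') = (r - leftSymbol W c b) * r' +
          leftSymbol W c b * (r' - leftSymbol W c b') -
          (starProd (leftSymbol W c b) (leftSymbol W c b') -
            leftSymbol W c b * leftSymbol W c b') := by
        rw [leftSymbol_mul]
        ring
      rw [h2]
      exact sub_mem (add_mem (mul_mem_lowSymbols (by omega) hbr (homogeneousSymbols_le e' he'))
        (mul_mem_lowSymbols (by omega) h1 hbr')) (starProd_sub_mul_mem h1 h1')
  -- A polynomial in the generators is a linear combination of homogeneous monomials; its component
  -- of degree d collects only those of degree d, each matched by the preceding claim.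
  have hcomp : ∀ r ∈ Algebra.adjoin ℂ S, ∀ d, ∃ b ∈ B,
      symbolComponent d r - leftSymbol W c b ∈ lowSymbols n d := by
    intro r hr d
    rw [← Subalgebra.mem_toSubmodule, Algebra.adjoin_eq_span] at hr
    induction hr using Submodule.span_induction with
    | mem r hr =>
      obtain ⟨e, he, b, hb, hbr⟩ := hmon r hr
      rw [symbolComponent_of_mem he]
      split_ifs with h
      · subst h
        exact ⟨b, hb, hbr⟩
      · exact ⟨0, zero_mem _, by rw [map_zero, sub_zero]; exact zero_mem _⟩
    | zero => exact ⟨0, zero_mem _, by rw [map_zero, map_zero, sub_zero]; exact zero_mem _⟩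
    | add r r' _ _ h h' =>
      obtain ⟨b, hb, hbr⟩ := h
      obtain ⟨b', hb', hbr'⟩ := h'
      exact ⟨b + b', add_mem hb hb', by
        rw [map_add, map_add, add_sub_add_comm]; exact add_mem hbr hbr'⟩
    | smul z r _ h =>
      obtain ⟨b, hb, hbr⟩ := h
      refine ⟨z • b, B.smul_mem hb z, ?_⟩
      have h1 := Submodule.smul_mem (lowSymbols n d) z hbr
      rw [smul_sub] at h1
      rw [map_smul, leftSymbol_smul]
      exact h1
  -- Subtracting an element of B with the same leading part lowers the degree; at d = 0 the symbol,
  -- and so u, is zero.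
  have hmain : ∀ d, ∀ u : invariants W, leftSymbol W c u ∈ lowSymbols n d → u ∈ B := by
    intro d
    induction d with
    | zero =>
      intro u hu
      have h1 : u = 0 := symbol_injective ((eq_zero_of_mem_lowSymbols_zero hu).trans
        (map_zero (leftSymbol W c)).symm)
      rw [h1]
      exact zero_mem B
    | succ d ih =>
      intro u hu
      obtain ⟨b, hb, hbu⟩ := hcomp _ (hS _ (hrange.le ⟨u, rfl⟩)) d
      have h1 : u - b ∈ B := ih _ (by
        have := add_mem (sub_symbolComponent_mem hu) hbu
        rwa [sub_add_sub_cancel, ← map_sub] at this)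
      have := add_mem h1 hb
      rwa [sub_add_cancel] at this
  refine eq_top_iff.mpr fun u _ => ?_
  obtain ⟨d, hd⟩ := exists_mem_lowSymbols (leftSymbol W c u)
  exact hmain d u hd

end Torus

end

theorem theorem1p3 (n : ℕ) (W : Subgroup (TorusWeyl n ≃ₐ[ℂ] TorusWeyl n))
    (hW : W ∈ ({TorusWeyl.groupS n, TorusWeyl.groupB n, TorusWeyl.groupD n} :
      Set (Subgroup (TorusWeyl n ≃ₐ[ℂ] TorusWeyl n)))) :
    IsHarishChandra (TorusWeyl.invariantPolynomials W) ∧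
    (∃ (j : TorusWeyl.polynomials n →ₐ[ℂ] RatFuncField n)
        (ι : TorusWeyl.invariants W →ₐ[ℂ] SkewMonoidAlgebra (RatFuncField n) (shiftMonoid n)),
      (∀ i, j ⟨TorusWeyl.t i, TorusWeyl.t_mem_polynomials i⟩ = ratVar i) ∧
      IsGaloisOrder (TorusWeyl.invariantPolynomials W) (shiftMonoid n)
        (j.comp (TorusWeyl.invariantPolynomialsIncl W)) ι) ∧
    Module.Free (TorusWeyl.invariantPolynomials W) (TorusWeyl.invariants W) ∧
    Module.Free (TorusWeyl.invariantPolynomials W).op (TorusWeyl.invariants W) := by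
  obtain ⟨c, H, hM, hH⟩ := TorusWeyl.exists_isModel hW
  obtain ⟨s, hs⟩ := exists_finset_adjoin_eq_top hM
  have hfg : Algebra.adjoin ℂ ((TorusWeyl.invariantPolynomials W : Set (TorusWeyl.invariants W)) ∪
      (s : Set (TorusWeyl.invariants W))) = ⊤ :=
    top_le_iff.mp (hs.ge.trans (Algebra.adjoin_mono Set.subset_union_right))
  exact ⟨isHarishChandra_invariantPolynomials hM,
    ⟨coeffEmb n, invariantsEmb W c, coeffEmb_t, isGaloisOrder hM ⟨s, hfg⟩⟩,
    free_invariants hM hH⟩
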